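/- Let $p>3$ be a prime. Let $M_1=\langle\rho,\sigma,\tau\mid\rho^p=\sigma^p=\tau^p=1,\ \sigma\rho=\rho\sigma,\ \tau\rho=\rho\tau,\ \tau\sigma=\rho\sigma\tau\rangle$ be the Heisenberg group of order $p^3$. A skew brace is a set $B$ with two group structures $\oplus,\odot$ such that $a\odot(b\oplus c)=(a\odot b)\ominus a\oplus(a\odot c)$. It is a $G$-skew brace of type $N$ if $(B,\odot)\cong G$ and $(B,\oplus)\cong N$. Put $\lambda_a(b)=\ominus a\oplus(a\odot b)$ and let $|\varTheta|$ denote the number of distinct maps $\lambda_a$ with $a\in B$. A regular subgroup $H$ of $\mathrm{Hol}(N)=N\rtimes\mathrm{Aut}(N)$ (acting on $N$ by $(\eta\alpha)(x)=\eta\,\alpha(x)$) gives a skew brace of type $N$ by identifying $H$ with $N$ through $g\mapsto g(1)$; its automorphisms are automorphisms of $N$, and $|\varTheta|$ is the order of the image of $H$ in $\mathrm{Aut}(N)$. Let $\alpha_1,\alpha_2,\alpha_3\in\mathrm{Aut}(M_1)$ be given by $\alpha_1:\sigma\mapsto\rho\sigma,\ \tau\mapsto\tau$; $\alpha_2:\sigma\mapsto\sigma\tau,\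 \tau\mapsto\tau$; $\alpha_3:\sigma\mapsto\sigma,\ \tau\mapsto\rho\tau$. Regard $\begin{pmatrix}a&b\\c&d\end{pmatrix}\in\mathrm{GL}_2(\mathbb F_p)$ as the automorphism $\sigma\mapsto\rho^{ac/2}\sigma^a\tau^c$, $\tau\mapsto\rho^{bd/2}\sigma^b\tau^d$ of $M_1$. All parameters below lie in $\mathbb F_p$. Consider the subgroups of $\mathrm{Hol}(M_1)$ $$A_{u_2,u_3}=\langle\rho,\sigma\alpha_1,\sigma^{u_2}\tau^{u_3}\alpha_3\rangle,\quad B_{v_2}=\langle\rho,\tau^{-v_2}\alpha_1,\sigma^{v_2}\alpha_3\rangle,\quad C_{x_3,a}=\langle\rho,\tau^{x_3}\alpha_1,\sigma\alpha_2\alpha_3^{a}\rangle .$$ (1) Up to isomorphism there are exactly $(2p-3)p$ $M_1$-skew braces of type $M_1$ with $|\varTheta|=p^2$. They are given by the following subgroups, which are regular, isomorphic to $M_1$, have image of order $p^2$ in $\mathrm{Aut}(M_1)$, and give pairwise non-isomorphic skew braces: $A_{u_2,u_3}$ with $u_3\ne0$, $u_2\neq u_3$; $B_{v_2}$ with $v_2\ne0,2$;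 $C_{x_3,a}$ with $x_3\neq0$, $ax_3\ne1+x_3$. (2) Up to isomorphism there are exactly $2p-1$ $C_p^3$-skew braces of type $M_1$ with $|\varTheta|=p^2$. They are given by the following subgroups, which are regular, isomorphic to $C_p^3$, have image of order $p^2$ in $\mathrm{Aut}(M_1)$, and give pairwise non-isomorphic skew braces: $A_{u,u}$ with $u\ne0$; $B_2$; $C_{x_3,a}$ with $x_3\ne0$, $ax_3=1+x_3$. (3) The automorphism groups of the skew braces, as sets of elements of $\mathrm{Aut}(M_1)$, are as follows. For $A_{u_2,u_3}$ with $u_3\ne0$: all $\alpha_1^{r_1}\alpha_3^{r_3}\begin{pmatrix}b_1&b_2\\-b_2u_3&b_1+b_2u_2\end{pmatrix}$ with invertible matrix. The order is $(p-1)p^3$ if $u_2^2-4u_3=0$, $(p-1)^2p^2$ if $u_2^2-4u_3$ is a nonzero square, and $(p^2-1)p^2$ if $u_2^2-4u_3$ is not a square. For $B_{v_2}$ with $v_2\ne0$: all of $\mathrm{Aut}(M_1)$, which consists of the elements $\alpha_1^{r_1}\alpha_3^{r_3}\beta$ with $\beta\in\mathrm{GL}_2(\mathbb F_p)$ and has order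 $(p^2-1)(p^2-p)p^2$. For $C_{x_3,a}$ with $x_3\ne0$: all $\alpha_1^{r_1}\alpha_3^{r_3}\begin{pmatrix}b_1&0\\b_3&b_1^2\end{pmatrix}$ with $b_1\neq0$ and $r_3=(a+x_3^{-1})b_1^{-1}b_3+\tfrac12(b_1-1)(1+a-x_3^{-1})$. The order is $(p-1)p^2$. (4) Let $L/K$ be a finite Galois extension of fields with group $G$. A Hopf-Galois structure on $L/K$ is a finite-dimensional cocommutative $K$-Hopf algebra $H$ acting on $L$, making $L$ an $H$-module algebra, such that $L\otimes_KH\to\mathrm{End}_K(L)$, $x\otimes h\mapsto(z\mapsto x\,h(z))$, is bijective; such structures are counted up to isomorphism of Hopf algebras compatible with the actions on $L$. A regular subgroup $N\subseteq\mathrm{Perm}(G)$ normalised by left translations gives the Hopf-Galois structure $L[N]^G$ (acting by $(\sum_n c_nn)\cdot x=\sum_n c_n\,n^{-1}(1)(x)$), which is said to be of type $N$. The skew brace attached to it is $G$ with its own multiplication as $\odot$ and with the group structure of $N$ carried over along $n\mapsto n(1)$ as $\oplus$; $|\varTheta|$ refers to this skew brace. If $G\cong M_1$, there are exactly $(p^4-p^3-2p^2+2p+1)p$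 Hopf-Galois structures of type $M_1$ on $L/K$ with $|\varTheta|=p^2$. If $G\cong C_p^3$, there are exactly $(p^3-1)(p^2-2)p^2$ of them. -/

import Mathlib

open scoped TensorProduct

universe u v w

/-! ### Skew braces -/

/-- A skew (left) brace: `+` and `*` are group structures (neither needs to be commutative) with
`a * (b + c) = a * b - a + a * c`. -/
class SkewBrace (B : Type u) extends AddGroup B, Group B where
  brace_property : ∀ a b c : B, a * (b + c) = a * b - a + a * c

namespace SkewBrace

/-- The map `λ_a : b ↦ -a + a * b` of a skew brace. -/
def lam {B : Type u} [SkewBrace B] (a : B) : B → B := fun b => -a + a * b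

/-- The number `|Θ|`: the size of the image of the multiplicative group in the automorphism group
of the additive group under `a ↦ λ_a`. -/
noncomputable def thetaCard (B : Type u) [SkewBrace B] : ℕ :=
  Nat.card (Set.range (lam : B → B → B))

/-- `B` is a `G`-skew brace of type `N` with `|Θ| = r`. -/
def IsBraceOf (G : Type v) (N : Type w) [Group G] [Group N] (r : ℕ) (B : Type u) [SkewBrace B] :
    Prop :=
  Nonempty (B ≃* G) ∧ Nonempty (B ≃+ Additive N) ∧ thetaCard B = r

/-- A skew brace bundled with its underlying set. -/
structure Bundled where
  carrier : Type u
  [inst : SkewBrace carrier]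

attribute [instance] Bundled.inst

/-- Isomorphism of skew braces. (`B ≃+* C` is Mathlib's type of bijections `B → C` that preserve
`+` and `*`; no ring structure is involved.) -/
instance isoSetoid : Setoid Bundled.{u} where
  r B C := Nonempty (B.carrier ≃+* C.carrier)
  iseqv :=
    { refl := fun _ => ⟨RingEquiv.refl _⟩
      symm := fun ⟨e⟩ => ⟨e.symm⟩
      trans := fun ⟨e⟩ ⟨f⟩ => ⟨e.trans f⟩ }

/-- The number of isomorphism classes of `G`-skew braces of type `N` with `|Θ| = r`. -/
noncomputable def numClasses (G : Type v) (N : Type w) [Group G] [Group N] (r : ℕ) : ℕ :=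
  Nat.card {q : Quotient isoSetoid.{u} //
    ∃ B : Bundled.{u}, Quotient.mk isoSetoid B = q ∧ IsBraceOf G N r B.carrier}

end SkewBrace

/-! ### The holomorph and its regular subgroups -/

/-- The holomorph `N ⋊ Aut N`. -/
abbrev Hol (N : Type u) [Group N] : Type u := N ⋊[MonoidHom.id (MulAut N)] MulAut N

namespace Hol

variable {N : Type u} [Group N]

/-- The element `η α` of the holomorph acts on `N` by `x ↦ η * α x`. -/
def act (g : Hol N) (x : N) : N := g.left * g.right x

theorem act_mul (g h : Hol N) (x : N) : act (g * h) x = act g (act h x) := by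
  simp [act, mul_assoc]

theorem act_one (x : N) : act (1 : Hol N) x = x := by simp [act]

/-- A subgroup of the holomorph is regular if it acts simply transitively on `N`. -/
def IsRegular (H : Subgroup (Hol N)) : Prop := ∀ x y : N, ∃! g : Hol N, g ∈ H ∧ act g x = y

/-- The natural projection `Hol N → Aut N`. -/
def Theta (N : Type u) [Group N] : Hol N →* MulAut N := SemidirectProduct.rightHom

/-- The underlying set of the skew brace of a regular subgroup `H` of the holomorph of `N`;
the bijection `g ↦ g(1)` identifies `H` with `N`. -/
def Brace (H : Subgroup (Hol N)) (_hH : IsRegular H) : Type u := N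

namespace Brace

/-- The identification of `N` with the underlying set of the skew brace. -/
def of (H : Subgroup (Hol N)) (hH : IsRegular H) : N ≃ Brace H hH := Equiv.refl N

variable (H : Subgroup (Hol N)) (hH : IsRegular H)

/-- The unique element of `H` that maps `1` to `a`. -/
noncomputable def elt (a : N) : Hol N := (hH 1 a).choose

theorem elt_mem (a : N) : elt H hH a ∈ H := (hH 1 a).choose_spec.1.1

theorem act_elt (a : N) : act (elt H hH a) 1 = a := (hH 1 a).choose_spec.1.2

theorem eq_elt {a : N} {g : Hol N} (hg : g ∈ H) (h : act g 1 = a) : g = elt H hH a :=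
  (hH 1 a).choose_spec.2 g ⟨hg, h⟩

theorem elt_left (a : N) : (elt H hH a).left = a := by
  have := act_elt H hH a
  simpa [act] using this

/-- The additive group of the skew brace is `N`. -/
instance : AddGroup (Brace H hH) := inferInstanceAs (AddGroup (Additive N))

theorem elt_act (a b : N) : elt H hH (act (elt H hH a) b) = elt H hH a * elt H hH b := by
  refine (eq_elt H hH (mul_mem (elt_mem H hH a) (elt_mem H hH b)) ?_).symm
  rw [act_mul, act_elt]

theorem mul_assoc_aux (a b c : N) : act (elt H hH (act (elt H hH a) b)) c =
    act (elt H hH a) (act (elt H hH b) c) := by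
  rw [elt_act, act_mul]

theorem one_mul_aux (a : N) : act (elt H hH 1) a = a := by
  rw [← eq_elt H hH (one_mem H) (act_one 1), act_one]

theorem inv_mul_aux (a : N) : act (elt H hH (act (elt H hH a)⁻¹ 1)) a = 1 := by
  rw [← eq_elt H hH (inv_mem (elt_mem H hH a)) rfl]
  nth_rewrite 2 [← act_elt H hH a]
  rw [← act_mul, inv_mul_cancel, act_one]

theorem brace_aux (a b c : N) : act (elt H hH a) (b * c) =
    act (elt H hH a) b / a * act (elt H hH a) c := by
  simp [act, elt_left, div_eq_mul_inv, mul_assoc]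

/-- The multiplicative group of the skew brace is `H`, carried over to `N` along `g ↦ g(1)`. -/
noncomputable instance : Group (Brace H hH) :=
  letI : Mul (Brace H hH) :=
    ⟨fun a b => of H hH (act (elt H hH ((of H hH).symm a)) ((of H hH).symm b))⟩
  letI : One (Brace H hH) := ⟨of H hH 1⟩
  letI : Inv (Brace H hH) := ⟨fun a => of H hH (act (elt H hH ((of H hH).symm a))⁻¹ 1)⟩
  Group.ofLeftAxioms (mul_assoc_aux H hH) (one_mul_aux H hH) (inv_mul_aux H hH)

noncomputable instance : SkewBrace (Brace H hH) where
  brace_property := brace_aux H hH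

end Brace

end Hol

/-! ### The group `M₁` and its automorphisms -/

/-- The Heisenberg group of order `p³`: `⟨a, b, c⟩` stands for `ρ ^ a * σ ^ b * τ ^ c`, and the
multiplication is the one forced by `ρ` central and `τ * σ = ρ * σ * τ`. -/
@[ext]
structure Heis (p : ℕ) where
  a : ZMod p
  b : ZMod p
  c : ZMod p

namespace Heis

variable {p : ℕ}

instance : Mul (Heis p) := ⟨fun x y => ⟨x.a + y.a + x.c * y.b, x.b + y.b, x.c + y.c⟩⟩
instance : One (Heis p) := ⟨⟨0, 0, 0⟩⟩
instance : Inv (Heis p) := ⟨fun x => ⟨-x.a + x.c * x.b, -x.b, -x.c⟩⟩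

@[simp] theorem mul_a (x y : Heis p) : (x * y).a = x.a + y.a + x.c * y.b := rfl
@[simp] theorem mul_b (x y : Heis p) : (x * y).b = x.b + y.b := rfl
@[simp] theorem mul_c (x y : Heis p) : (x * y).c = x.c + y.c := rfl
@[simp] theorem one_a : (1 : Heis p).a = 0 := rfl
@[simp] theorem one_b : (1 : Heis p).b = 0 := rfl
@[simp] theorem one_c : (1 : Heis p).c = 0 := rfl
@[simp] theorem inv_a (x : Heis p) : (x⁻¹).a = -x.a + x.c * x.b := rfl
@[simp] theorem inv_b (x : Heis p) : (x⁻¹).b = -x.b := rfl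
@[simp] theorem inv_c (x : Heis p) : (x⁻¹).c = -x.c := rfl

instance : Group (Heis p) :=
  Group.ofLeftAxioms (fun x y z => by ext <;> simp <;> ring) (fun x => by ext <;> simp)
    (fun x => by ext <;> simp)

variable (p) in
def rho : Heis p := ⟨1, 0, 0⟩
variable (p) in
def sigma : Heis p := ⟨0, 1, 0⟩
variable (p) in
def tau : Heis p := ⟨0, 0, 1⟩

theorem sigma_rho : sigma p * rho p = rho p * sigma p := by ext <;> simp [sigma, rho]
theorem tau_rho : tau p * rho p = rho p * tau p := by ext <;> simp [tau, rho]
theorem tau_sigma : tau p * sigma p = rho p * sigma p * tau p := by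
  ext <;> simp [sigma, tau, rho]

theorem rho_pow (n : ℕ) : rho p ^ n = ⟨n, 0, 0⟩ := by
  induction n with
  | zero => ext <;> simp
  | succ n ih => rw [pow_succ, ih]; ext <;> simp [rho]
theorem sigma_pow (n : ℕ) : sigma p ^ n = ⟨0, n, 0⟩ := by
  induction n with
  | zero => ext <;> simp
  | succ n ih => rw [pow_succ, ih]; ext <;> simp [sigma]
theorem tau_pow (n : ℕ) : tau p ^ n = ⟨0, 0, n⟩ := by
  induction n with
  | zero => ext <;> simp
  | succ n ih => rw [pow_succ, ih]; ext <;> simp [tau]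

theorem rho_pow_p : rho p ^ p = 1 := by rw [rho_pow]; ext <;> simp
theorem sigma_pow_p : sigma p ^ p = 1 := by rw [sigma_pow]; ext <;> simp
theorem tau_pow_p : tau p ^ p = 1 := by rw [tau_pow]; ext <;> simp

/-- The three generators generate the group, by the normal form `ρ ^ a * σ ^ b * τ ^ c`. -/
theorem normal_form [NeZero p] (x : Heis p) :
    x = rho p ^ x.a.val * sigma p ^ x.b.val * tau p ^ x.c.val := by
  rw [rho_pow, sigma_pow, tau_pow]; ext <;> simp

variable (p) in
theorem card_heis : Nat.card (Heis p) = p ^ 3 := by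
  let e : Heis p ≃ ZMod p × ZMod p × ZMod p :=
    { toFun := fun x => (x.a, x.b, x.c)
      invFun := fun y => ⟨y.1, y.2.1, y.2.2⟩
      left_inv := fun _ => rfl
      right_inv := fun _ => rfl }
  rw [Nat.card_congr e, Nat.card_prod, Nat.card_prod, Nat.card_zmod]
  ring

variable (p) in
/-- The automorphism `α₁`: `σ ↦ ρ * σ`, `τ ↦ τ`. -/
def alpha1 : MulAut (Heis p) where
  toFun x := ⟨x.a + x.b, x.b, x.c⟩
  invFun x := ⟨x.a - x.b, x.b, x.c⟩
  left_inv x := by ext <;> simp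
  right_inv x := by ext <;> simp
  map_mul' x y := by ext <;> simp; ring

variable (p) in
/-- The automorphism `α₃`: `σ ↦ σ`, `τ ↦ ρ * τ`. -/
def alpha3 : MulAut (Heis p) where
  toFun x := ⟨x.a + x.c, x.b, x.c⟩
  invFun x := ⟨x.a - x.c, x.b, x.c⟩
  left_inv x := by ext <;> simp
  right_inv x := by ext <;> simp
  map_mul' x y := by ext <;> simp; ring

variable [Fact p.Prime]

/-- The map `σ ↦ ρ ^ (ac/2) * σ ^ a * τ ^ c`, `τ ↦ ρ ^ (bd/2) * σ ^ b * τ ^ d`, `ρ ↦ ρ ^ (ad - bc)`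
attached to the matrix with rows `(a, b)` and `(c, d)`, on `ρ ^ x * σ ^ y * τ ^ z`. -/
def lin (A : Matrix (Fin 2) (Fin 2) (ZMod p)) (x : Heis p) : Heis p :=
  ⟨A.det * x.a + (A 0 0 * A 1 0 * x.b ^ 2 + A 0 1 * A 1 1 * x.c ^ 2) / 2 +
      A 0 1 * A 1 0 * x.b * x.c,
    A 0 0 * x.b + A 0 1 * x.c, A 1 0 * x.b + A 1 1 * x.c⟩

theorem lin_one (x : Heis p) : lin 1 x = x := by ext <;> simp [lin]

variable [Fact (3 < p)]

theorem two_ne_zero' : (2 : ZMod p) ≠ 0 := by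
  have h3 : 3 < p := Fact.out
  intro h
  have : ((2 : ℕ) : ZMod p) = 0 := by exact_mod_cast h
  rw [ZMod.natCast_eq_zero_iff] at this
  have := Nat.le_of_dvd (by norm_num) this
  omega

variable (p) in
/-- The automorphism `α₂`: `σ ↦ σ * τ`, `τ ↦ τ`. -/
def alpha2 : MulAut (Heis p) where
  toFun x := ⟨x.a + x.b * (x.b - 1) / 2, x.b, x.c + x.b⟩
  invFun x := ⟨x.a - x.b * (x.b - 1) / 2, x.b, x.c - x.b⟩
  left_inv x := by ext <;> simp
  right_inv x := by ext <;> simp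
  map_mul' x y := by
    have := two_ne_zero' (p := p)
    ext <;> simp
    · field_simp; ring
    · ring

theorem lin_lin (A B : Matrix (Fin 2) (Fin 2) (ZMod p)) (x : Heis p) :
    lin A (lin B x) = lin (A * B) x := by
  have := two_ne_zero' (p := p)
  ext <;> simp [lin, Matrix.det_fin_two, Matrix.mul_apply, Fin.sum_univ_two]
  · field_simp; ring
  · ring
  · ring

theorem lin_mul (A : Matrix (Fin 2) (Fin 2) (ZMod p)) (x y : Heis p) :
    lin A (x * y) = lin A x * lin A y := by
  have := two_ne_zero' (p := p)
  ext <;> simp [lin, Matrix.det_fin_two]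
  · field_simp; ring
  · ring
  · ring

/-- The automorphism attached to an invertible matrix. -/
noncomputable def autGL (A : GL (Fin 2) (ZMod p)) : MulAut (Heis p) where
  toFun := lin (A : Matrix (Fin 2) (Fin 2) (ZMod p))
  invFun := lin ((A⁻¹ : GL (Fin 2) (ZMod p)) : Matrix (Fin 2) (Fin 2) (ZMod p))
  left_inv x := by rw [lin_lin, ← Units.val_mul, inv_mul_cancel, Units.val_one, lin_one]
  right_inv x := by rw [lin_lin, ← Units.val_mul, mul_inv_cancel, Units.val_one, lin_one]
  map_mul' := lin_mul _

/-- The element `η α` of the holomorph. -/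
def hol (η : Heis p) (α : MulAut (Heis p)) : Hol (Heis p) := ⟨η, α⟩

/-- Parameters for the three families of subgroups of the holomorph. -/
inductive Param (p : ℕ) where
  | A (u₂ u₃ : ZMod p)
  | B (v₂ : ZMod p)
  | C (x₃ a : ZMod p)

/-- The subgroups `⟨ρ, σα₁, σ^u₂ τ^u₃ α₃⟩`, `⟨ρ, τ^(-v₂) α₁, σ^v₂ α₃⟩` and
`⟨ρ, τ^x₃ α₁, σ α₂ α₃^a⟩`. -/
def Param.subgroup : Param p → Subgroup (Hol (Heis p))
  | .A u₂ u₃ => Subgroup.closure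
      {hol (rho p) 1, hol (sigma p) (alpha1 p),
        hol (sigma p ^ u₂.val * tau p ^ u₃.val) (alpha3 p)}
  | .B v₂ => Subgroup.closure
      {hol (rho p) 1, hol ((tau p ^ v₂.val)⁻¹) (alpha1 p), hol (sigma p ^ v₂.val) (alpha3 p)}
  | .C x₃ a => Subgroup.closure
      {hol (rho p) 1, hol (tau p ^ x₃.val) (alpha1 p),
        hol (sigma p) (alpha2 p * alpha3 p ^ a.val)}

/-- The parameters of the `M₁`-skew braces. -/
def Param.IsHeis : Param p → Prop
  | .A u₂ u₃ => u₃ ≠ 0 ∧ u₂ ≠ u₃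
  | .B v₂ => v₂ ≠ 0 ∧ v₂ ≠ 2
  | .C x₃ a => x₃ ≠ 0 ∧ a * x₃ ≠ 1 + x₃

/-- The parameters of the `C_p³`-skew braces. -/
def Param.IsElem : Param p → Prop
  | .A u₂ u₃ => u₃ ≠ 0 ∧ u₂ = u₃
  | .B v₂ => v₂ = 2
  | .C x₃ a => x₃ ≠ 0 ∧ a * x₃ = 1 + x₃

/-- `α ∈ Aut(N)` is an automorphism of the skew brace of the regular subgroup `H`. -/
def IsBraceAut {H : Subgroup (Hol (Heis p))} (hH : Hol.IsRegular H) (α : MulAut (Heis p)) : Prop :=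
  ∃ φ : RingAut (Hol.Brace H hH), ∀ x, φ (Hol.Brace.of H hH x) = Hol.Brace.of H hH (α x)

end Heis

/-- The elementary abelian group `C_p³`. -/
abbrev ElemAb3 (p : ℕ) : Type := Fin 3 → Multiplicative (ZMod p)

/-! ### Hopf-Galois structures -/

/-- A Hopf-Galois structure on `L/K`: a finite-dimensional cocommutative `K`-Hopf algebra `H` with
an action on `L` that makes `L` an `H`-module algebra and for which
`L ⊗ H → End_K(L)`, `x ⊗ h ↦ (z ↦ x * h(z))`, is bijective. -/
structure HopfGaloisStructure (K : Type u) (L : Type v) [Field K] [Field L] [Algebra K L] where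
  H : Type v
  [ring : Ring H]
  [hopf : HopfAlgebra K H]
  [finite : Module.Finite K H]
  [cocomm : Coalgebra.IsCocomm K H]
  /-- the action of `H` on `L` -/
  act : H →ₐ[K] Module.End K L
  act_one : ∀ h : H, act h 1 = algebraMap K L (Coalgebra.counit (R := K) h)
  act_mul : ∀ (h : H) (x y : L), act h (x * y) =
    LinearMap.mul' K L (TensorProduct.map (act.toLinearMap.flip x) (act.toLinearMap.flip y)
      (Coalgebra.comul (R := K) h))
  galois : Function.Bijective (TensorProduct.lift
    ((LinearMap.mul K (Module.End K L)).compl₁₂ (Algebra.lmul K L).toLinearMap act.toLinearMap))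

namespace HopfGaloisStructure

attribute [instance] ring hopf finite cocomm

variable (K : Type u) (L : Type v) [Field K] [Field L] [Algebra K L]

/-- Two Hopf-Galois structures are identified if there is an isomorphism of Hopf algebras that is
compatible with the actions on `L`. -/
instance isoSetoid : Setoid (HopfGaloisStructure K L) where
  r S T := ∃ e : S.H ≃ₐc[K] T.H, ∀ h, T.act (e h) = S.act h
  iseqv :=
    { refl := fun S => ⟨BialgEquiv.refl K S.H, fun _ => rfl⟩
      symm := fun {S T} ⟨e, he⟩ => ⟨e.symm, fun h => by
        rw [← he (e.symm h), BialgEquiv.apply_symm_apply]⟩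
      trans := fun {S T U} ⟨e, he⟩ ⟨f, hf⟩ => ⟨e.trans f, fun h => by
        rw [← he, ← hf]; rfl⟩ }

end HopfGaloisStructure

/-- A subgroup of `Perm(G)` is regular and normalised by the left translations of `G`. -/
structure IsRegularNormalised {G : Type u} [Group G] (M : Subgroup (Equiv.Perm G)) : Prop where
  regular : ∀ x y : G, ∃! n : Equiv.Perm G, n ∈ M ∧ n x = y
  normalised : ∀ (g : G), ∀ n ∈ M, Equiv.mulLeft g * n * (Equiv.mulLeft g)⁻¹ ∈ M

namespace IsRegularNormalised

variable {G : Type u} [Group G] {M : Subgroup (Equiv.Perm G)}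

/-- Conjugation by a left translation, as a map `M → M`. -/
def conj (hM : IsRegularNormalised M) (g : G) (n : M) : M :=
  ⟨Equiv.mulLeft g * n * (Equiv.mulLeft g)⁻¹, hM.normalised g n n.2⟩

/-- The underlying set, which is `G`, of the skew brace of a regular subgroup of `Perm(G)`
normalised by left translations. -/
def Brace (_hM : IsRegularNormalised M) : Type u := G

variable (hM : IsRegularNormalised M)

/-- The multiplicative group of the skew brace is `G`. -/
instance : Group hM.Brace := inferInstanceAs (Group G)

/-- The unique element of `M` that maps `1` to `a`. -/
noncomputable def elt (a : G) : Equiv.Perm G := (hM.regular 1 a).choose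

theorem elt_mem (a : G) : hM.elt a ∈ M := (hM.regular 1 a).choose_spec.1.1

theorem elt_one (a : G) : hM.elt a 1 = a := (hM.regular 1 a).choose_spec.1.2

theorem eq_elt {a : G} {n : Equiv.Perm G} (hn : n ∈ M) (h : n 1 = a) : n = hM.elt a :=
  (hM.regular 1 a).choose_spec.2 n ⟨hn, h⟩

theorem elt_elt (a b : G) : hM.elt (hM.elt a b) = hM.elt a * hM.elt b := by
  refine (hM.eq_elt (mul_mem (hM.elt_mem a) (hM.elt_mem b)) ?_).symm
  rw [Equiv.Perm.mul_apply, hM.elt_one]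

theorem add_assoc_aux (a b c : G) : hM.elt (hM.elt a b) c = hM.elt a (hM.elt b c) := by
  rw [elt_elt, Equiv.Perm.mul_apply]

theorem zero_add_aux (a : G) : hM.elt 1 a = a := by
  rw [← hM.eq_elt (one_mem M) (Equiv.Perm.one_apply 1), Equiv.Perm.one_apply]

theorem elt_inv (a : G) : hM.elt ((hM.elt a)⁻¹ 1) = (hM.elt a)⁻¹ :=
  (hM.eq_elt (inv_mem (hM.elt_mem a)) rfl).symm

theorem neg_add_aux (a : G) : hM.elt ((hM.elt a)⁻¹ 1) a = 1 := by
  rw [elt_inv, Equiv.Perm.inv_eq_iff_eq, hM.elt_one]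

theorem brace_aux (x y z : G) :
    x * hM.elt y z = hM.elt (hM.elt (x * y) ((hM.elt x)⁻¹ 1)) (x * z) := by
  have h : hM.elt (x * y) = Equiv.mulLeft x * hM.elt y * (Equiv.mulLeft x)⁻¹ * hM.elt x := by
    refine (hM.eq_elt (mul_mem (hM.normalised x _ (hM.elt_mem y)) (hM.elt_mem x)) ?_).symm
    simp [hM.elt_one]
  rw [elt_elt, elt_inv, h]
  simp

/-- The additive group of the skew brace is `M`, carried over to `G` along `n ↦ n(1)`. -/
noncomputable instance : AddGroup hM.Brace :=
  letI : Add hM.Brace := ⟨fun a b => hM.elt a b⟩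
  letI : Zero hM.Brace := ⟨(1 : G)⟩
  letI : Neg hM.Brace := ⟨fun a => (hM.elt a)⁻¹ (1 : G)⟩
  AddGroup.ofLeftAxioms hM.add_assoc_aux hM.zero_add_aux hM.neg_add_aux

noncomputable instance : SkewBrace hM.Brace where
  brace_property a b c := (hM.brace_aux a b c).trans (by rw [sub_eq_add_neg]; rfl)

end IsRegularNormalised

namespace HopfGaloisStructure

variable {K : Type u} {L : Type v} [Field K] [Field L] [Algebra K L]

/-- The Hopf algebra `L[M]^G`, as a subset of the group algebra: `G = Gal(L/K)` acts on `L` as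
field automorphisms and on `M` by conjugation with left translations. -/
def fixedElements {M : Subgroup (Equiv.Perm (L ≃ₐ[K] L))} (hM : IsRegularNormalised M) :
    Set (MonoidAlgebra L M) :=
  {c | ∀ (g : L ≃ₐ[K] L) (n : M), c.coeff (hM.conj g n) = g (c.coeff n)}

/-- The action of an element of the group algebra on `L`: `(∑ cₙ n) · x = ∑ cₙ n⁻¹(1)(x)`. -/
noncomputable def groupAlgebraAct {M : Subgroup (Equiv.Perm (L ≃ₐ[K] L))}
    (c : MonoidAlgebra L M) (x : L) : L :=
  c.coeff.sum fun n a => a * ((n : Equiv.Perm (L ≃ₐ[K] L))⁻¹ 1) x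

/-- The Hopf-Galois structure `S` is the one given by `M`, i.e. by `L[M]^G`. Since the action on `L`
of the Hopf algebra of a Hopf-Galois structure is faithful and determines all its operations, this
is expressed by saying that the two act on `L` through the same set of operators. -/
def GivenBy (S : HopfGaloisStructure K L) {M : Subgroup (Equiv.Perm (L ≃ₐ[K] L))}
    (hM : IsRegularNormalised M) : Prop :=
  {f : L → L | ∃ h : S.H, f = S.act h} = groupAlgebraAct '' fixedElements hM

/-- The Hopf-Galois structure has type `N`, and the skew brace attached to it has `|Θ| = r`. -/
def HasType (S : HopfGaloisStructure K L) (N : Type w) [Group N] (r : ℕ) : Prop :=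
  ∃ (M : Subgroup (Equiv.Perm (L ≃ₐ[K] L))) (hM : IsRegularNormalised M),
    S.GivenBy hM ∧ Nonempty (M ≃* N) ∧ SkewBrace.thetaCard hM.Brace = r

variable (K L) in
/-- The number of Hopf-Galois structures on `L/K` of type `N` with `|Θ| = r`. -/
noncomputable def number (N : Type w) [Group N] (r : ℕ) : ℕ :=
  Nat.card {q : Quotient (isoSetoid K L) //
    ∃ S : HopfGaloisStructure K L, Quotient.mk (isoSetoid K L) S = q ∧ S.HasType N r}

end HopfGaloisStructure

/-!
A skew brace with additive group `N` is a gamma function `γ : N → Aut N`, i.e. a map with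
`γ (n * γ n m) = γ n * γ m`, taken up to conjugation by automorphisms of `N`; its automorphisms are
the automorphisms of `N` that carry `γ` to itself.

Let `N = M₁`. As `|Θ| = p²`, the image of `γ` is an abelian `p`-group, so its image in `GL₂(p)`
fixes a common vector. After a change of basis every `γ n` is unipotent and fixes `ρ`, so `γ` is
given by three functions of the two coordinates of `n` modulo the centre. The functional equation
makes these additive up to an explicit quadratic correction, and normalising the remaining
constants leaves the families `A`, `B` and `C`. For each of them the multiplicative group is again
a central extension of `C_p²` by `C_p`, whose commutator is that of `M₁` times a constant `κ`; so
it is `M₁` or `C_p³` according to whether `κ ≠ 0` or `κ = 0`.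

By Galois descent, Hopf-Galois structures on `L/K` correspond to the regular subgroups of `Perm G`
normalised by left translations. Those belonging to a given skew brace `B` number
`|Aut G| / |Aut B|`, and the sum of these quotients over the list is evaluated with the quadratic
character of the discriminant `u₂² - 4u₃`.
-/

/-! ### Galois descent for Hopf algebras -/

namespace GaloisDescent

open TensorProduct

section BaseChange

variable {K L X Y V W : Type*} [Field K] [Field L] [Algebra K L]
  [AddCommGroup X] [Module K X] [AddCommGroup Y] [Module K Y]
  [AddCommGroup V] [Module K V] [Module L V] [IsScalarTower K L V]
  [AddCommGroup W] [Module K W] [Module L W] [IsScalarTower K L W]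

theorem isBaseChange_of_basis {ι : Type*} {f : X →ₗ[K] V} (b : Module.Basis ι K X)
    (B : Module.Basis ι L V) (h : ∀ i, f (b i) = B i) : IsBaseChange L f := by
  let e : L ⊗[K] X ≃ₗ[L] V := (Algebra.TensorProduct.basis L b).equiv B (Equiv.refl ι)
  have he : (e.toLinearMap.restrictScalars K).comp (TensorProduct.mk K L X 1) = f :=
    b.ext fun i => by
      have := (Algebra.TensorProduct.basis L b).equiv_apply i B (Equiv.refl ι)
      rw [Algebra.TensorProduct.basis_apply] at this
      exact this.trans (h i).symm
  exact .of_equiv e fun x => LinearMap.congr_fun he x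

theorem injective_of_isBaseChange {f : X →ₗ[K] V} (hf : IsBaseChange L f) :
    Function.Injective f := by
  let b := Module.Basis.ofVectorSpace K X
  refine fun x y hxy => b.repr.injective (Finsupp.ext fun i => (algebraMap K L).injective ?_)
  rw [← hf.basis_repr_comp_apply b, ← hf.basis_repr_comp_apply b, hxy]

variable (L) in
/-- The map `x ⊗ y ↦ f x ⊗ g y` from a tensor product over `K` to a tensor product over `L`. -/
noncomputable def tensorMap (f : X →ₗ[K] V) (g : Y →ₗ[K] W) : X ⊗[K] Y →ₗ[K] V ⊗[L] W :=
  (mapOfCompatibleSMul L K K V W).comp (TensorProduct.map f g)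

@[simp]
theorem tensorMap_tmul (f : X →ₗ[K] V) (g : Y →ₗ[K] W) (x : X) (y : Y) :
    tensorMap L f g (x ⊗ₜ y) = f x ⊗ₜ g y := rfl

theorem isBaseChange_tensorMap {f : X →ₗ[K] V} {g : Y →ₗ[K] W} (hf : IsBaseChange L f)
    (hg : IsBaseChange L g) : IsBaseChange L (tensorMap L f g) := by
  let b := Module.Basis.ofVectorSpace K X
  let c := Module.Basis.ofVectorSpace K Y
  refine isBaseChange_of_basis (b.tensorProduct c) ((hf.basis b).tensorProduct (hg.basis c)) ?_
  simp [Module.Basis.tensorProduct_apply', IsBaseChange.basis_apply]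

section Map

variable {X' V' : Type*} [AddCommGroup X'] [Module K X'] [AddCommGroup V'] [Module K V']
  [Module L V'] [IsScalarTower K L V'] (f : X →ₗ[K] V) (f' : X' →ₗ[K] V') (g : Y →ₗ[K] W)
  {u : X →ₗ[K] X'} {u' : V →ₗ[L] V'}

theorem tensorMap_rTensor (h : ∀ x, f' (u x) = u' (f x)) (z : X ⊗[K] Y) :
    tensorMap L f' g (u.rTensor Y z) = u'.rTensor W (tensorMap L f g z) := by
  induction z with
  | zero => simp only [map_zero]
  | add z z' hz hz' => simp only [map_add, hz, hz']
  | tmul x y => simp only [LinearMap.rTensor_tmul, tensorMap_tmul, h]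

theorem tensorMap_lTensor (h : ∀ x, f' (u x) = u' (f x)) (z : Y ⊗[K] X) :
    tensorMap L g f' (u.lTensor Y z) = u'.lTensor W (tensorMap L g f z) := by
  induction z with
  | zero => simp only [map_zero]
  | add z z' hz hz' => simp only [map_add, hz, hz']
  | tmul x y => simp only [LinearMap.lTensor_tmul, tensorMap_tmul, h]

end Map

theorem tensorMap_assoc {Z U : Type*} [AddCommGroup Z] [Module K Z] [AddCommGroup U] [Module K U]
    [Module L U] [IsScalarTower K L U] (f : X →ₗ[K] V) (g : Y →ₗ[K] W) (h : Z →ₗ[K] U)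
    (z : (X ⊗[K] Y) ⊗[K] Z) :
    tensorMap L f (tensorMap L g h) (TensorProduct.assoc K X Y Z z) =
      TensorProduct.assoc L V W U (tensorMap L (tensorMap L f g) h z) := by
  induction z with
  | zero => simp only [map_zero]
  | add z z' hz hz' => simp only [map_add, hz, hz']
  | tmul z t =>
    induction z with
    | zero => simp only [zero_tmul, map_zero]
    | add z z' hz hz' => simp only [add_tmul, map_add, hz, hz']
    | tmul x y => simp only [assoc_tmul, tensorMap_tmul]

theorem tensorMap_comm (f : X →ₗ[K] V) (g : Y →ₗ[K] W) (z : X ⊗[K] Y) :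
    tensorMap L g f (TensorProduct.comm K X Y z) =
      TensorProduct.comm L V W (tensorMap L f g z) := by
  induction z with
  | zero => simp only [map_zero]
  | add z z' hz hz' => simp only [map_add, hz, hz']
  | tmul x y => simp only [comm_tmul, tensorMap_tmul]

theorem apply_lid (f : X →ₗ[K] V) (z : K ⊗[K] X) :
    f (TensorProduct.lid K X z) =
      TensorProduct.lid L V (tensorMap L (Algebra.linearMap K L) f z) := by
  induction z with
  | zero => simp only [map_zero]
  | add z z' hz hz' => simp only [map_add, hz, hz']
  | tmul k x => simp

theorem apply_rid (f : X →ₗ[K] V) (z : X ⊗[K] K) :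
    f (TensorProduct.rid K X z) =
      TensorProduct.rid L V (tensorMap L f (Algebra.linearMap K L) z) := by
  induction z with
  | zero => simp only [map_zero]
  | add z z' hz hz' => simp only [map_add, hz, hz']
  | tmul x k => simp

end BaseChange

section AlgebraForm

variable {K L H A : Type*} [Field K] [Field L] [Algebra K L] [Ring H] [Algebra K H]
  [Ring A] [Algebra K A] [Algebra L A] [IsScalarTower K L A]

theorem tensorMap_mul (f : H →ₐ[K] A) (z w : H ⊗[K] H) :
    tensorMap L f.toLinearMap f.toLinearMap (z * w) =
      tensorMap L f.toLinearMap f.toLinearMap z * tensorMap L f.toLinearMap f.toLinearMap w := by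
  induction z with
  | zero => simp only [zero_mul, map_zero]
  | add z z' hz hz' => simp only [add_mul, map_add, hz, hz']
  | tmul x y =>
    induction w with
    | zero => simp only [mul_zero, map_zero]
    | add w w' hw hw' => simp only [mul_add, map_add, hw, hw']
    | tmul x' y' => simp

theorem apply_mul' (f : H →ₐ[K] A) (z : H ⊗[K] H) :
    f (LinearMap.mul' K H z) =
      LinearMap.mul' L A (tensorMap L f.toLinearMap f.toLinearMap z) := by
  induction z with
  | zero => simp only [map_zero]
  | add z z' hz hz' => simp only [map_add, hz, hz']
  | tmul x y => simp

end AlgebraForm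

section Factor

variable {K X Y V : Type*} [Field K] [AddCommGroup X] [Module K X] [AddCommGroup Y] [Module K Y]
  [AddCommGroup V] [Module K V]

/-- The factorisation of a linear map `g` through an injective linear map `f` whose range contains
that of `g`. -/
noncomputable def factorThrough (f : Y →ₗ[K] V) (hf : Function.Injective f) (g : X →ₗ[K] V)
    (h : ∀ x, g x ∈ LinearMap.range f) : X →ₗ[K] Y :=
  (LinearEquiv.ofInjective f hf).symm.toLinearMap.comp (g.codRestrict _ h)

theorem apply_factorThrough (f : Y →ₗ[K] V) (hf : Function.Injective f) (g : X →ₗ[K] V)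
    (h : ∀ x, g x ∈ LinearMap.range f) (x : X) : f (factorThrough f hf g h x) = g x :=
  congrArg Subtype.val ((LinearEquiv.ofInjective f hf).apply_symm_apply (g.codRestrict _ h x))

end Factor

/-- An algebra map `f : H → A` exhibits the `K`-algebra `H` as a `K`-form of the Hopf algebra `A`
over `L`: it identifies `A` with `L ⊗ H`, and the structure maps of `A` are defined over `K`. -/
structure IsHopfForm {K L H A : Type*} [Field K] [Field L] [Algebra K L] [Ring H] [Algebra K H]
    [Ring A] [Algebra K A] [HopfAlgebra L A] [IsScalarTower K L A] (f : H →ₐ[K] A) : Prop where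
  isBaseChange : IsBaseChange L f.toLinearMap
  counit_mem : ∀ x, Coalgebra.counit (R := L) (f x) ∈ LinearMap.range (Algebra.linearMap K L)
  comul_mem : ∀ x, Coalgebra.comul (R := L) (f x) ∈
    LinearMap.range (tensorMap L f.toLinearMap f.toLinearMap)
  antipode_mem : ∀ x, HopfAlgebra.antipode L (f x) ∈ LinearMap.range f.toLinearMap

namespace IsHopfForm

open Coalgebra HopfAlgebra

variable {K L H A : Type*} [Field K] [Field L] [Algebra K L] [Ring H] [Algebra K H]
  [Ring A] [Algebra K A] [HopfAlgebra L A] [IsScalarTower K L A] {f : H →ₐ[K] A}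
  (hf : IsHopfForm (L := L) f)
include hf

theorem injective : Function.Injective f := injective_of_isBaseChange hf.isBaseChange

theorem tensorMap_injective :
    Function.Injective (tensorMap L f.toLinearMap f.toLinearMap) :=
  injective_of_isBaseChange (isBaseChange_tensorMap hf.isBaseChange hf.isBaseChange)

/-- The counit of a form of a Hopf algebra. -/
noncomputable def counitMap : H →ₗ[K] K :=
  factorThrough (Algebra.linearMap K L) (algebraMap K L).injective
    ((counit.restrictScalars K).comp f.toLinearMap) hf.counit_mem

theorem algebraMap_counitMap (x : H) :
    algebraMap K L (hf.counitMap x) = counit (R := L) (f x) :=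
  apply_factorThrough (Algebra.linearMap K L) _ _ hf.counit_mem x

/-- The comultiplication of a form of a Hopf algebra. -/
noncomputable def comulMap : H →ₗ[K] H ⊗[K] H :=
  factorThrough (tensorMap L f.toLinearMap f.toLinearMap) hf.tensorMap_injective
    ((comul.restrictScalars K).comp f.toLinearMap) hf.comul_mem

theorem tensorMap_comulMap (x : H) :
    tensorMap L f.toLinearMap f.toLinearMap (hf.comulMap x) = comul (R := L) (f x) :=
  apply_factorThrough _ _ _ hf.comul_mem x

/-- The antipode of a form of a Hopf algebra. -/
noncomputable def antipodeMap : H →ₗ[K] H :=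
  factorThrough f.toLinearMap hf.injective
    (((antipode L).restrictScalars K).comp f.toLinearMap) hf.antipode_mem

theorem apply_antipodeMap (x : H) : f (hf.antipodeMap x) = antipode L (f x) :=
  apply_factorThrough f.toLinearMap _ _ hf.antipode_mem x

theorem comulMap_coassoc (x : H) :
    TensorProduct.assoc K H H H (hf.comulMap.rTensor H (hf.comulMap x)) =
      hf.comulMap.lTensor H (hf.comulMap x) := by
  have hι := hf.isBaseChange
  refine injective_of_isBaseChange (isBaseChange_tensorMap hι (isBaseChange_tensorMap hι hι)) ?_
  rw [tensorMap_assoc, tensorMap_rTensor f.toLinearMap _ _ hf.tensorMap_comulMap,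
    tensorMap_lTensor f.toLinearMap _ _ hf.tensorMap_comulMap, tensorMap_comulMap]
  exact Coalgebra.coassoc_apply (f x)

theorem counitMap_rTensor (x : H) :
    hf.counitMap.rTensor H (hf.comulMap x) = 1 ⊗ₜ x := by
  refine (TensorProduct.lid K H).injective (hf.injective ?_)
  have h := apply_lid (L := L) f.toLinearMap (hf.counitMap.rTensor H (hf.comulMap x))
  rw [tensorMap_rTensor f.toLinearMap (Algebra.linearMap K L) _ hf.algebraMap_counitMap,
    tensorMap_comulMap] at h
  refine h.trans ((congrArg _ (Coalgebra.rTensor_counit_comul (f x))).trans ?_)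
  simp

theorem counitMap_lTensor (x : H) :
    hf.counitMap.lTensor H (hf.comulMap x) = x ⊗ₜ 1 := by
  refine (TensorProduct.rid K H).injective (hf.injective ?_)
  have h := apply_rid (L := L) f.toLinearMap (hf.counitMap.lTensor H (hf.comulMap x))
  rw [tensorMap_lTensor f.toLinearMap (Algebra.linearMap K L) _ hf.algebraMap_counitMap,
    tensorMap_comulMap] at h
  refine h.trans ((congrArg _ (Coalgebra.lTensor_counit_comul (f x))).trans ?_)
  simp

theorem counitMap_mul (x y : H) : hf.counitMap (x * y) = hf.counitMap x * hf.counitMap y :=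
  (algebraMap K L).injective <| by
    simp only [map_mul, algebraMap_counitMap, Bialgebra.counit_mul]

theorem comulMap_mul (x y : H) : hf.comulMap (x * y) = hf.comulMap x * hf.comulMap y :=
  hf.tensorMap_injective <| by
    rw [tensorMap_mul, tensorMap_comulMap, tensorMap_comulMap, tensorMap_comulMap, map_mul,
      Bialgebra.comul_mul]

theorem counitMap_one : hf.counitMap 1 = 1 :=
  (algebraMap K L).injective <| by
    rw [algebraMap_counitMap, map_one f, Bialgebra.counit_one, map_one]

theorem comulMap_one : hf.comulMap 1 = 1 :=
  hf.tensorMap_injective <| by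
    rw [tensorMap_comulMap, map_one, Bialgebra.comul_one, Algebra.TensorProduct.one_def,
      Algebra.TensorProduct.one_def, tensorMap_tmul, AlgHom.toLinearMap_apply, map_one]

theorem mul_antipodeMap_rTensor (x : H) :
    LinearMap.mul' K H (hf.antipodeMap.rTensor H (hf.comulMap x)) =
      algebraMap K H (hf.counitMap x) := by
  refine hf.injective ?_
  rw [apply_mul' (L := L), tensorMap_rTensor f.toLinearMap f.toLinearMap _ hf.apply_antipodeMap,
    tensorMap_comulMap, AlgHom.commutes, IsScalarTower.algebraMap_apply K L A, algebraMap_counitMap]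
  exact mul_antipode_rTensor_comul_apply (f x)

theorem mul_antipodeMap_lTensor (x : H) :
    LinearMap.mul' K H (hf.antipodeMap.lTensor H (hf.comulMap x)) =
      algebraMap K H (hf.counitMap x) := by
  refine hf.injective ?_
  rw [apply_mul' (L := L), tensorMap_lTensor f.toLinearMap f.toLinearMap _ hf.apply_antipodeMap,
    tensorMap_comulMap, AlgHom.commutes, IsScalarTower.algebraMap_apply K L A, algebraMap_counitMap]
  exact mul_antipode_lTensor_comul_apply (f x)

theorem comulMap_comm [IsCocomm L A] (x : H) :
    TensorProduct.comm K H H (hf.comulMap x) = hf.comulMap x :=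
  hf.tensorMap_injective <| by
    rw [tensorMap_comm, tensorMap_comulMap, Coalgebra.comm_comul]

/-- A form of a Hopf algebra is a Hopf algebra. -/
noncomputable abbrev hopfAlgebra : HopfAlgebra K H :=
  letI : Coalgebra K H :=
    { comul := hf.comulMap
      counit := hf.counitMap
      coassoc := LinearMap.ext hf.comulMap_coassoc
      rTensor_counit_comp_comul := LinearMap.ext hf.counitMap_rTensor
      lTensor_counit_comp_comul := LinearMap.ext hf.counitMap_lTensor }
  letI : Bialgebra K H := Bialgebra.mk' K H hf.counitMap_one (hf.counitMap_mul _ _)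
    hf.comulMap_one (hf.comulMap_mul _ _)
  { antipode := hf.antipodeMap
    mul_antipode_rTensor_comul := LinearMap.ext hf.mul_antipodeMap_rTensor
    mul_antipode_lTensor_comul := LinearMap.ext hf.mul_antipodeMap_lTensor }

end IsHopfForm

/-- A semilinear action of the Galois group of `L/K` on a vector space over `L`. -/
structure SemilinearAction (K L V : Type*) [Field K] [Field L] [Algebra K L] [AddCommGroup V]
    [Module L V] where
  /-- the semilinear map by which an automorphism acts -/
  toFun : ∀ g : L ≃ₐ[K] L, V →ₛₗ[(g : L →+* L)] V
  one_apply : ∀ v, toFun 1 v = v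
  mul_apply : ∀ g h v, toFun (g * h) v = toFun g (toFun h v)

namespace SemilinearAction

variable {K L V W : Type*} [Field K] [Field L] [Algebra K L]
  [AddCommGroup V] [Module L V] [AddCommGroup W] [Module L W]

instance : CoeFun (SemilinearAction K L V) fun _ => ∀ g : L ≃ₐ[K] L, V →ₛₗ[(g : L →+* L)] V :=
  ⟨toFun⟩

/-- The diagonal action on a tensor product. -/
noncomputable def tensor (ρ : SemilinearAction K L V) (σ : SemilinearAction K L W) :
    SemilinearAction K L (V ⊗[L] W) where
  toFun g := TensorProduct.map (ρ g) (σ g)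
  one_apply z := by
    induction z with
    | zero => simp only [map_zero]
    | add z z' hz hz' => simp only [map_add, hz, hz']
    | tmul v w => rw [map_tmul, one_apply, one_apply]
  mul_apply g h z := by
    induction z with
    | zero => simp only [map_zero]
    | add z z' hz hz' => simp only [map_add, hz, hz']
    | tmul v w => simp only [map_tmul, mul_apply]

variable [Module K V] [IsScalarTower K L V] (ρ : SemilinearAction K L V)

/-- The `K`-subspace of the fixed vectors of a semilinear action. -/
def fixed : Submodule K V where
  carrier := {v | ∀ g, ρ g v = v}
  zero_mem' g := map_zero _
  add_mem' hv hw g := by rw [map_add, hv g, hw g]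
  smul_mem' k v hv g := by
    rw [← algebraMap_smul L k v, map_smulₛₗ, hv g]
    exact congrArg (· • v) (g.commutes k)

variable [FiniteDimensional K L]

theorem sum_mem_fixed (v : V) : ∑ g, ρ g v ∈ ρ.fixed := fun h => by
  simp_rw [map_sum, ← mul_apply]
  exact Fintype.sum_bijective (h * ·) (Group.mulLeft_bijective h) _ _ fun _ => rfl

-- A linear form `f` that kills every `∑ g, g a • ρ g v` vanishes, by Artin's independence of the
-- characters `a ↦ g a`.
theorem eq_zero_of_forall_mem_fixed {f : V →ₗ[L] L} (hf : ∀ v ∈ ρ.fixed, f v = 0) : f = 0 := by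
  ext v
  have hli := (linearIndependent_monoidHom L L).comp
    (fun g : L ≃ₐ[K] L => ((g : L →+* L) : L →* L))
    (fun g h hgh => AlgEquiv.ext fun x => DFunLike.congr_fun hgh x)
  rw [Fintype.linearIndependent_iff] at hli
  have h := hli (fun g => f (ρ g v)) (funext fun a => ?_) 1
  · simpa only [one_apply, LinearMap.zero_apply] using h
  · have h := hf _ (ρ.sum_mem_fixed (a • v))
    simp_rw [map_sum, map_smulₛₗ, smul_eq_mul] at h
    simpa [mul_comm] using h

theorem span_fixed : Submodule.span L (ρ.fixed : Set V) = ⊤ := by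
  by_contra hne
  obtain ⟨f, hf0, hf⟩ := Submodule.exists_le_ker_of_lt_top _ (lt_top_iff_ne_top.2 hne)
  exact hf0 (ρ.eq_zero_of_forall_mem_fixed fun v hv => hf (Submodule.subset_span hv))

variable [IsGalois K L]

theorem fixed_le_range {X : Type*} [AddCommGroup X] [Module K X] {f : X →ₗ[K] V}
    (hf : IsBaseChange L f) (h : ∀ g x, ρ g (f x) = f x) : ρ.fixed ≤ LinearMap.range f := by
  intro v hv
  let b := Module.Basis.ofVectorSpace K X
  let B := hf.basis b
  have hB : ∀ g i, ρ g (B i) = B i := fun g i => by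
    rw [hf.basis_apply, h]
  have hrepr : ∀ i, B.repr v i ∈ Set.range (algebraMap K L) := fun i => by
    rw [IsGalois.mem_range_algebraMap_iff_fixed]
    intro g
    have hg : Finsupp.linearCombination L B ((B.repr v).mapRange g (map_zero g)) = v := by
      conv_rhs => rw [← hv g, ← B.linearCombination_repr v]
      rw [Finsupp.linearCombination_apply, Finsupp.sum_mapRange_index (by simp),
        Finsupp.linearCombination_apply, map_finsuppSum]
      exact Finsupp.sum_congr fun j _ => by rw [map_smulₛₗ, hB]; rfl
    simpa using DFunLike.congr_fun (congrArg B.repr hg) i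
  rw [← B.linearCombination_repr v]
  refine Submodule.finsuppSum_mem _ _ _ _ fun i _ => ?_
  obtain ⟨k, hk⟩ := hrepr i
  refine ⟨k • b i, ?_⟩
  simp [← hk, B, hf.basis_apply]

theorem isBaseChange_fixed : IsBaseChange L ρ.fixed.subtype := by
  obtain ⟨ι, hι, hspan, hli⟩ := exists_linearIndependent L (ρ.fixed : Set V)
  let B : Module.Basis ι L V := .mk hli (by simp [hspan, span_fixed])
  have hB : ∀ i, B i = i := fun i => by simp [B]
  let f : (ι →₀ K) →ₗ[K] V := Finsupp.linearCombination K B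
  have hf : IsBaseChange L f :=
    isBaseChange_of_basis Finsupp.basisSingleOne B fun i => by simp [f]
  have hle : LinearMap.range f ≤ ρ.fixed := by
    rw [Finsupp.range_linearCombination, Submodule.span_le]
    rintro _ ⟨i, rfl⟩
    exact hB i ▸ hι i.2
  have hrange : LinearMap.range f = ρ.fixed :=
    hle.antisymm (ρ.fixed_le_range hf fun g x => hle ⟨x, rfl⟩ g)
  exact isBaseChange_of_basis (Finsupp.basisSingleOne.map
    ((LinearEquiv.ofInjective f (injective_of_isBaseChange hf)).trans (.ofEq _ _ hrange))) B
    fun i => by simp [f]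

end SemilinearAction

/-- A semilinear action on a Hopf algebra is compatible with the Hopf algebra structure. -/
structure IsHopfAction {K L A : Type*} [Field K] [Field L] [Algebra K L] [Ring A]
    [HopfAlgebra L A] (ρ : SemilinearAction K L A) : Prop where
  map_one : ∀ g, ρ g 1 = 1
  map_mul : ∀ g x y, ρ g (x * y) = ρ g x * ρ g y
  counit_apply : ∀ g x, Coalgebra.counit (R := L) (ρ g x) = g (Coalgebra.counit (R := L) x)
  comul_apply : ∀ g x, Coalgebra.comul (R := L) (ρ g x) =
    ρ.tensor ρ g (Coalgebra.comul (R := L) x)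
  antipode_apply : ∀ g x, HopfAlgebra.antipode L (ρ g x) = ρ g (HopfAlgebra.antipode L x)

namespace IsHopfAction

variable {K L A : Type*} [Field K] [Field L] [Algebra K L] [Ring A] [HopfAlgebra L A]
  [Algebra K A] [IsScalarTower K L A] {ρ : SemilinearAction K L A} (hρ : IsHopfAction ρ)

/-- The `K`-subalgebra of the fixed elements of an action on a Hopf algebra. -/
def fixed : Subalgebra K A where
  __ := ρ.fixed
  mul_mem' hx hy g := by rw [hρ.map_mul, hx g, hy g]
  algebraMap_mem' k g := by
    rw [Algebra.algebraMap_eq_smul_one]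
    exact ρ.fixed.smul_mem k (hρ.map_one) g

variable [FiniteDimensional K L] [IsGalois K L]

theorem isHopfForm_fixed : IsHopfForm (L := L) hρ.fixed.val where
  isBaseChange := ρ.isBaseChange_fixed
  counit_mem x := by
    refine (IsGalois.mem_range_algebraMap_iff_fixed _).2 fun g => ?_
    rw [← hρ.counit_apply]
    exact congrArg _ (x.2 g)
  comul_mem x := by
    refine (ρ.tensor ρ).fixed_le_range
      (isBaseChange_tensorMap ρ.isBaseChange_fixed ρ.isBaseChange_fixed) (fun g z => ?_)
      fun g => ?_
    · induction z with
      | zero => simp only [map_zero]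
      | add z z' hz hz' => simp only [map_add, hz, hz']
      | tmul y z => exact congrArg₂ (· ⊗ₜ ·) (y.2 g) (z.2 g)
    · rw [← hρ.comul_apply]
      exact congrArg _ (x.2 g)
  antipode_mem x := by
    refine ⟨⟨HopfAlgebra.antipode L (x : A), fun g => ?_⟩, rfl⟩
    rw [← hρ.antipode_apply]
    exact congrArg _ (x.2 g)

end IsHopfAction

end GaloisDescent

/-! ### Hopf-Galois structures and regular subgroups -/

namespace TwistedGroupAlgebra

open MonoidAlgebra GaloisDescent

variable {K L S : Type*} [Field K] [Field L] [Algebra K L] [Group S]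
  (φ : (L ≃ₐ[K] L) →* MulAut S)

/-- The action of a field automorphism on the group algebra `L[S]`, through its action on the
coefficients and the action `φ` on the group. -/
noncomputable def twist (g : L ≃ₐ[K] L) : MonoidAlgebra L S →+* MonoidAlgebra L S :=
  (mapDomainRingHom L (φ g : S →* S)).comp (mapRingHom S (g : L →+* L))

theorem twist_single (g : L ≃ₐ[K] L) (s : S) (a : L) :
    twist φ g (single s a) = single (φ g s) (g a) := by
  simp [twist]

theorem coeff_twist (g : L ≃ₐ[K] L) (c : MonoidAlgebra L S) (s : S) :
    (twist φ g c).coeff (φ g s) = g (c.coeff s) := by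
  simp only [twist, RingHom.comp_apply, mapDomainRingHom_apply, mapDomain]
  refine (Finsupp.mapDomain_apply (φ g).injective _ _).trans ?_
  simp

theorem twist_eq_self_iff {g : L ≃ₐ[K] L} {c : MonoidAlgebra L S} :
    twist φ g c = c ↔ ∀ s, c.coeff (φ g s) = g (c.coeff s) := by
  refine ⟨fun h s => by rw [← coeff_twist φ, h], fun h => ?_⟩
  ext s
  obtain ⟨t, rfl⟩ := (φ g).surjective s
  rw [coeff_twist, h]

/-- The semilinear action of the Galois group on the group algebra. -/
noncomputable def twistAction : SemilinearAction K L (MonoidAlgebra L S) where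
  toFun g :=
    { toFun := twist φ g
      map_add' := map_add _
      map_smul' := fun a c => by
        ext s
        obtain ⟨t, rfl⟩ := (φ g).surjective s
        simp [coeff_twist] }
  one_apply c := by
    induction c using MonoidAlgebra.induction_linear with
    | zero => exact map_zero _
    | add c d hc hd => rw [map_add, hc, hd]
    | single s a => exact (twist_single φ 1 s a).trans (by simp)
  mul_apply g h c := by
    induction c using MonoidAlgebra.induction_linear with
    | zero => simp only [map_zero]
    | add c d hc hd => simp only [map_add, hc, hd]
    | single s a =>
      change twist φ (g * h) (single s a) = twist φ g (twist φ h (single s a))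
      simp only [twist_single, map_mul, MulAut.mul_apply, AlgEquiv.mul_apply]

theorem twistAction_apply (g : L ≃ₐ[K] L) (c : MonoidAlgebra L S) :
    twistAction φ g c = twist φ g c := rfl

theorem isHopfAction_twistAction : IsHopfAction (twistAction φ) where
  map_one g := map_one (twist φ g)
  map_mul g := map_mul (twist φ g)
  counit_apply g c := by
    induction c using MonoidAlgebra.induction_linear with
    | zero => simp only [map_zero]
    | add c d hc hd => simp only [map_add, hc, hd]
    | single s a => simp [twistAction_apply, twist_single]
  comul_apply g c := by
    induction c using MonoidAlgebra.induction_linear with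
    | zero => simp only [map_zero]
    | add c d hc hd => simp only [map_add, hc, hd]
    | single s a =>
      simp [twistAction_apply, twist_single, SemilinearAction.tensor]
  antipode_apply g c := by
    induction c using MonoidAlgebra.induction_linear with
    | zero => simp only [map_zero]
    | add c d hc hd => simp only [map_add, hc, hd]
    | single s a => simp [twistAction_apply, twist_single]

/-- The twisted group algebra `L[S]^G`. -/
noncomputable def fixed : Subalgebra K (MonoidAlgebra L S) :=
  (isHopfAction_twistAction φ).fixed

theorem mem_fixed {c : MonoidAlgebra L S} :
    c ∈ fixed φ ↔ ∀ g s, c.coeff (φ g s) = g (c.coeff s) :=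
  forall_congr' fun _ => twist_eq_self_iff φ

variable [FiniteDimensional K L]

theorem eq_zero_of_forall_mem_fixed {f : MonoidAlgebra L S →ₗ[L] L}
    (hf : ∀ c ∈ fixed φ, f c = 0) : f = 0 :=
  (twistAction φ).eq_zero_of_forall_mem_fixed hf

variable [IsGalois K L]

theorem isHopfForm_fixed : IsHopfForm (L := L) (fixed φ).val :=
  (isHopfAction_twistAction φ).isHopfForm_fixed

noncomputable instance : HopfAlgebra K (fixed φ) := (isHopfForm_fixed φ).hopfAlgebra

instance : Coalgebra.IsCocomm K (fixed φ) where
  comm_comp_comul := LinearMap.ext (isHopfForm_fixed φ).comulMap_comm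

theorem algebraMap_counit (c : fixed φ) : algebraMap K L (Coalgebra.counit (R := K) c) =
    Coalgebra.counit (R := L) (c : MonoidAlgebra L S) :=
  (isHopfForm_fixed φ).algebraMap_counitMap c

theorem tensorMap_comul (c : fixed φ) :
    tensorMap L (fixed φ).val.toLinearMap (fixed φ).val.toLinearMap
      (Coalgebra.comul (R := K) c) = Coalgebra.comul (R := L) (c : MonoidAlgebra L S) :=
  (isHopfForm_fixed φ).tensorMap_comulMap c

instance [Finite S] : Module.Finite K (fixed φ) := by
  let b := Module.Basis.ofVectorSpace K (fixed φ)
  have := Module.Finite.finite_basis ((isHopfForm_fixed φ).isBaseChange.basis b)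
  exact Module.Finite.of_basis b

end TwistedGroupAlgebra

namespace IsRegularNormalised

variable {G : Type*} [Group G] {M : Subgroup (Equiv.Perm G)} (hM : IsRegularNormalised M)

/-- The conjugation action of `G` on `M`. -/
def conjAut : G →* MulAut M where
  toFun g :=
    { toFun := hM.conj g
      invFun := hM.conj g⁻¹
      left_inv := fun n => by
        ext x
        simp [conj]
      right_inv := fun n => by
        ext x
        simp [conj]
      map_mul' := fun n m => by
        ext x
        simp [conj] }
  map_one' := by
    ext n x
    simp [conj]
  map_mul' g h := by
    ext n x
    simp [conj, mul_assoc]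

theorem conjAut_apply (g : G) (n : M) : hM.conjAut g n = hM.conj g n := rfl

include hM

theorem bijective_inv_apply_one : Function.Bijective fun n : M => (n : Equiv.Perm G)⁻¹ 1 := by
  refine ⟨fun n m h => ?_, fun g => ?_⟩
  · exact Subtype.ext (inv_injective
      ((hM.regular 1 _).unique ⟨inv_mem n.2, rfl⟩ ⟨inv_mem m.2, h.symm⟩))
  · exact ⟨⟨(hM.elt g)⁻¹, inv_mem (hM.elt_mem g)⟩, by simpa using hM.elt_one g⟩

theorem finite [Finite G] : Finite M := .of_injective _ hM.bijective_inv_apply_one.1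

theorem card_eq : Nat.card M = Nat.card G := Nat.card_eq_of_bijective _ hM.bijective_inv_apply_one

theorem mul_conj_inv_apply_one (n m : M) :
    ((n * hM.conj ((n : Equiv.Perm G)⁻¹ 1) m : M) : Equiv.Perm G)⁻¹ 1 =
      (n : Equiv.Perm G)⁻¹ 1 * (m : Equiv.Perm G)⁻¹ 1 := by
  simp [conj]

end IsRegularNormalised

namespace HopfGaloisStructure

open MonoidAlgebra TwistedGroupAlgebra GaloisDescent

variable {K : Type u} {L : Type v} [Field K] [Field L] [Algebra K L]

theorem isBaseChange_iff_bijective_lift {H : Type*} [AddCommGroup H] [Module K H]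
    {f : H →ₗ[K] Module.End K L} :
    IsBaseChange L f ↔ Function.Bijective (TensorProduct.lift
      ((LinearMap.mul K (Module.End K L)).compl₁₂ (Algebra.lmul K L).toLinearMap f)) := by
  rw [IsBaseChange, IsTensorProduct]
  refine iff_of_eq (congrArg (fun F : L ⊗[K] H →ₗ[K] Module.End K L => Function.Bijective F) ?_)
  ext a h x
  simp

section OfRegular

variable {M : Subgroup (Equiv.Perm (L ≃ₐ[K] L))}

/-- The action of the group algebra on `L`, as an `L`-linear map to `End_K(L)`. -/
noncomputable def actLin : MonoidAlgebra L M →ₗ[L] Module.End K L :=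
  (Finsupp.linearCombination L
    (fun n : M => (((n : Equiv.Perm (L ≃ₐ[K] L))⁻¹ 1 : L ≃ₐ[K] L) : L →ₐ[K] L).toLinearMap)).comp
    (coeffLinearEquiv L).toLinearMap

theorem actLin_apply (c : MonoidAlgebra L M) (x : L) : actLin c x = groupAlgebraAct c x := by
  simp [actLin, groupAlgebraAct, Finsupp.linearCombination_apply, Finsupp.sum]

theorem actLin_single (n : M) (a x : L) :
    actLin (single n a : MonoidAlgebra L M) x =
      a * ((n : Equiv.Perm (L ≃ₐ[K] L))⁻¹ 1 : L ≃ₐ[K] L) x := by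
  simp [actLin]

theorem actLin_apply_one (c : MonoidAlgebra L M) :
    actLin (K := K) c 1 = Coalgebra.counit (R := L) c := by
  induction c using MonoidAlgebra.induction_linear with
  | zero => simp
  | add c d hc hd => rw [map_add, map_add, LinearMap.add_apply, hc, hd]
  | single n a => simp [actLin_single]

/-- The action on `L` evaluated at `x`, as a linear form on the group algebra. -/
noncomputable def evalAt (x : L) : MonoidAlgebra L M →ₗ[L] L :=
  (LinearMap.applyₗ' L x).comp (actLin (K := K))

theorem actLin_apply_mul (c : MonoidAlgebra L M) (x y : L) :
    actLin (K := K) c (x * y) =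
      LinearMap.mul' L L
        (TensorProduct.map (evalAt x) (evalAt y) (Coalgebra.comul (R := L) c)) := by
  induction c using MonoidAlgebra.induction_linear with
  | zero => simp
  | add c d hc hd => simp only [map_add, LinearMap.add_apply, hc, hd]
  | single n a => simp [actLin_single, evalAt, mul_left_comm]

theorem actLin_injective (hM : IsRegularNormalised M) :
    Function.Injective (actLin (K := K) (M := M)) := by
  have hli := (linearIndependent_toLinearMap K L L).comp
    (fun n : M => (((n : Equiv.Perm (L ≃ₐ[K] L))⁻¹ 1 : L ≃ₐ[K] L) : L →ₐ[K] L))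
    (fun n m hnm => hM.bijective_inv_apply_one.1 (AlgEquiv.ext fun x => DFunLike.congr_fun hnm x))
  exact fun c d hcd => (coeffLinearEquiv L).injective (hli hcd)

variable (hM : IsRegularNormalised M)

theorem actLin_single_mul_twist (n : M) (a : L) (d : MonoidAlgebra L M) :
    actLin (K := K) (single n a * twist hM.conjAut ((n : Equiv.Perm (L ≃ₐ[K] L))⁻¹ 1) d) =
      actLin (single n a) * actLin d := by
  induction d using MonoidAlgebra.induction_linear with
  | zero => simp
  | add c d hc hd => simp only [map_add, mul_add, hc, hd]
  | single m b =>
    ext x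
    rw [twist_single, single_mul_single, actLin_single, hM.conjAut_apply,
      hM.mul_conj_inv_apply_one, Module.End.mul_apply, actLin_single, actLin_single,
      AlgEquiv.mul_apply, map_mul, mul_assoc]

theorem actLin_mul (c : MonoidAlgebra L M) {d : MonoidAlgebra L M} (hd : d ∈ fixed hM.conjAut) :
    actLin (K := K) (c * d) = actLin c * actLin d := by
  induction c using MonoidAlgebra.induction_linear with
  | zero => simp
  | add c c' hc hc' => simp only [map_add, add_mul, hc, hc']
  | single n a =>
    rw [← actLin_single_mul_twist hM, (twist_eq_self_iff _).2 ((mem_fixed _).1 hd _)]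

/-- The action of the twisted group algebra on `L`. -/
noncomputable def actHom : fixed hM.conjAut →ₐ[K] Module.End K L :=
  AlgHom.ofLinearMap ((actLin.restrictScalars K).comp (fixed hM.conjAut).val.toLinearMap)
    (by ext x; simp [one_def, actLin_single])
    (fun c d => actLin_mul hM (c : MonoidAlgebra L M) d.2)

theorem actHom_apply (c : fixed hM.conjAut) :
    actHom hM c = actLin (c : MonoidAlgebra L M) := rfl

variable [FiniteDimensional K L] [IsGalois K L]

theorem actLin_bijective (hM : IsRegularNormalised M) :
    Function.Bijective (actLin (K := K) (M := M)) := by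
  have := hM.finite
  have := Fintype.ofFinite M
  have hfinrank : Module.finrank L (MonoidAlgebra L M) =
      Module.finrank L (Module.End K L) := by
    rw [(coeffLinearEquiv L).finrank_eq, Module.finrank_finsupp_self, ← Nat.card_eq_fintype_card,
      hM.card_eq, IsGalois.card_aut_eq_finrank]
    exact (Module.finrank_linearMap_self K L L).symm
  have hinj := actLin_injective (K := K) hM
  exact ⟨hinj, (LinearMap.injective_iff_surjective_of_finrank_eq_finrank hfinrank).1 hinj⟩

theorem isBaseChange_actHom : IsBaseChange L (actHom hM).toLinearMap := by
  let b := Module.Basis.ofVectorSpace K (fixed hM.conjAut)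
  have hb := (isHopfForm_fixed hM.conjAut).isBaseChange
  refine isBaseChange_of_basis b
    ((hb.basis b).map (LinearEquiv.ofBijective actLin (actLin_bijective hM))) fun i => ?_
  simp [hb.basis_apply, actHom_apply]

/-- The Hopf-Galois structure of a regular subgroup normalised by left translations. -/
noncomputable def ofRegular : HopfGaloisStructure K L :=
  have := hM.finite
  { H := fixed hM.conjAut
    act := actHom hM
    act_one := fun c => by rw [algebraMap_counit, actHom_apply, actLin_apply_one]
    act_mul := fun c x y => by
      rw [actHom_apply, actLin_apply_mul, ← tensorMap_comul]
      generalize Coalgebra.comul (R := K) c = z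
      induction z with
      | zero => simp only [map_zero]
      | add z z' hz hz' => simp only [map_add, hz, hz']
      | tmul c d => rfl
    galois := isBaseChange_iff_bijective_lift.1 (isBaseChange_actHom hM) }

theorem givenBy_ofRegular : (ofRegular hM).GivenBy hM := by
  ext f
  constructor
  · rintro ⟨c, rfl⟩
    change fixed hM.conjAut at c
    exact ⟨c.1, (mem_fixed _).1 c.2, funext fun x => (actLin_apply c.1 x).symm⟩
  · rintro ⟨c, hc, rfl⟩
    exact ⟨(⟨c, (mem_fixed _).2 hc⟩ : fixed hM.conjAut), funext fun x => (actLin_apply c x).symm⟩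

end OfRegular

section Iso

theorem isBaseChange_act (S : HopfGaloisStructure K L) : IsBaseChange L S.act.toLinearMap :=
  isBaseChange_iff_bijective_lift.2 S.galois

theorem act_injective (S : HopfGaloisStructure K L) : Function.Injective S.act :=
  injective_of_isBaseChange S.isBaseChange_act

theorem eq_zero_of_sum_act (S : HopfGaloisStructure K L) {ι : Type*} [Fintype ι]
    (b : Module.Basis ι K S.H) {a : ι → L} (h : ∀ x, ∑ i, a i * S.act (b i) x = 0) (i : ι) :
    a i = 0 := by
  refine Fintype.linearIndependent_iff.1 (S.isBaseChange_act.basis b).linearIndependent a ?_ i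
  ext x
  simpa [IsBaseChange.basis_apply] using h x

/-- The operation of `H ⊗ H` on pairs of elements of `L`. -/
noncomputable def act₂ (S : HopfGaloisStructure K L) (x y : L) : S.H ⊗[K] S.H →ₗ[K] L :=
  LinearMap.mul' K L ∘ₗ
    TensorProduct.map (S.act.toLinearMap.flip x) (S.act.toLinearMap.flip y)

theorem act₂_tmul (S : HopfGaloisStructure K L) (x y : L) (h k : S.H) :
    S.act₂ x y (h ⊗ₜ k) = S.act h x * S.act k y := by
  simp [act₂]

theorem act₂_comul (S : HopfGaloisStructure K L) (x y : L) (h : S.H) :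
    S.act₂ x y (Coalgebra.comul (R := K) h) = S.act h (x * y) := (S.act_mul h x y).symm

theorem eq_zero_of_act₂ (S : HopfGaloisStructure K L) {z : S.H ⊗[K] S.H}
    (h : ∀ x y, S.act₂ x y z = 0) : z = 0 := by
  let b := Module.finBasis K S.H
  let B := b.tensorProduct b
  have hz : ∑ i, ∑ j, B.repr z (i, j) • (b i ⊗ₜ[K] b j) = z := by
    conv_rhs => rw [← B.sum_repr z, Fintype.sum_prod_type]
    simp [B, Module.Basis.tensorProduct_apply]
  have hsum : ∀ y i, ∑ j, algebraMap K L (B.repr z (i, j)) * S.act (b j) y = 0 := fun y =>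
    S.eq_zero_of_sum_act b fun x => by
      rw [← h x y]
      conv_rhs => rw [← hz]
      simp only [map_sum, map_smul, act₂_tmul, Finset.sum_mul]
      refine Finset.sum_congr rfl fun i _ => Finset.sum_congr rfl fun j _ => ?_
      rw [Algebra.smul_def]
      ring
  have hrepr : ∀ i j, B.repr z (i, j) = 0 := fun i j => by
    simpa using S.eq_zero_of_sum_act b (hsum · i) j
  rw [← hz]
  simp [hrepr]

theorem eq_of_act₂ (S : HopfGaloisStructure K L) {z w : S.H ⊗[K] S.H}
    (h : ∀ x y, S.act₂ x y z = S.act₂ x y w) : z = w :=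
  sub_eq_zero.1 (S.eq_zero_of_act₂ fun x y => by rw [map_sub, h, sub_self])

/-- An algebra isomorphism between Hopf-Galois structures that is compatible with the actions is an
isomorphism of Hopf algebras. -/
noncomputable def bialgEquivOfAct {S T : HopfGaloisStructure K L} (e : S.H ≃ₐ[K] T.H)
    (he : ∀ h, T.act (e h) = S.act h) : S.H ≃ₐc[K] T.H :=
  have hact₂ : ∀ x y z, T.act₂ x y (Algebra.TensorProduct.map e.toAlgHom e.toAlgHom z) =
      S.act₂ x y z := fun x y z => by
    induction z with
    | zero => simp only [map_zero]
    | add z z' hz hz' => simp only [map_add, hz, hz']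
    | tmul h k =>
      rw [Algebra.TensorProduct.map_tmul, act₂_tmul, act₂_tmul]
      exact congrArg₂ (fun f g => f x * g y) (he h) (he k)
  BialgEquiv.ofAlgEquiv e
    (AlgHom.ext fun h => (algebraMap K L).injective
      ((T.act_one _).symm.trans ((congrArg (· 1) (he h)).trans (S.act_one h))))
    (AlgHom.ext fun h => T.eq_of_act₂ fun x y =>
      (hact₂ x y _).trans ((S.act₂_comul x y h).trans
        ((congrArg (· (x * y)) (he h).symm).trans (T.act₂_comul x y _).symm)))

theorem iso_of_range_eq {S T : HopfGaloisStructure K L} (h : S.act.range = T.act.range) :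
    (isoSetoid K L).r S T := by
  let e : S.H ≃ₐ[K] T.H := (AlgEquiv.ofInjective S.act S.act_injective).trans
    ((Subalgebra.equivOfEq _ _ h).trans (AlgEquiv.ofInjective T.act T.act_injective).symm)
  have he : ∀ k, T.act (e k) = S.act k := fun k =>
    congrArg Subtype.val ((AlgEquiv.ofInjective T.act T.act_injective).apply_symm_apply
      (Subalgebra.equivOfEq _ _ h (AlgEquiv.ofInjective S.act S.act_injective k)))
  exact ⟨bialgEquivOfAct e he, he⟩

theorem coe_range_act (S : HopfGaloisStructure K L) :
    {f : L → L | ∃ h : S.H, f = S.act h} =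
      (fun f : Module.End K L => (f : L → L)) '' S.act.range := by
  ext f
  constructor
  · rintro ⟨h, rfl⟩
    exact ⟨S.act h, ⟨h, rfl⟩, rfl⟩
  · rintro ⟨_, ⟨h, rfl⟩, rfl⟩
    exact ⟨h, rfl⟩

namespace GivenBy

variable {S T : HopfGaloisStructure K L} {M : Subgroup (Equiv.Perm (L ≃ₐ[K] L))}
  {hM : IsRegularNormalised M}

theorem iso (hS : S.GivenBy hM) (hT : T.GivenBy hM) : (isoSetoid K L).r S T := by
  refine iso_of_range_eq (SetLike.coe_injective (DFunLike.coe_injective.image_injective ?_))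
  exact (coe_range_act S).symm.trans ((hS.trans hT.symm).trans (coe_range_act T))

theorem of_iso (hS : S.GivenBy hM) (h : (isoSetoid K L).r S T) : T.GivenBy hM := by
  obtain ⟨e, he⟩ := h
  refine Eq.trans (Set.ext fun f => ⟨?_, ?_⟩) hS
  · rintro ⟨k, rfl⟩
    exact ⟨e.symm k, by rw [← he, BialgEquiv.apply_symm_apply]⟩
  · rintro ⟨k, rfl⟩
    exact ⟨e k, by rw [he]⟩

end GivenBy

end Iso

section Unique

variable {M : Subgroup (Equiv.Perm (L ≃ₐ[K] L))} (hM : IsRegularNormalised M)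

/-- The coefficient function of an element of `L[M]`, with `M` identified with the Galois group
through `n ↦ n⁻¹(1)`. -/
noncomputable def coeffFun (c : MonoidAlgebra L M) (g : L ≃ₐ[K] L) : L :=
  c.coeff ⟨(hM.elt g)⁻¹, inv_mem (hM.elt_mem g)⟩

theorem coeffFun_mul_elt {c : MonoidAlgebra L M} (hc : c ∈ fixed hM.conjAut)
    (g h : L ≃ₐ[K] L) : coeffFun hM c (h * hM.elt g h⁻¹) = h (coeffFun hM c g) := by
  rw [coeffFun, coeffFun, ← (mem_fixed _).1 hc h]
  refine congrArg c.coeff (Subtype.ext ?_)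
  rw [hM.conjAut_apply]
  change (hM.elt _)⁻¹ = Equiv.mulLeft h * (hM.elt g)⁻¹ * (Equiv.mulLeft h)⁻¹
  have hconj : Equiv.mulLeft h * hM.elt g * (Equiv.mulLeft h)⁻¹ = hM.elt (h * hM.elt g h⁻¹) :=
    hM.eq_elt (hM.normalised h _ (hM.elt_mem g)) (by simp)
  rw [← hconj, mul_inv_rev, mul_inv_rev, inv_inv, mul_assoc]

variable [FiniteDimensional K L]

theorem actLin_eq_sum (c : MonoidAlgebra L M) (x : L) :
    actLin c x = ∑ g : L ≃ₐ[K] L, coeffFun hM c g * g x := by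
  have := hM.finite
  have := Fintype.ofFinite M
  rw [actLin_apply, groupAlgebraAct, Finsupp.sum_fintype _ _ (by simp)]
  refine Fintype.sum_bijective _ hM.bijective_inv_apply_one _ _ fun n => ?_
  have hn : (n : Equiv.Perm (L ≃ₐ[K] L)) = (hM.elt ((n : Equiv.Perm (L ≃ₐ[K] L))⁻¹ 1))⁻¹ := by
    rw [← hM.eq_elt (inv_mem n.2) rfl, inv_inv]
  exact congrArg (fun m : M => c.coeff m * _) (Subtype.ext hn)

theorem coeffFun_eq_of_actLin_eq {M' : Subgroup (Equiv.Perm (L ≃ₐ[K] L))}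
    (hM' : IsRegularNormalised M') {c : MonoidAlgebra L M} {c' : MonoidAlgebra L M'}
    (h : actLin (K := K) c = actLin c') : coeffFun hM c = coeffFun hM' c' := by
  have hli := (linearIndependent_toLinearMap K L L).comp
    (fun g : L ≃ₐ[K] L => (g : L →ₐ[K] L))
    (fun n m hnm => AlgEquiv.ext fun x => DFunLike.congr_fun hnm x)
  rw [Fintype.linearIndependent_iff] at hli
  refine funext fun g => sub_eq_zero.1
    (hli (fun g => coeffFun hM c g - coeffFun hM' c' g) (LinearMap.ext fun x => ?_) g)
  have hx := LinearMap.congr_fun h x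
  rw [actLin_eq_sum hM, actLin_eq_sum hM', ← sub_eq_zero, ← Finset.sum_sub_distrib] at hx
  simpa [sub_mul] using hx

theorem eq_of_coeffFun_eq {g h : L ≃ₐ[K] L}
    (hgh : ∀ c ∈ fixed hM.conjAut, coeffFun hM c g = coeffFun hM c h) : g = h := by
  classical
  let evalCoeff (g : L ≃ₐ[K] L) : MonoidAlgebra L M →ₗ[L] L :=
    (Finsupp.lapply ⟨(hM.elt g)⁻¹, inv_mem (hM.elt_mem g)⟩).comp (coeffLinearEquiv L).toLinearMap
  have hzero : evalCoeff g - evalCoeff h = 0 :=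
    eq_zero_of_forall_mem_fixed hM.conjAut fun c hc => sub_eq_zero.2 (hgh c hc)
  have hone := LinearMap.congr_fun hzero (single ⟨(hM.elt g)⁻¹, inv_mem (hM.elt_mem g)⟩ 1)
  by_contra hne
  have helt : hM.elt g ≠ hM.elt h := fun h => hne (by rw [← hM.elt_one g, h, hM.elt_one])
  simp [evalCoeff, helt] at hone

theorem GivenBy.elt_eq {S : HopfGaloisStructure K L} {M' : Subgroup (Equiv.Perm (L ≃ₐ[K] L))}
    {hM : IsRegularNormalised M} {hM' : IsRegularNormalised M'} (h : S.GivenBy hM)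
    (h' : S.GivenBy hM') : hM.elt = hM'.elt := by
  refine funext fun g => Equiv.ext fun k => ?_
  have hk : k⁻¹ * hM.elt g k⁻¹⁻¹ = k⁻¹ * hM'.elt g k⁻¹⁻¹ := by
    refine eq_of_coeffFun_eq hM fun c hc => ?_
    obtain ⟨c', hc', hcc'⟩ := (Set.ext_iff.1 (h.symm.trans h') (groupAlgebraAct c)).1
      ⟨c, (mem_fixed _).1 hc, rfl⟩
    have hf : coeffFun hM c = coeffFun hM' c' :=
      coeffFun_eq_of_actLin_eq hM hM' (LinearMap.ext fun x => by
        rw [actLin_apply, actLin_apply, hcc'])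
    rw [coeffFun_mul_elt hM hc, hf, coeffFun_mul_elt hM' ((mem_fixed _).2 hc')]
  simpa using hk

theorem GivenBy.unique {S : HopfGaloisStructure K L} {M' : Subgroup (Equiv.Perm (L ≃ₐ[K] L))}
    {hM : IsRegularNormalised M} {hM' : IsRegularNormalised M'} (h : S.GivenBy hM)
    (h' : S.GivenBy hM') : M = M' := by
  have helt := h.elt_eq h'
  refine le_antisymm (fun n hn => ?_) (fun n hn => ?_)
  · rw [hM.eq_elt hn rfl, helt]
    exact hM'.elt_mem _
  · rw [hM'.eq_elt hn rfl, ← helt]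
    exact hM.elt_mem _

variable (K L) in
theorem number_eq [IsGalois K L] (N : Type w) [Group N] (r : ℕ) :
    number K L N r = Nat.card {M : Subgroup (Equiv.Perm (L ≃ₐ[K] L)) //
      ∃ hM : IsRegularNormalised M, Nonempty (M ≃* N) ∧ SkewBrace.thetaCard hM.Brace = r} := by
  symm
  refine Nat.card_eq_of_bijective (fun M => ⟨Quotient.mk _ (ofRegular M.2.choose),
    ofRegular M.2.choose, rfl, M.1, M.2.choose, givenBy_ofRegular _, M.2.choose_spec⟩) ⟨?_, ?_⟩
  · intro M M' h
    have hiso : (isoSetoid K L).r (ofRegular M.2.choose) (ofRegular M'.2.choose) :=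
      Quotient.exact (Subtype.ext_iff.1 h)
    exact Subtype.ext (((givenBy_ofRegular M.2.choose).of_iso hiso).unique (givenBy_ofRegular _))
  · rintro ⟨q, S, rfl, M, hM, hS, h⟩
    exact ⟨⟨M, hM, h⟩, Subtype.ext (Quotient.sound ((givenBy_ofRegular _).iso hS))⟩

end Unique

end HopfGaloisStructure

/-! ### Gamma functions -/

namespace SkewBrace

section Lam

variable {B : Type*} [SkewBrace B]

theorem one_eq_zero : (1 : B) = 0 := by
  have h := brace_property (1 : B) 0 0
  simp only [one_mul, add_zero, zero_sub] at h
  exact (neg_eq_zero.1 h.symm)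

theorem lam_add (a b c : B) : lam a (b + c) = lam a b + lam a c := by
  simp only [lam, brace_property, sub_eq_add_neg, add_assoc]

theorem mul_eq_add_lam (a b : B) : a * b = a + lam a b := by simp [lam]

theorem lam_zero (a : B) : lam a 0 = 0 := by
  rw [lam, ← one_eq_zero, mul_one, one_eq_zero, neg_add_cancel]

theorem lam_neg (a b : B) : lam a (-b) = -lam a b :=
  eq_neg_of_add_eq_zero_left (by rw [← lam_add, neg_add_cancel, lam_zero])

theorem lam_mul (a b c : B) : lam (a * b) c = lam a (lam b c) := by
  conv_rhs => rw [lam.eq_1 b c, lam_add, lam_neg, lam]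
  rw [lam, mul_assoc, mul_eq_add_lam a b, mul_eq_add_lam a (b * c), neg_add_rev]
  simp only [add_assoc, neg_add_cancel_left]

theorem lam_one (b : B) : lam 1 b = b := by
  rw [lam, one_mul, one_eq_zero, neg_zero, zero_add]

variable {C : Type*} [SkewBrace C]

theorem map_lam (e : B ≃+* C) (a b : B) : e (lam a b) = lam (e a) (e b) := by
  have h : e (a + lam a b) = e a + lam (e a) (e b) := by
    rw [← mul_eq_add_lam, ← mul_eq_add_lam, map_mul]
  rwa [map_add, add_right_inj] at h

theorem thetaCard_congr (e : B ≃+* C) :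
    thetaCard B = thetaCard C := by
  have hr : (fun f : B → B => e ∘ f ∘ e.symm) '' Set.range (lam : B → B → B) =
      Set.range (lam : C → C → C) := by
    ext f
    constructor
    · rintro ⟨_, ⟨a, rfl⟩, rfl⟩
      exact ⟨e a, funext fun c => by simp [map_lam]⟩
    · rintro ⟨c, rfl⟩
      exact ⟨lam (e.symm c), ⟨_, rfl⟩, funext fun c => by simp [map_lam]⟩
  rw [thetaCard, thetaCard, ← hr, Nat.card_image_of_injective]
  intro f g hfg
  funext b
  simpa using congrFun hfg (e b)

theorem IsBraceOf.congr {G N : Type*} [Group G] [Group N] {r : ℕ}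
    (h : IsBraceOf G N r B) (e : B ≃+* C) : IsBraceOf G N r C :=
  ⟨h.1.map fun f => (e.symm : C ≃* B).trans f, h.2.1.map fun f => (e.symm : C ≃+ B).trans f,
    (thetaCard_congr e).symm.trans h.2.2⟩

end Lam

section ULift

variable (B : Type u) [SkewBrace B]

instance : SkewBrace (ULift.{v} B) where
  brace_property a b c := ULift.ext _ _ (brace_property a.down b.down c.down)

/-- A skew brace is isomorphic to its lift to a higher universe. -/
def uliftEquiv : ULift.{v} B ≃+* B where
  toFun := ULift.down
  invFun := ULift.up
  left_inv _ := rfl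
  right_inv _ := rfl
  map_mul' _ _ := rfl
  map_add' _ _ := rfl

end ULift

end SkewBrace

namespace Hol

open SkewBrace

variable {N : Type u} [Group N]

theorem isRegular_of_existsUnique {H : Subgroup (Hol N)}
    (h : ∀ n : N, ∃! g : Hol N, g ∈ H ∧ g.left = n) : IsRegular H := by
  have hact : ∀ g : Hol N, act g 1 = g.left := fun g => by simp [act]
  intro x y
  obtain ⟨gx, ⟨hgx, hx⟩, -⟩ := h x
  obtain ⟨gy, ⟨hgy, hy⟩, hyu⟩ := h y
  refine ⟨gy * gx⁻¹, ⟨mul_mem hgy (inv_mem hgx), ?_⟩, ?_⟩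
  · rw [← hx, ← hact, ← act_mul, inv_mul_cancel_right, hact, hy]
  · rintro g ⟨hg, hgxy⟩
    rw [← hyu (g * gx) ⟨mul_mem hg hgx, ?_⟩, mul_inv_cancel_right]
    rw [← hact, act_mul, hact, hx, hgxy]

/-- A gamma function on `N`: the map `λ` of a skew brace with additive group `N`. -/
def IsGamma (γ : N → MulAut N) : Prop := ∀ n m, γ (n * γ n m) = γ n * γ m

namespace IsGamma

variable {γ : N → MulAut N} (h : IsGamma γ)

theorem map_one (h : IsGamma γ) : γ 1 = 1 := by
  have hmul := h 1 1
  rw [_root_.map_one, mul_one] at hmul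
  exact left_eq_mul.1 hmul

theorem map_inv (h : IsGamma γ) (n : N) : γ ((γ n)⁻¹ n⁻¹) = (γ n)⁻¹ := by
  have hmul := h n ((γ n)⁻¹ n⁻¹)
  rw [MulAut.apply_inv_self, mul_inv_cancel, h.map_one] at hmul
  exact eq_inv_of_mul_eq_one_right hmul.symm

/-- The regular subgroup of the holomorph attached to a gamma function. -/
def subgroup : Subgroup (Hol N) where
  carrier := {g | g.right = γ g.left}
  mul_mem' {x y} hx hy := by
    change (x * y).right = γ (x * y).left
    rw [SemidirectProduct.mul_left, SemidirectProduct.mul_right, MonoidHom.id_apply,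
      Set.mem_ofPred.1 hx, Set.mem_ofPred.1 hy, h]
  one_mem' := h.map_one.symm
  inv_mem' {x} hx := by
    change (x⁻¹).right = γ (x⁻¹).left
    rw [SemidirectProduct.inv_left, SemidirectProduct.inv_right, MonoidHom.id_apply,
      Set.mem_ofPred.1 hx, h.map_inv]

theorem mem_subgroup {g : Hol N} : g ∈ h.subgroup ↔ g.right = γ g.left := Iff.rfl

theorem isRegular : IsRegular h.subgroup :=
  isRegular_of_existsUnique fun n => ⟨⟨n, γ n⟩, ⟨rfl, rfl⟩, fun g hg =>
    SemidirectProduct.ext hg.2 (by rw [h.mem_subgroup.1 hg.1, hg.2])⟩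

end IsGamma

/-- The automorphism `α` carries the gamma function `γ` to `γ'`. -/
def Intertwines (γ γ' : N → MulAut N) (α : MulAut N) : Prop := ∀ n, α * γ n = γ' (α n) * α

theorem Intertwines.symm {γ γ' : N → MulAut N} {α : MulAut N} (h : Intertwines γ γ' α) :
    Intertwines γ' γ α⁻¹ := by
  intro n
  have hn := h (α⁻¹ n)
  rw [MulAut.apply_inv_self] at hn
  rw [eq_mul_inv_iff_mul_eq, mul_assoc, inv_mul_eq_iff_eq_mul, hn]

theorem Intertwines.trans {γ γ' γ'' : N → MulAut N} {α β : MulAut N} (h : Intertwines γ γ' α)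
    (h' : Intertwines γ' γ'' β) : Intertwines γ γ'' (β * α) := by
  intro n
  rw [mul_assoc, h, ← mul_assoc, h', mul_assoc]
  rfl

namespace Brace

variable (H : Subgroup (Hol N)) (hH : IsRegular H)

/-- The map `λ` of the skew brace of `H`, with values in `Aut N`. -/
noncomputable def gamma (n : N) : MulAut N := (elt H hH n).right

theorem elt_eq (n : N) : elt H hH n = ⟨n, gamma H hH n⟩ :=
  SemidirectProduct.ext (elt_left H hH n) rfl

theorem act_elt_eq (a b : N) : act (elt H hH a) b = a * gamma H hH a b := by
  rw [elt_eq, act]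

theorem gamma_eq_of_mem {n : N} {α : MulAut N} (h : (⟨n, α⟩ : Hol N) ∈ H) :
    gamma H hH n = α := by
  rw [gamma, ← eq_elt H hH h (a := n) (by simp [act])]

theorem mem_iff (g : Hol N) : g ∈ H ↔ g.right = gamma H hH g.left := by
  refine ⟨fun h => (gamma_eq_of_mem H hH (n := g.left) (α := g.right) h).symm, fun h => ?_⟩
  have hg : g = elt H hH g.left := by
    rw [elt_eq]
    exact SemidirectProduct.ext rfl h
  rw [hg]
  exact elt_mem H hH _

variable {H}

theorem mul_of (a b : N) : of H hH a * of H hH b = of H hH (a * gamma H hH a b) :=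
  congrArg (of H hH) (act_elt_eq H hH a b)

theorem add_of (a b : N) : of H hH a + of H hH b = of H hH (a * b) := rfl

theorem neg_of (a : N) : -of H hH a = of H hH a⁻¹ := rfl

theorem lam_of (a b : N) : lam (of H hH a) (of H hH b) = of H hH (gamma H hH a b) := by
  rw [lam, mul_of, neg_of, add_of, inv_mul_cancel_left]

/-- The additive group of the skew brace of `H` is `N`. -/
def addEquiv : Brace H hH ≃+ Additive N where
  toFun x := Additive.ofMul ((of H hH).symm x)
  invFun x := of H hH x.toMul
  left_inv _ := rfl
  right_inv _ := rfl
  map_add' _ _ := rfl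

/-- The multiplicative group of the skew brace of `H` is `H`. -/
noncomputable def mulEquiv : H ≃* Brace H hH where
  toFun g := of H hH g.1.left
  invFun x := ⟨elt H hH ((of H hH).symm x), elt_mem _ _ _⟩
  left_inv g := Subtype.ext (eq_elt H hH g.2 (by simp [act])).symm
  right_inv x := congrArg (of H hH) (elt_left H hH _)
  map_mul' g k := by
    rw [mul_of, ← (mem_iff H hH g.1).1 g.2]
    rfl

/-- A bijection from `N` onto a group that is multiplicative for the multiplication of the skew
brace, as an isomorphism. -/
noncomputable def mulEquivOfBijective {G : Type*} [Group G] {f : N → G}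
    (hf : Function.Bijective f) (hmul : ∀ a b, f (a * gamma H hH a b) = f a * f b) :
    Brace H hH ≃* G where
  toEquiv := (of H hH).symm.trans (Equiv.ofBijective f hf)
  map_mul' x y := by
    obtain ⟨a, rfl⟩ := (of H hH).surjective x
    obtain ⟨b, rfl⟩ := (of H hH).surjective y
    rw [mul_of]
    exact hmul a b

theorem thetaCard_eq_card_range :
    thetaCard (Brace H hH) = Nat.card (Set.range (gamma H hH)) := by
  let F : MulAut N → (Brace H hH → Brace H hH) := fun α x => of H hH (α ((of H hH).symm x))
  have hF : Function.Injective F := fun α β hαβ => MulEquiv.ext fun n => congrFun hαβ (of H hH n)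
  have hr : F '' Set.range (gamma H hH) = Set.range (lam : Brace H hH → _ → _) := by
    rw [← Set.range_comp]
    refine congrArg Set.range (funext fun n => funext fun x => ?_)
    exact (lam_of hH n x).symm
  rw [thetaCard, ← hr, Nat.card_image_of_injective hF]

theorem coe_map_Theta : (H.map (Theta N) : Set (MulAut N)) = Set.range (gamma H hH) := by
  ext α
  constructor
  · rintro ⟨g, hg, rfl⟩
    exact ⟨g.left, ((mem_iff H hH g).1 hg).symm⟩
  · rintro ⟨n, rfl⟩
    exact ⟨elt H hH n, elt_mem _ _ _, rfl⟩

theorem card_map_Theta : Nat.card (H.map (Theta N)) = Nat.card (Set.range (gamma H hH)) :=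
  Nat.card_congr (Equiv.setCongr (coe_map_Theta hH))

variable {H' : Subgroup (Hol N)} (hH' : IsRegular H')

/-- Isomorphisms between the skew braces of regular subgroups are automorphisms of `N`. -/
noncomputable def isoEquiv : (Brace H hH ≃+* Brace H' hH') ≃
    {α : MulAut N // Intertwines (gamma H hH) (gamma H' hH') α} where
  toFun e := ⟨MulEquiv.toAdditive.symm
      ((addEquiv hH).symm.trans ((e : Brace H hH ≃+ Brace H' hH').trans (addEquiv hH'))), by
    intro n
    ext m
    have h := map_lam e (of H hH n) (of H hH m)
    rw [lam_of] at h
    exact h.trans (lam_of hH' (e (of H hH n)) (e (of H hH m)))⟩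
  invFun α :=
    { toFun := fun x => of H' hH' (α.1 ((of H hH).symm x))
      invFun := fun x => of H hH (α.1.symm ((of H' hH').symm x))
      left_inv := fun x => by simp
      right_inv := fun x => by simp
      map_add' := fun x y =>
        congrArg (of H' hH') (α.1.map_mul ((of H hH).symm x) ((of H hH).symm y))
      map_mul' := fun x y => by
        obtain ⟨x, rfl⟩ := (of H hH).surjective x
        obtain ⟨y, rfl⟩ := (of H hH).surjective y
        rw [mul_of]
        simp only [Equiv.symm_apply_apply]
        rw [mul_of, map_mul]
        have hα : α.1 (gamma H hH x y) = gamma H' hH' (α.1 x) (α.1 y) :=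
          MulEquiv.congr_fun (α.2 x) y
        rw [hα] }
  left_inv _ := rfl
  right_inv _ := rfl

theorem nonempty_iso_iff : Nonempty (Brace H hH ≃+* Brace H' hH') ↔
    ∃ α : MulAut N, Intertwines (gamma H hH) (gamma H' hH') α :=
  (isoEquiv hH hH').nonempty_congr.trans nonempty_subtype

end Brace

namespace IsGamma

variable {γ : N → MulAut N} (h : IsGamma γ)

theorem gamma_eq : Brace.gamma h.subgroup h.isRegular = γ :=
  funext fun _ => Brace.gamma_eq_of_mem _ _ (h.mem_subgroup.2 rfl)

/-- An additive isomorphism from a skew brace to `N` that carries `λ` to `γ` is an isomorphism onto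
the skew brace of `γ`. -/
def braceEquiv {B : Type v} [SkewBrace B] (f : B ≃+ Additive N)
    (hf : ∀ b c, γ (f b).toMul (f c).toMul = (f (lam b c)).toMul) :
    B ≃+* Brace h.subgroup h.isRegular :=
  { f.trans (Brace.addEquiv h.isRegular).symm with
    map_mul' := fun b c => by
      have hmul := Brace.mul_of h.isRegular (f b).toMul (f c).toMul
      rw [h.gamma_eq, hf, ← toMul_add, ← map_add, ← mul_eq_add_lam] at hmul
      exact hmul.symm }

end IsGamma

/-- The map `λ` of a skew brace, carried over to `N` along an isomorphism of the additive group. -/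
def lamAut {B : Type v} [SkewBrace B] (f : B ≃+ Additive N) (n : N) : MulAut N :=
  MulEquiv.toAdditive.symm (f.symm.trans (AddEquiv.trans
    { toFun := lam (f.symm (.ofMul n))
      invFun := lam (f.symm (.ofMul n))⁻¹
      left_inv := fun b => by rw [← lam_mul, inv_mul_cancel, lam_one]
      right_inv := fun b => by rw [← lam_mul, mul_inv_cancel, lam_one]
      map_add' := lam_add _ } f))

theorem lamAut_apply {B : Type v} [SkewBrace B] (f : B ≃+ Additive N) (b c : B) :
    lamAut f (f b).toMul (f c).toMul = (f (lam b c)).toMul := by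
  simp [lamAut]

theorem isGamma_lamAut {B : Type v} [SkewBrace B] (f : B ≃+ Additive N) : IsGamma (lamAut f) := by
  intro n m
  obtain ⟨b, rfl⟩ := (f.toEquiv.trans Additive.toMul).surjective n
  obtain ⟨c, rfl⟩ := (f.toEquiv.trans Additive.toMul).surjective m
  ext k
  obtain ⟨d, rfl⟩ := (f.toEquiv.trans Additive.toMul).surjective k
  simp only [Equiv.trans_apply, AddEquiv.toEquiv_eq_coe, AddEquiv.coe_toEquiv, MulAut.mul_apply]
  rw [lamAut_apply, ← toMul_add, ← map_add, ← mul_eq_add_lam, lamAut_apply, lamAut_apply,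
    lamAut_apply, lam_mul]

theorem exists_isGamma_of_addEquiv {B : Type v} [SkewBrace B] (f : B ≃+ Additive N) :
    ∃ (γ : N → MulAut N) (h : IsGamma γ), Nonempty (B ≃+* Brace h.subgroup h.isRegular) :=
  ⟨lamAut f, isGamma_lamAut f, ⟨(isGamma_lamAut f).braceEquiv f (lamAut_apply f)⟩⟩

end Hol

namespace SkewBrace

variable {B : Type u} [SkewBrace B] {G : Type v} [Group G]

/-- The additive left translations of a skew brace, transported to a copy of the multiplicative
group. -/
def translation (φ : B ≃* G) : Multiplicative B →* Equiv.Perm G where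
  toFun b := (φ.symm.toEquiv.trans (Equiv.addLeft b.toAdd)).trans φ.toEquiv
  map_one' := by ext x; simp
  map_mul' a b := by ext x; simp

theorem translation_apply (φ : B ≃* G) (b c : B) :
    translation φ (Multiplicative.ofAdd b) (φ c) = φ (b + c) := by
  simp [translation]

theorem translation_one (φ : B ≃* G) (b : B) :
    translation φ (Multiplicative.ofAdd b) 1 = φ b := by
  have h := translation_apply φ b 1
  rwa [map_one, one_eq_zero, add_zero] at h

theorem isRegularNormalised_range (φ : B ≃* G) :
    IsRegularNormalised (translation φ).range where
  regular x y := by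
    obtain ⟨b, rfl⟩ := φ.surjective x
    obtain ⟨c, rfl⟩ := φ.surjective y
    refine ⟨translation φ (Multiplicative.ofAdd (c - b)), ⟨⟨_, rfl⟩, ?_⟩, ?_⟩
    · rw [translation_apply, sub_add_cancel]
    · rintro _ ⟨⟨a, rfl⟩, h⟩
      have h' : translation φ (Multiplicative.ofAdd a.toAdd) (φ b) = φ c := h
      rw [translation_apply] at h'
      rw [← φ.injective h', add_sub_cancel_right]
      rfl
  normalised g n hn := by
    obtain ⟨b, rfl⟩ := hn
    obtain ⟨c, rfl⟩ := φ.surjective g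
    refine ⟨Multiplicative.ofAdd (c * b.toAdd - c), Equiv.ext fun x => ?_⟩
    obtain ⟨d, rfl⟩ := φ.surjective x
    have h := translation_apply φ b.toAdd (c⁻¹ * d)
    rw [map_mul, map_inv] at h
    rw [translation_apply, Equiv.Perm.mul_apply, Equiv.Perm.mul_apply, Equiv.inv_mulLeft,
      Equiv.coe_mulLeft, Equiv.coe_mulLeft]
    refine Eq.trans ?_ (congrArg (φ c * ·) h).symm
    rw [← map_mul, brace_property, mul_inv_cancel_left]

theorem range_translation_eq_iff (φ : B ≃* G) {M : Subgroup (Equiv.Perm G)}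
    (hM : IsRegularNormalised M) :
    (translation φ).range = M ↔ ∀ b c, φ (b + c) = hM.elt (φ b) (φ c) := by
  constructor
  · rintro rfl b c
    rw [← hM.eq_elt ⟨Multiplicative.ofAdd b, rfl⟩ (translation_one φ b), translation_apply]
  · intro h
    have helt : ∀ b, translation φ (Multiplicative.ofAdd b) = hM.elt (φ b) := fun b =>
      Equiv.ext fun x => by
        obtain ⟨c, rfl⟩ := φ.surjective x
        rw [translation_apply, h]
    ext n
    constructor
    · rintro ⟨b, rfl⟩
      exact (helt b.toAdd) ▸ hM.elt_mem _
    · intro hn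
      refine ⟨Multiplicative.ofAdd (φ.symm (n 1)), ?_⟩
      rw [helt, φ.apply_symm_apply]
      exact (hM.eq_elt hn rfl).symm

/-- The isomorphisms from a skew brace to the one of a regular subgroup `M`, as those isomorphisms
of the multiplicative groups that carry the additive translations to `M`. -/
noncomputable def fiberEquiv {M : Subgroup (Equiv.Perm G)} (hM : IsRegularNormalised M) :
    {φ : B ≃* G // (translation φ).range = M} ≃ (B ≃+* hM.Brace) where
  toFun φ :=
    { toFun := φ.1
      invFun := φ.1.symm
      left_inv := φ.1.left_inv
      right_inv := φ.1.right_inv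
      map_mul' := φ.1.map_mul
      map_add' := (range_translation_eq_iff φ.1 hM).1 φ.2 }
  invFun e := ⟨
    { toFun := e
      invFun := e.symm
      left_inv := e.left_inv
      right_inv := e.right_inv
      map_mul' := e.map_mul }, (range_translation_eq_iff _ hM).2 e.map_add⟩
  left_inv _ := rfl
  right_inv _ := rfl

-- The isomorphisms `B ≃* G` are fibred over these subgroups, with `Aut B` acting simply
-- transitively on each fibre.
theorem card_mul_card_ringAut (φ₀ : B ≃* G) :
    Nat.card {M : Subgroup (Equiv.Perm G) //
      ∃ hM : IsRegularNormalised M, Nonempty (B ≃+* hM.Brace)} * Nat.card (RingAut B) =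
      Nat.card (MulAut G) := by
  let X := {M : Subgroup (Equiv.Perm G) //
      ∃ hM : IsRegularNormalised M, Nonempty (B ≃+* hM.Brace)}
  let F : (B ≃* G) → X := fun φ => ⟨(translation φ).range, isRegularNormalised_range φ,
    ⟨fiberEquiv _ ⟨φ, rfl⟩⟩⟩
  have hfib : ∀ M : X, Nonempty ({φ // F φ = M} ≃ RingAut B) := by
    rintro ⟨M, hM, ⟨e⟩⟩
    refine ⟨(Equiv.subtypeEquivRight fun φ => Subtype.ext_iff).trans ((fiberEquiv hM).trans ?_)⟩
    exact
      { toFun := fun f => f.trans e.symm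
        invFun := fun f => RingEquiv.trans f e
        left_inv := fun f => by ext; simp
        right_inv := fun f => by ext; simp }
  have e := (Equiv.sigmaFiberEquiv F).symm.trans
    ((Equiv.sigmaCongrRight fun M => (hfib M).some).trans (Equiv.sigmaEquivProd X (RingAut B)))
  rw [← Nat.card_prod, ← Nat.card_congr e]
  exact Nat.card_congr
    { toFun := fun f => φ₀.symm.trans f
      invFun := fun f => φ₀.trans f
      left_inv := fun f => by ext; simp
      right_inv := fun f => by ext; simp }

end SkewBrace

namespace IsRegularNormalised

variable {G : Type u} [Group G] {M : Subgroup (Equiv.Perm G)} (hM : IsRegularNormalised M)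

/-- The additive group of the skew brace of `M` is `M`. -/
noncomputable def addEquiv : hM.Brace ≃+ Additive M where
  toFun a := Additive.ofMul ⟨hM.elt a, hM.elt_mem a⟩
  invFun n := (n.toMul : Equiv.Perm G) 1
  left_inv a := hM.elt_one a
  right_inv n := congrArg Additive.ofMul (Subtype.ext (hM.eq_elt n.toMul.2 rfl).symm)
  map_add' a b := congrArg Additive.ofMul (Subtype.ext (hM.elt_elt a b))

theorem isBraceOf_iff {Γ : Type v} {N : Type w} [Group Γ] [Group N] (r : ℕ) (e : G ≃* Γ) :
    SkewBrace.IsBraceOf Γ N r hM.Brace ↔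
      Nonempty (M ≃* N) ∧ SkewBrace.thetaCard hM.Brace = r := by
  constructor
  · rintro ⟨-, ⟨f⟩, h⟩
    exact ⟨⟨MulEquiv.toAdditive.symm (hM.addEquiv.symm.trans f)⟩, h⟩
  · rintro ⟨⟨f⟩, h⟩
    exact ⟨⟨e⟩, ⟨hM.addEquiv.trans (MulEquiv.toAdditive f)⟩, h⟩

end IsRegularNormalised

namespace Hol.IsGamma

section Kernel

variable {N : Type*} [Group N] {γ : N → MulAut N} (h : IsGamma γ)

include h

theorem map_mul_inv_eq_one {x y : N} (hxy : γ x = γ y) : γ (x * y⁻¹) = 1 := by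
  have hmul := h x ((γ y)⁻¹ y⁻¹)
  rwa [h.map_inv, hxy, MulAut.apply_inv_self, mul_inv_cancel] at hmul

/-- The kernel of a gamma function. -/
def ker : Subgroup N where
  carrier := {n | γ n = 1}
  mul_mem' {x y} hx hy := by
    have hmul := h x y
    rwa [Set.mem_ofPred.1 hx, Set.mem_ofPred.1 hy, mul_one] at hmul
  one_mem' := h.map_one
  inv_mem' {x} hx := by
    have hinv := h.map_inv x
    rwa [Set.mem_ofPred.1 hx, inv_one] at hinv

theorem mem_ker {n : N} : n ∈ h.ker ↔ γ n = 1 := Iff.rfl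

theorem map_mul_of_mem_ker {k : N} (hk : k ∈ h.ker) (n : N) : γ (k * n) = γ n := by
  have hmul := h k n
  rwa [h.mem_ker.1 hk, one_mul, MulAut.one_apply] at hmul

theorem conj (α : MulAut N) : IsGamma fun n => α * γ (α⁻¹ n) * α⁻¹ := by
  intro n m
  have harg : α⁻¹ (n * (α * γ (α⁻¹ n) * α⁻¹) m) = α⁻¹ n * γ (α⁻¹ n) (α⁻¹ m) := by
    rw [map_mul, MulAut.mul_apply, MulAut.mul_apply, MulAut.inv_apply_self]
  simp only [harg, h (α⁻¹ n) (α⁻¹ m)]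
  group

theorem mem_map_Theta (n : N) : γ n ∈ h.subgroup.map (Theta N) := ⟨⟨n, γ n⟩, rfl, rfl⟩

theorem card_map_Theta : Nat.card (h.subgroup.map (Theta N)) = Nat.card (Set.range γ) := by
  rw [Brace.card_map_Theta h.isRegular, h.gamma_eq]

theorem commute_of_card_eq_sq {p : ℕ} [Fact p.Prime] (hcard : Nat.card (Set.range γ) = p ^ 2)
    (n m : N) : Commute (γ n) (γ m) := by
  let _ := IsPGroup.commGroupOfCardEqPrimeSq (h.card_map_Theta.trans hcard)
  exact congrArg Subtype.val (mul_comm (⟨γ n, h.mem_map_Theta n⟩ : h.subgroup.map (Theta N))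
    ⟨γ m, h.mem_map_Theta m⟩)

theorem pow_eq_one_of_card_eq {k : ℕ} (hcard : Nat.card (Set.range γ) = k) (n : N) :
    γ n ^ k = 1 := by
  rw [← hcard, ← h.card_map_Theta]
  exact congrArg Subtype.val
    (pow_card_eq_one' (x := (⟨γ n, h.mem_map_Theta n⟩ : h.subgroup.map (Theta N))))

end Kernel

end Hol.IsGamma

/-! ### Algebra and counting over finite fields -/

theorem eq_sub_of_cramer {R : Type*} [CommRing R] [IsDomain R] {x y z w m₁ m₂ s t : R}
    (h₁ : (x * w - y * z) * s = m₁ * x + m₂ * z) (h₂ : (x * w - y * z) * t = m₁ * y + m₂ * w)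
    (hdet : x * w - y * z ≠ 0) : m₁ = s * w - t * z ∧ m₂ = t * x - s * y := by
  constructor <;> apply mul_left_cancel₀ hdet
  · linear_combination z * h₂ - w * h₁
  · linear_combination y * h₁ - x * h₂

theorem zmod_map_eq_mul_map_one {n : ℕ} {f : ZMod n → ZMod n}
    (h : ∀ x y, f (x + y) = f x + f y) (x : ZMod n) : f x = x * f 1 := by
  simpa using ZMod.map_smul (AddMonoidHom.mk' f h) x 1

theorem zmod_map₂_eq {n : ℕ} {f : ZMod n → ZMod n → ZMod n}
    (h : ∀ b c b' c', f (b + b') (c + c') = f b c + f b' c') (b c : ZMod n) :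
    f b c = b * f 1 0 + c * f 0 1 := by
  have hb := zmod_map_eq_mul_map_one (f := fun b => f b 0) (fun x y => by simpa using h x 0 y 0) b
  have hc := zmod_map_eq_mul_map_one (f := f 0) (fun x y => by simpa using h 0 x 0 y) c
  have hbc := h b 0 0 c
  rwa [add_zero, zero_add, hb, hc] at hbc

section TwistedAdditive

variable {p : ℕ} [Fact p.Prime]

theorem eq_apply_one_zero_mul {k : ZMod p → ZMod p → ZMod p}
    (h : ∀ b c b' c', k (b + b') (c + (c' + k b c * b')) = k b c + k b' c') (b c : ZMod p) :
    k b c = k 1 0 * b := by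
  have hadd (b c s) : k b (c + s) = k b c + k 0 s := by simpa using h b c 0 s
  have hlin := zmod_map_eq_mul_map_one (f := k 0) (hadd 0)
  have h01 : k 0 1 = 0 := by
    have hprod := h 0 1 1 (-1)
    rw [show (1 : ZMod p) + (-1 + k 0 1 * 1) = 0 + k 0 1 by ring, zero_add 1, hadd, hlin (k 0 1)]
      at hprod
    have hcancel := hadd 1 (-1) 1
    rw [neg_add_cancel] at hcancel
    exact eq_zero_of_pow_eq_zero (n := 2) (by linear_combination hprod - hcancel)
  have hfst (b c) : k b c = k b 0 := by
    rw [← zero_add c, hadd, hlin, h01, mul_zero, add_zero]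
  rw [hfst, zmod_map_eq_mul_map_one (f := fun b => k b 0) (fun x y => ?_) b, mul_comm]
  rw [← h x 0 y 0]
  exact (hfst _ _).symm

theorem eq_quadratic_of_map_add (h2 : (2 : ZMod p) ≠ 0) {l : ZMod p → ZMod p → ZMod p}
    {a κ : ZMod p}
    (h : ∀ b c b' c', l (b + b') (c + (c' + κ * b * b')) = l b c + l b' c' + a * b * (κ * b'))
    (b c : ZMod p) :
    l b c = (a - l 0 1) * κ / 2 * b ^ 2 + (l 1 0 - (a - l 0 1) * κ / 2) * b + l 0 1 * c := by
  have hzero := zmod_map_eq_mul_map_one (f := l 0) fun x y => by simpa using h 0 x 0 y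
  have hsplit (b c) : l b c = l b 0 + l 0 1 * c := by
    have hb := h b 0 0 c
    simp only [add_zero, zero_add, mul_zero] at hb
    rw [hb, hzero, mul_comm]
  have hlin := zmod_map_eq_mul_map_one (f := fun b => l b 0 - (a - l 0 1) * κ / 2 * b ^ 2)
    fun x y => by
      have hxy := h x 0 y 0
      rw [hsplit] at hxy
      field_simp
      linear_combination 2 * hxy
  rw [hsplit]
  linear_combination hlin b

end TwistedAdditive

section Unipotent

theorem eq_one_of_add_eq_two {R : Type*} [CommRing R] [IsReduced R] {x w : R} (htr : x + w = 2)
    (hdet : (x - 1) * (w - 1) = 0) : x = 1 := by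
  have hsq : (x - 1) ^ 2 = 0 := by linear_combination (x - 1) * htr - hdet
  exact sub_eq_zero.1 (eq_zero_of_pow_eq_zero hsq)

theorem trace_and_det_sub_one_of_pow_eq_one {R : Type*} [CommRing R] [IsReduced R] {p : ℕ}
    [Fact p.Prime] [CharP R p] {M : Matrix (Fin 2) (Fin 2) R} {k : ℕ} (h : M ^ p ^ k = 1) :
    M 0 0 + M 1 1 = 2 ∧ (M 0 0 - 1) * (M 1 1 - 1) = M 0 1 * M 1 0 := by
  have hpow : (M - 1) ^ p ^ k = 0 := by
    rw [sub_pow_char_pow_of_commute p k (Commute.one_right M), h, one_pow, sub_self]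
  have htr := (Matrix.isNilpotent_trace_of_isNilpotent ⟨p ^ k, hpow⟩).eq_zero
  have hdet : (M - 1).det = 0 := by
    refine eq_zero_of_pow_eq_zero (n := p ^ k) ?_
    rw [← Matrix.det_pow, hpow, Matrix.det_zero]
  simp only [Matrix.trace_fin_two, Matrix.det_fin_two, Matrix.sub_apply, Matrix.one_apply_eq,
    Matrix.one_apply_ne zero_ne_one, Matrix.one_apply_ne one_ne_zero, sub_zero] at htr hdet
  exact ⟨by linear_combination htr, by linear_combination hdet⟩

theorem exists_mul_eq_mul_lowerUnipotent {K : Type*} [Field K] {M : Matrix (Fin 2) (Fin 2) K}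
    (htr : M 0 0 + M 1 1 = 2) (hdet : (M 0 0 - 1) * (M 1 1 - 1) = M 0 1 * M 1 0) (hM : M ≠ 1) :
    ∃ P : GL (Fin 2) K, M * P.1 = P.1 * !![1, 0; 1, 1] := by
  have heta : M = !![M 0 0, M 0 1; M 1 0, M 1 1] := Matrix.eta_fin_two M
  by_cases h10 : M 1 0 = 0
  · have h00 : M 0 0 = 1 := eq_one_of_add_eq_two htr (by rw [hdet, h10, mul_zero])
    have h11 : M 1 1 = 1 := by linear_combination htr - h00
    rw [h00, h10, h11] at heta
    have h01 : M 0 1 ≠ 0 := fun h01 => hM (by rw [heta, h01, Matrix.one_fin_two])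
    refine ⟨Matrix.GeneralLinearGroup.mkOfDetNeZero !![0, M 0 1; 1, 0]
      (by simpa [Matrix.det_fin_two_of] using h01), ?_⟩
    refine (congrArg (· * _) heta).trans ?_
    simp [Matrix.GeneralLinearGroup.mkOfDetNeZero]
  · refine ⟨Matrix.GeneralLinearGroup.mkOfDetNeZero !![1, M 0 0 - 1; 0, M 1 0]
      (by simpa [Matrix.det_fin_two_of] using h10), ?_⟩
    have h01 : M 0 0 * (M 0 0 - 1) + M 0 1 * M 1 0 = M 0 0 - 1 := by
      linear_combination (M 0 0 - 1) * htr - hdet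
    have h11 : M 1 0 * (M 0 0 - 1) + M 1 1 * M 1 0 = M 1 0 := by
      linear_combination M 1 0 * htr
    refine (congrArg (· * _) heta).trans ?_
    simp [Matrix.GeneralLinearGroup.mkOfDetNeZero, h01, h11]

theorem apply_zero_one_eq_zero_of_commute {R : Type*} [CommRing R] {M : Matrix (Fin 2) (Fin 2) R}
    (h : Commute M !![1, 0; 1, 1]) : M 0 1 = 0 := by
  simpa [Matrix.mul_apply, Fin.sum_univ_two] using congrFun (congrFun h.eq 0) 0

theorem det_ne_zero_of_forall {R : Type*} [CommRing R] [Nontrivial R] {x y z w : R}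
    (h : ∀ b c, b * x + c * y = 0 → b * z + c * w = 0 → b = 0 ∧ c = 0) :
    x * w - y * z ≠ 0 := by
  intro hdet
  obtain ⟨-, hz⟩ := h w (-z) (by linear_combination hdet) (by ring)
  obtain ⟨-, hx⟩ := h y (-x) (by ring) (by linear_combination -hdet)
  rw [neg_eq_zero] at hx hz
  exact one_ne_zero (h 1 0 (by rw [hx]; ring) (by rw [hz]; ring)).1

end Unipotent

theorem intCast_card_filter_ne {α : Type*} [Fintype α] [DecidableEq α] (a : α) :
    ((Finset.univ.filter fun x : α => x ≠ a).card : ℤ) = Fintype.card α - 1 := by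
  rw [Finset.filter_ne', Finset.card_erase_of_mem (Finset.mem_univ _), Finset.card_univ,
    Nat.cast_sub (Fintype.card_pos_iff.2 ⟨a⟩), Nat.cast_one]

section QuadraticChar

variable {F : Type*} [Field F] [Fintype F] [DecidableEq F]

theorem sum_quadraticChar_sq : ∑ b : F, quadraticChar F (b ^ 2) = Fintype.card F - 1 := by
  have h (b : F) : quadraticChar F (b ^ 2) = if b ≠ 0 then 1 else 0 := by
    split_ifs with hb
    · exact quadraticChar_sq_one' hb
    · simp [not_not.1 hb]
  rw [Finset.sum_congr rfl fun b _ => h b, ← Finset.natCast_card_filter, intCast_card_filter_ne]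

variable (hF : ringChar F ≠ 2)

include hF

theorem sum_quadraticChar_sub_mul {c : F} (hc : c ≠ 0) (d : F) :
    ∑ u, quadraticChar F (d - c * u) = 0 := by
  rw [← quadraticChar_sum_zero hF]
  exact ((Equiv.mulLeft₀ c hc).trans (Equiv.subLeft d)).sum_comp (quadraticChar F)

theorem card_filter_quadratic_eq_zero (u v b₂ : F) :
    ((Finset.univ.filter fun b₁ : F => b₁ ^ 2 + u * (b₁ * b₂) + v * b₂ ^ 2 = 0).card : ℤ) =
      quadraticChar F ((u ^ 2 - 4 * v) * b₂ ^ 2) + 1 := by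
  have h2 : (2 : F) ≠ 0 := Ring.two_ne_zero hF
  have h4 : (4 : F) ≠ 0 := by
    rw [show (4 : F) = 2 * 2 by norm_num]
    exact mul_ne_zero h2 h2
  rw [← quadraticChar_card_sqrts hF, Nat.cast_inj]
  refine Finset.card_equiv ((Equiv.mulLeft₀ 2 h2).trans (Equiv.addRight (u * b₂))) fun b₁ => ?_
  simp only [Finset.mem_filter, Finset.mem_univ, true_and, Set.mem_toFinset, Set.mem_ofPred_eq]
  change _ ↔ (2 * b₁ + u * b₂) ^ 2 = (u ^ 2 - 4 * v) * b₂ ^ 2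
  constructor <;> intro h
  · linear_combination 4 * h
  · exact mul_left_cancel₀ h4 (by linear_combination h)

theorem card_filter_quadraticForm_ne_zero (u v : F) :
    ((Finset.univ.filter fun b : F × F => b.1 ^ 2 + u * (b.1 * b.2) + v * b.2 ^ 2 ≠ 0).card : ℤ) =
      (Fintype.card F - 1) * (Fintype.card F - quadraticChar F (u ^ 2 - 4 * v)) := by
  have hzero : ((Finset.univ.filter fun b : F × F =>
      b.1 ^ 2 + u * (b.1 * b.2) + v * b.2 ^ 2 = 0).card : ℤ) =
        (Fintype.card F - 1) * quadraticChar F (u ^ 2 - 4 * v) + Fintype.card F := by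
    rw [Finset.card_filter, Fintype.sum_prod_type, Finset.sum_comm]
    simp only [← Finset.card_filter]
    rw [Nat.cast_sum, Finset.sum_congr rfl fun b₂ _ => card_filter_quadratic_eq_zero hF u v b₂]
    simp only [map_mul, Finset.sum_add_distrib, ← Finset.mul_sum, Finset.sum_const,
      Finset.card_univ, nsmul_one, sum_quadraticChar_sq]
    ring
  have htotal := Finset.card_filter_add_card_filter_not (s := (Finset.univ : Finset (F × F)))
    (fun b => b.1 ^ 2 + u * (b.1 * b.2) + v * b.2 ^ 2 = 0)
  rw [Finset.card_univ, Fintype.card_prod] at htotal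
  zify at htotal
  linear_combination htotal - hzero

end QuadraticChar

/-! ### Automorphisms of the Heisenberg group -/

namespace Heis

variable {p : ℕ}

instance [Fact p.Prime] : Finite (Heis p) := Nat.finite_of_card_ne_zero (by
  rw [card_heis]
  exact pow_ne_zero _ (Fact.out : p.Prime).ne_zero)

@[simp] theorem rho_a : (rho p).a = 1 := rfl

@[simp] theorem rho_b : (rho p).b = 0 := rfl

@[simp] theorem rho_c : (rho p).c = 0 := rfl

@[simp] theorem sigma_a : (sigma p).a = 0 := rfl

@[simp] theorem sigma_b : (sigma p).b = 1 := rfl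

@[simp] theorem sigma_c : (sigma p).c = 0 := rfl

@[simp] theorem tau_a : (tau p).a = 0 := rfl

@[simp] theorem tau_b : (tau p).b = 0 := rfl

@[simp] theorem tau_c : (tau p).c = 1 := rfl

variable [Fact p.Prime]

/-- The `ρ`-coordinate in exponential coordinates. With `X` in place of `a` the group law is the
Baker–Campbell–Hausdorff formula, and the automorphisms `autGL β` are linear. -/
def X (n : Heis p) : ZMod p := n.a - n.b * n.c / 2

theorem ext_X {n m : Heis p} (hX : X n = X m) (hb : n.b = m.b) (hc : n.c = m.c) : n = m := by
  refine Heis.ext ?_ hb hc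
  rw [X, X, hb, hc] at hX
  exact sub_left_injective hX

/-- The element with given exponential coordinates. -/
def ofX (x b c : ZMod p) : Heis p := ⟨x + b * c / 2, b, c⟩

@[simp] theorem X_ofX (x b c : ZMod p) : X (ofX x b c) = x := by simp [X, ofX]

@[simp] theorem ofX_b (x b c : ZMod p) : (ofX x b c).b = b := rfl

@[simp] theorem ofX_c (x b c : ZMod p) : (ofX x b c).c = c := rfl

@[simp] theorem X_one : X (1 : Heis p) = 0 := by simp [X]

@[simp] theorem X_rho : X (rho p) = 1 := by simp [X]

@[simp] theorem X_sigma : X (sigma p) = 0 := by simp [X]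

@[simp] theorem X_tau : X (tau p) = 0 := by simp [X]

theorem ofX_zero : ofX 0 0 0 = (1 : Heis p) := ext_X (by simp) rfl rfl

theorem ofX_one : ofX 1 0 0 = rho p := ext_X (by simp) rfl rfl

theorem mulAut_ext {α β : MulAut (Heis p)} (hρ : α (rho p) = β (rho p))
    (hσ : α (sigma p) = β (sigma p)) (hτ : α (tau p) = β (tau p)) : α = β :=
  MulEquiv.ext fun n => by
    rw [normal_form n]
    simp only [map_mul, map_pow, hρ, hσ, hτ]

/-- The inner automorphism with `σ ↦ ρ ^ r₁ * σ`, `τ ↦ ρ ^ r₃ * τ`. -/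
def inner (r₁ r₃ : ZMod p) : MulAut (Heis p) where
  toFun n := ⟨n.a + (r₁ * n.b + r₃ * n.c), n.b, n.c⟩
  invFun n := ⟨n.a - (r₁ * n.b + r₃ * n.c), n.b, n.c⟩
  left_inv n := by ext <;> simp
  right_inv n := by ext <;> simp
  map_mul' n m := Heis.ext (by simp only [mul_a, mul_b, mul_c]; ring) rfl rfl

theorem inner_mul (r₁ r₃ s₁ s₃ : ZMod p) :
    inner r₁ r₃ * inner s₁ s₃ = inner (r₁ + s₁) (r₃ + s₃) :=
  MulEquiv.ext fun n => Heis.ext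
    (by simp only [inner, MulAut.mul_apply, MulEquiv.coe_mk, Equiv.coe_fn_mk]; ring) rfl rfl

theorem inner_zero : inner 0 0 = (1 : MulAut (Heis p)) :=
  MulEquiv.ext fun n => Heis.ext (by simp [inner]) rfl rfl

theorem alpha1_eq_inner : alpha1 p = inner 1 0 :=
  MulEquiv.ext fun n => Heis.ext (by simp [inner, alpha1]) rfl rfl

theorem alpha3_eq_inner : alpha3 p = inner 0 1 :=
  MulEquiv.ext fun n => Heis.ext (by simp [inner, alpha3]) rfl rfl

theorem alpha1_pow (r : ℕ) : alpha1 p ^ r = inner (r : ZMod p) 0 := by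
  induction r with
  | zero => simp [inner_zero]
  | succ r ih => rw [pow_succ, ih, alpha1_eq_inner, inner_mul, add_zero, Nat.cast_succ]

theorem alpha3_pow (r : ℕ) : alpha3 p ^ r = inner 0 (r : ZMod p) := by
  induction r with
  | zero => simp [inner_zero]
  | succ r ih => rw [pow_succ, ih, alpha3_eq_inner, inner_mul, add_zero, Nat.cast_succ]

/-- The invertible matrix with given entries. -/
noncomputable def mat (x y z w : ZMod p) (h : x * w - y * z ≠ 0) : GL (Fin 2) (ZMod p) :=
  Matrix.GeneralLinearGroup.mkOfDetNeZero !![x, y; z, w] (by rwa [Matrix.det_fin_two_of])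

theorem coe_mat (x y z w : ZMod p) (h : x * w - y * z ≠ 0) :
    (mat x y z w h).1 = !![x, y; z, w] := rfl

theorem det_ne_zero (β : GL (Fin 2) (ZMod p)) :
    β.1 0 0 * β.1 1 1 - β.1 0 1 * β.1 1 0 ≠ 0 := by
  rw [← Matrix.det_fin_two]
  exact ((Matrix.isUnit_iff_isUnit_det _).1 β.isUnit).ne_zero

theorem eq_mat {β : GL (Fin 2) (ZMod p)} {x y z w : ZMod p}
    (hx : β.1 0 0 = x) (hy : β.1 0 1 = y) (hz : β.1 1 0 = z) (hw : β.1 1 1 = w) :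
    β = mat x y z w (by rw [← hx, ← hy, ← hz, ← hw]; exact det_ne_zero β) := by
  subst hx hy hz hw
  exact Units.ext (Matrix.eta_fin_two β.1)

variable [Fact (3 < p)]

theorem three_ne_zero' : (3 : ZMod p) ≠ 0 := by
  have hp : 3 < p := Fact.out
  intro h
  have hdvd : p ∣ 3 := (ZMod.natCast_eq_zero_iff 3 p).1 (mod_cast h)
  exact hp.not_ge (Nat.le_of_dvd three_pos hdvd)

theorem X_mul (n m : Heis p) : X (n * m) = X n + X m + (n.c * m.b - n.b * m.c) / 2 := by
  have h2 := two_ne_zero' (p := p)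
  simp only [X, mul_a, mul_b, mul_c]
  field_simp
  ring

theorem X_inv (n : Heis p) : X n⁻¹ = -X n := by
  have h2 := two_ne_zero' (p := p)
  simp only [X, inv_a, inv_b, inv_c]
  field_simp
  ring

theorem commutator_eq_ofX (n m : Heis p) :
    n * m * n⁻¹ * m⁻¹ = ofX (n.c * m.b - n.b * m.c) 0 0 := by
  have h2 := two_ne_zero' (p := p)
  refine ext_X ?_ (by simp) (by simp)
  simp only [X_mul, X_inv, mul_b, mul_c, inv_b, inv_c, X_ofX]
  field_simp
  ring

section Aut

/-- The automorphism `α₁ ^ r₁ * α₃ ^ r₃ * β`. -/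
noncomputable def aut (r₁ r₃ : ZMod p) (β : GL (Fin 2) (ZMod p)) : MulAut (Heis p) :=
  inner r₁ r₃ * autGL β

theorem aut_natCast (r₁ r₃ : ℕ) (β : GL (Fin 2) (ZMod p)) :
    aut (r₁ : ZMod p) (r₃ : ZMod p) β = alpha1 p ^ r₁ * alpha3 p ^ r₃ * autGL β := by
  rw [alpha1_pow, alpha3_pow, inner_mul, add_zero, zero_add, aut]

variable (r₁ r₃ : ZMod p) (β : GL (Fin 2) (ZMod p)) (n : Heis p)

theorem aut_b : (aut r₁ r₃ β n).b = β.1 0 0 * n.b + β.1 0 1 * n.c := rfl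

theorem aut_c : (aut r₁ r₃ β n).c = β.1 1 0 * n.b + β.1 1 1 * n.c := rfl

theorem X_aut : X (aut r₁ r₃ β n) = (β.1 0 0 * β.1 1 1 - β.1 0 1 * β.1 1 0) * X n +
    r₁ * (β.1 0 0 * n.b + β.1 0 1 * n.c) + r₃ * (β.1 1 0 * n.b + β.1 1 1 * n.c) := by
  have h2 := two_ne_zero' (p := p)
  have ha : (aut r₁ r₃ β n).a = (lin β.1 n).a +
    (r₁ * (β.1 0 0 * n.b + β.1 0 1 * n.c) + r₃ * (β.1 1 0 * n.b + β.1 1 1 * n.c)) := rfl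
  rw [X, aut_b, aut_c, ha, lin, X, Matrix.det_fin_two]
  field_simp
  ring

end Aut

theorem map_rho (α : MulAut (Heis p)) : α (rho p) =
    ofX ((α (sigma p)).b * (α (tau p)).c - (α (tau p)).b * (α (sigma p)).c) 0 0 := by
  have h : rho p = tau p * sigma p * (tau p)⁻¹ * (sigma p)⁻¹ := by
    rw [tau_sigma]; group
  rw [h, map_mul, map_mul, map_mul, map_inv, map_inv, commutator_eq_ofX]
  congr 1
  ring

theorem det_map_ne_zero (α : MulAut (Heis p)) :
    (α (sigma p)).b * (α (tau p)).c - (α (tau p)).b * (α (sigma p)).c ≠ 0 := by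
  intro h
  have hρ := map_rho α
  rw [h, ofX_zero, map_eq_one_iff α α.injective] at hρ
  have hX := congrArg X hρ
  rw [X_rho, X_one] at hX
  exact one_ne_zero hX

theorem mulAut_ext_sigma_tau {α β : MulAut (Heis p)} (hσ : α (sigma p) = β (sigma p))
    (hτ : α (tau p) = β (tau p)) : α = β :=
  mulAut_ext (by rw [map_rho, map_rho, hσ, hτ]) hσ hτ

theorem exists_eq_aut (α : MulAut (Heis p)) : ∃ r₁ r₃ β, α = aut r₁ r₃ β := by
  have hD := det_map_ne_zero α
  set s := α (sigma p) with hs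
  set t := α (tau p) with ht
  set D := s.b * t.c - t.b * s.c with hDdef
  refine ⟨(X s * t.c - X t * s.c) / D, (X t * s.b - X s * t.b) / D, mat s.b t.b s.c t.c hD,
    mulAut_ext_sigma_tau (ext_X ?_ ?_ ?_) (ext_X ?_ ?_ ?_)⟩
  · simp only [X_aut, X_sigma, sigma_b, sigma_c, coe_mat, Matrix.of_apply, Matrix.cons_val]
    field_simp
    rw [hDdef]
    ring
  · simp [aut_b, coe_mat, ← hs]
  · simp [aut_c, coe_mat, ← hs]
  · simp only [X_aut, X_tau, tau_b, tau_c, coe_mat, Matrix.of_apply, Matrix.cons_val]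
    field_simp
    rw [hDdef]
    ring
  · simp [aut_b, coe_mat, ← ht]
  · simp [aut_c, coe_mat, ← ht]

theorem aut_inj {r₁ r₃ s₁ s₃ : ZMod p} {β β' : GL (Fin 2) (ZMod p)} :
    aut r₁ r₃ β = aut s₁ s₃ β' ↔ r₁ = s₁ ∧ r₃ = s₃ ∧ β = β' := by
  refine ⟨fun h => ?_, by rintro ⟨rfl, rfl, rfl⟩; rfl⟩
  have hσ : aut r₁ r₃ β (sigma p) = aut s₁ s₃ β' (sigma p) := by rw [h]
  have hτ : aut r₁ r₃ β (tau p) = aut s₁ s₃ β' (tau p) := by rw [h]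
  have h00 := congrArg Heis.b hσ
  have h10 := congrArg Heis.c hσ
  have h01 := congrArg Heis.b hτ
  have h11 := congrArg Heis.c hτ
  have hXσ := congrArg X hσ
  have hXτ := congrArg X hτ
  simp only [aut_b, aut_c, X_aut, X_sigma, X_tau, sigma_b, sigma_c, tau_b, tau_c, mul_one,
    mul_zero, add_zero, zero_add] at h00 h01 h10 h11 hXσ hXτ
  obtain rfl : β = β' := by
    ext i j
    fin_cases i <;> fin_cases j <;> assumption
  have hD := det_ne_zero β
  refine ⟨mul_left_cancel₀ hD ?_, mul_left_cancel₀ hD ?_, rfl⟩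
  · linear_combination β.1 1 1 * hXσ - β.1 1 0 * hXτ
  · linear_combination β.1 0 0 * hXτ - β.1 0 1 * hXσ

/-- The parametrization of the automorphism group by `α₁ ^ r₁ * α₃ ^ r₃ * β`. -/
noncomputable def autEquiv : ZMod p × ZMod p × GL (Fin 2) (ZMod p) ≃ MulAut (Heis p) :=
  Equiv.ofBijective (fun t => aut t.1 t.2.1 t.2.2)
    ⟨fun _ _ h => Prod.ext_iff.2 ⟨(aut_inj.1 h).1, Prod.ext_iff.2 (aut_inj.1 h).2⟩,
    fun α => by
      obtain ⟨r₁, r₃, β, rfl⟩ := exists_eq_aut α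
      exact ⟨(r₁, r₃, β), rfl⟩⟩

variable (p) in
theorem card_mulAut : Nat.card (MulAut (Heis p)) = p ^ 2 * ((p ^ 2 - 1) * (p ^ 2 - p)) := by
  rw [← Nat.card_congr autEquiv, Nat.card_prod, Nat.card_prod, Nat.card_zmod,
    Matrix.card_GL_field, Fin.prod_univ_two, ZMod.card, Fin.val_zero, Fin.val_one, pow_zero,
    pow_one]
  ring

/-- The automorphism with `X ↦ X + l₁ b + l₂ c` and matrix with rows `(1, 0)`, `(k, 1)`. -/
def unip (l₁ l₂ k : ZMod p) : MulAut (Heis p) where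
  toFun n := ⟨n.a + k * n.b ^ 2 / 2 + l₁ * n.b + l₂ * n.c, n.b, n.c + k * n.b⟩
  invFun n := ⟨n.a - k * n.b ^ 2 / 2 - l₁ * n.b - l₂ * (n.c - k * n.b), n.b, n.c - k * n.b⟩
  left_inv n := Heis.ext (by ring) rfl (by ring)
  right_inv n := Heis.ext (by ring) rfl (by ring)
  map_mul' n m := by
    have h2 := two_ne_zero' (p := p)
    refine Heis.ext ?_ rfl ?_
    · simp only [mul_a, mul_b, mul_c]
      field_simp
      ring
    · simp only [mul_b, mul_c]
      ring

section Unip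

variable (l₁ l₂ k m₁ m₂ j : ZMod p)

@[simp] theorem unip_b (n : Heis p) : (unip l₁ l₂ k n).b = n.b := rfl

@[simp] theorem unip_c (n : Heis p) : (unip l₁ l₂ k n).c = n.c + k * n.b := rfl

@[simp] theorem X_unip (n : Heis p) : X (unip l₁ l₂ k n) = X n + l₁ * n.b + l₂ * n.c := by
  have h2 := two_ne_zero' (p := p)
  simp only [X, unip, MulEquiv.coe_mk, Equiv.coe_fn_mk]
  field_simp
  ring

theorem unip_mul :
    unip l₁ l₂ k * unip m₁ m₂ j = unip (l₁ + m₁ + l₂ * j) (l₂ + m₂) (k + j) := by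
  refine MulEquiv.ext fun n => ext_X ?_ rfl ?_ <;>
    simp only [MulAut.mul_apply, X_unip, unip_b, unip_c] <;> ring

theorem unip_zero : unip 0 0 0 = (1 : MulAut (Heis p)) :=
  MulEquiv.ext fun n => ext_X (by simp) (by simp) (by simp)

variable {l₁ l₂ k m₁ m₂ j}

theorem unip_inj : unip l₁ l₂ k = unip m₁ m₂ j ↔ l₁ = m₁ ∧ l₂ = m₂ ∧ k = j := by
  refine ⟨fun h => ?_, by rintro ⟨rfl, rfl, rfl⟩; rfl⟩
  have hσ : unip l₁ l₂ k (sigma p) = unip m₁ m₂ j (sigma p) := by rw [h]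
  have hτ : unip l₁ l₂ k (tau p) = unip m₁ m₂ j (tau p) := by rw [h]
  exact ⟨by simpa using congrArg X hσ, by simpa using congrArg X hτ,
    by simpa using congrArg Heis.c hσ⟩

theorem aut_mul_unip_iff (r₁ r₃ : ZMod p) (β : GL (Fin 2) (ZMod p)) :
    aut r₁ r₃ β * unip l₁ l₂ k = unip m₁ m₂ j * aut r₁ r₃ β ↔
      β.1 0 1 * k = 0 ∧ β.1 1 1 * k = j * β.1 0 0 ∧ j * β.1 0 1 = 0 ∧
      (β.1 0 0 * β.1 1 1 - β.1 0 1 * β.1 1 0) * l₁ + r₃ * β.1 1 1 * k =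
        m₁ * β.1 0 0 + m₂ * β.1 1 0 ∧
      (β.1 0 0 * β.1 1 1 - β.1 0 1 * β.1 1 0) * l₂ = m₁ * β.1 0 1 + m₂ * β.1 1 1 := by
  constructor
  · intro h
    have hσ := DFunLike.congr_fun h (sigma p)
    have hτ := DFunLike.congr_fun h (tau p)
    have hbσ := congrArg Heis.b hσ
    have hcσ := congrArg Heis.c hσ
    have hcτ := congrArg Heis.c hτ
    have hXσ := congrArg X hσ
    have hXτ := congrArg X hτ
    simp only [MulAut.mul_apply, aut_b, aut_c, X_aut, X_unip, unip_b, unip_c, X_sigma, X_tau,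
      sigma_b, sigma_c, tau_b, tau_c, mul_one, mul_zero, add_zero, zero_add]
      at hbσ hcσ hcτ hXσ hXτ
    have hk : β.1 0 1 * k = 0 := by linear_combination hbσ
    refine ⟨hk, by linear_combination hcσ, by linear_combination -hcτ, ?_, ?_⟩
    · linear_combination hXσ - r₁ * hk
    · linear_combination hXτ
  · rintro ⟨hk, hjk, hj, hl₁, hl₂⟩
    refine MulEquiv.ext fun n => ext_X ?_ ?_ ?_ <;>
      simp only [MulAut.mul_apply, aut_b, aut_c, X_aut, X_unip, unip_b, unip_c]
    · linear_combination n.b * hl₁ + n.c * hl₂ + r₁ * n.b * hk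
    · linear_combination n.b * hk
    · linear_combination n.b * hjk - n.c * hj

end Unip

end Heis

/-! ### The regular subgroups -/

namespace Heis

variable {p : ℕ}

theorem card_elemAb3 : Nat.card (ElemAb3 p) = p ^ 3 := by
  have hcard : Nat.card (Multiplicative (ZMod p)) = p :=
    (Nat.card_congr Multiplicative.toAdd).trans (Nat.card_zmod p)
  rw [ElemAb3, Nat.card_pi, Finset.prod_const, hcard, Finset.card_univ, Fintype.card_fin]

variable [Fact p.Prime]

theorem exists_nsmul_add_nsmul_eq {x y z w : ZMod p} (h : x * w - y * z ≠ 0) (b c : ZMod p) :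
    ∃ i j : ℕ, (i : ZMod p) * x + j * y = b ∧ (i : ZMod p) * z + j * w = c := by
  obtain ⟨i, hi⟩ := ZMod.natCast_zmod_surjective ((b * w - y * c) / (x * w - y * z))
  obtain ⟨j, hj⟩ := ZMod.natCast_zmod_surjective ((x * c - b * z) / (x * w - y * z))
  refine ⟨i, j, ?_, ?_⟩ <;>
    · rw [hi, hj, div_mul_eq_mul_div, div_mul_eq_mul_div, ← add_div, div_eq_iff h]
      ring

namespace Param

/-- The parameters for which the subgroup is regular. -/
def Valid : Param p → Prop
  | .A _ u₃ => u₃ ≠ 0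
  | .B v₂ => v₂ ≠ 0
  | .C x₃ _ => x₃ ≠ 0

theorem IsHeis.valid {t : Param p} (h : t.IsHeis) : t.Valid := by
  cases t <;> exact h.1

theorem Valid.isHeis_or_isElem {t : Param p} (h : t.Valid) : t.IsHeis ∨ t.IsElem := by
  cases t with
  | A u₂ u₃ => exact (em (u₂ = u₃)).symm.imp (⟨h, ·⟩) (⟨h, ·⟩)
  | B v₂ => exact (em (v₂ = 2)).symm.imp (⟨h, ·⟩) id
  | C x₃ a => exact (em (a * x₃ = 1 + x₃)).symm.imp (⟨h, ·⟩) (⟨h, ·⟩)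

/-- The coordinate replacing `c` on the multiplicative group of the skew brace. -/
def mulC : Param p → Heis p → ZMod p
  | .A _ _, n => n.c
  | .B _, n => n.c
  | .C _ _, n => n.c - n.b ^ 2 / 2

/-- The coordinate replacing `X` on the multiplicative group of the skew brace. The corrections
subtracted from `X` remove the symmetric part of the cocycle of this central extension, which
leaves `kappa` times the cocycle of the Heisenberg group. -/
def mulX : Param p → Heis p → ZMod p
  | .A u₂ u₃, n => X n - (n.b ^ 2 - u₂ / u₃ * n.b * n.c + n.c ^ 2 / u₃) / 2
  | .B _, n => X n
  | .C x₃ a, n => X n - ((a / 2 - 1 / 4) * n.b ^ 3 / 3 + (x₃⁻¹ - a - 1) / 2 * n.b ^ 2 / 2 +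
      (x₃⁻¹ + a) / 2 * n.b * (n.c - n.b ^ 2 / 2))

/-- The factor by which commutators in the multiplicative group differ from those in the additive
group. -/
def kappa : Param p → ZMod p
  | .A u₂ u₃ => 1 - u₂ / u₃
  | .B v₂ => 1 - 2 / v₂
  | .C x₃ a => 1 + x₃⁻¹ - a

theorem eq_of_mulC_eq_of_mulX_eq (t : Param p) {n m : Heis p} (hb : n.b = m.b)
    (hc : t.mulC n = t.mulC m) (hX : t.mulX n = t.mulX m) : n = m := by
  have hc' : n.c = m.c := by
    cases t with
    | A u₂ u₃ => exact hc
    | B v₂ => exact hc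
    | C x₃ a => simpa [mulC, hb] using hc
  exact ext_X (by cases t <;> simpa [mulX, hb, hc'] using hX) hb hc'

theorem IsHeis.kappa_ne_zero {t : Param p} (h : t.IsHeis) : t.kappa ≠ 0 := by
  cases t with
  | A u₂ u₃ =>
    rw [kappa, sub_ne_zero, Ne, eq_div_iff h.1, one_mul]
    exact Ne.symm h.2
  | B v₂ =>
    rw [kappa, sub_ne_zero, Ne, eq_div_iff h.1, one_mul]
    exact h.2
  | C x₃ a =>
    intro h0
    rw [kappa] at h0
    exact h.2 (by linear_combination inv_mul_cancel₀ h.1 - x₃ * h0)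

variable [Fact (3 < p)]

theorem IsElem.valid {t : Param p} (h : t.IsElem) : t.Valid := by
  cases t with
  | A u₂ u₃ => exact h.1
  | B v₂ => exact (show v₂ = 2 from h) ▸ two_ne_zero'
  | C x₃ a => exact h.1

theorem IsElem.kappa_eq_zero {t : Param p} (h : t.IsElem) : t.kappa = 0 := by
  cases t with
  | A u₂ u₃ => rw [kappa, h.2, div_self h.1, sub_self]
  | B v₂ => rw [kappa, show v₂ = 2 from h, div_self two_ne_zero', sub_self]
  | C x₃ a =>
    rw [kappa]
    linear_combination -x₃⁻¹ * h.2 + (a - 1) * inv_mul_cancel₀ h.1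

/-- The gamma function of the subgroup with the given parameters. -/
def gamma : Param p → Heis p → MulAut (Heis p)
  | .A u₂ u₃, n => unip (n.b - u₂ / u₃ * n.c) (n.c / u₃) 0
  | .B v₂, n => unip (-n.c / v₂) (n.b / v₂) 0
  | .C x₃ a, n => unip ((a - x₃⁻¹) / 2 * n.b ^ 2 + (x₃⁻¹ - a - 1) / 2 * n.b + x₃⁻¹ * n.c)
      (a * n.b) n.b

theorem isGamma_gamma (t : Param p) : Hol.IsGamma t.gamma := by
  have h2 := two_ne_zero' (p := p)
  intro n m
  cases t with
  | A u₂ u₃ =>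
    simp only [gamma, unip_mul, mul_b, mul_c, unip_b, unip_c]
    congr 1 <;> ring
  | B v₂ =>
    simp only [gamma, unip_mul, mul_b, mul_c, unip_b, unip_c]
    congr 1 <;> ring
  | C x₃ a =>
    simp only [gamma, unip_mul, mul_b, mul_c, unip_b, unip_c]
    congr 1
    · field_simp
      ring
    · ring

theorem b_mul_gamma (t : Param p) (n m : Heis p) : (n * t.gamma n m).b = n.b + m.b := by
  cases t <;> simp [gamma]

theorem mulC_mul_gamma (t : Param p) (n m : Heis p) :
    t.mulC (n * t.gamma n m) = t.mulC n + t.mulC m := by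
  have h2 := two_ne_zero' (p := p)
  cases t <;> simp only [mulC, gamma, mul_b, mul_c, unip_b, unip_c]
  all_goals
    field_simp
    ring

theorem mulX_mul_gamma (t : Param p) (n m : Heis p) : t.mulX (n * t.gamma n m) =
    t.mulX n + t.mulX m + t.kappa * ((t.mulC n * m.b - n.b * t.mulC m) / 2) := by
  have h2 := two_ne_zero' (p := p)
  have h3 := three_ne_zero' (p := p)
  have h4 : (4 : ZMod p) ≠ 0 := by
    have h : (4 : ZMod p) = 2 * 2 := by norm_num
    exact h ▸ mul_ne_zero h2 h2
  cases t with
  | A u₂ u₃ =>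
    simp only [gamma, mulX, kappa, mulC, X_mul, mul_b, mul_c, unip_b, unip_c, X_unip,
      div_eq_mul_inv]
    generalize u₃⁻¹ = e
    field_simp
    ring
  | B v₂ =>
    simp only [gamma, mulX, kappa, mulC, X_mul, unip_b, unip_c, X_unip, div_eq_mul_inv]
    generalize v₂⁻¹ = e
    field_simp
    ring
  | C x₃ a =>
    simp only [gamma, mulX, kappa, mulC, X_mul, mul_b, mul_c, unip_b, unip_c, X_unip]
    generalize x₃⁻¹ = e
    field_simp
    ring

section Group

variable {H : Subgroup (Hol (Heis p))} (hH : Hol.IsRegular H)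

theorem IsHeis.nonempty_mulEquiv {t : Param p} (ht : t.IsHeis)
    (hg : Hol.Brace.gamma H hH = t.gamma) : Nonempty (Hol.Brace H hH ≃* Heis p) := by
  have hk := ht.kappa_ne_zero
  let f : Heis p → Heis p := fun n => ofX (t.mulX n / t.kappa) n.b (t.mulC n)
  have hf : Function.Injective f := by
    intro n m h
    have hX := congrArg X h
    rw [X_ofX, X_ofX, div_left_inj' hk] at hX
    have hb : (f n).b = (f m).b := congrArg Heis.b h
    have hc : (f n).c = (f m).c := congrArg Heis.c h
    exact t.eq_of_mulC_eq_of_mulX_eq hb hc hX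
  refine ⟨Hol.Brace.mulEquivOfBijective hH (Finite.injective_iff_bijective.1 hf) fun n m => ?_⟩
  rw [hg]
  refine ext_X ?_ (b_mul_gamma t n m) (mulC_mul_gamma t n m)
  simp only [f, X_ofX, X_mul (ofX _ _ _), mulX_mul_gamma, ofX_b, ofX_c]
  field_simp

theorem IsElem.nonempty_mulEquiv {t : Param p} (ht : t.IsElem)
    (hg : Hol.Brace.gamma H hH = t.gamma) : Nonempty (Hol.Brace H hH ≃* ElemAb3 p) := by
  let f : Heis p → ElemAb3 p := fun n => ![.ofAdd (t.mulX n), .ofAdd n.b, .ofAdd (t.mulC n)]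
  have hf : Function.Injective f := fun n m h =>
    t.eq_of_mulC_eq_of_mulX_eq (congrFun h 1) (congrFun h 2) (congrFun h 0)
  have hbij : Function.Bijective f :=
    (Nat.bijective_iff_injective_and_card f).2 ⟨hf, (card_heis p).trans card_elemAb3.symm⟩
  refine ⟨Hol.Brace.mulEquivOfBijective hH hbij fun n m => ?_⟩
  simp only [f, hg, mulX_mul_gamma, b_mul_gamma, mulC_mul_gamma, ht.kappa_eq_zero, zero_mul,
    add_zero]
  funext i
  fin_cases i <;> rfl

end Group

theorem gamma_eq_one {t : Param p} {n : Heis p} (hb : n.b = 0) (hc : t.mulC n = 0) :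
    t.gamma n = 1 := by
  cases t <;> simp_all [gamma, mulC, unip_zero]

theorem Valid.injective_gamma {t : Param p} (ht : t.Valid) :
    Function.Injective fun v : ZMod p × ZMod p => t.gamma ⟨0, v.1, v.2⟩ := by
  rintro ⟨b, c⟩ ⟨b', c'⟩ h
  cases t with
  | A u₂ u₃ =>
    obtain ⟨hl₁, hl₂, -⟩ := unip_inj.1 h
    obtain rfl : c = c' := (div_left_inj' ht).1 hl₂
    exact Prod.ext (sub_left_injective hl₁) rfl
  | B v₂ =>
    obtain ⟨hl₁, hl₂, -⟩ := unip_inj.1 h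
    exact Prod.ext ((div_left_inj' ht).1 hl₂) (neg_injective ((div_left_inj' ht).1 hl₁))
  | C x₃ a =>
    obtain ⟨hl₁, -, hk⟩ := unip_inj.1 h
    obtain rfl : b = b' := hk
    exact Prod.ext rfl (mul_left_cancel₀ (inv_ne_zero ht) (add_left_cancel hl₁))

theorem Valid.card_range_gamma {t : Param p} (ht : t.Valid) :
    Nat.card (Set.range t.gamma) = p ^ 2 := by
  have hr : Set.range t.gamma =
      Set.range fun v : ZMod p × ZMod p => t.gamma ⟨0, v.1, v.2⟩ := by
    ext α
    constructor
    · rintro ⟨n, rfl⟩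
      exact ⟨(n.b, n.c), by cases t <;> rfl⟩
    · rintro ⟨v, rfl⟩
      exact ⟨_, rfl⟩
  rw [hr, Nat.card_congr (Equiv.ofInjective _ ht.injective_gamma).symm, Nat.card_prod,
    Nat.card_zmod, sq]

section Generators

variable (t : Param p)

/-- The projection of the group of the gamma function of `t` to its two additive coordinates, with
kernel the powers of `ρ`. -/
def planeHom : t.isGamma_gamma.subgroup →* Multiplicative (ZMod p × ZMod p) :=
  MonoidHom.mk' (fun g => .ofAdd (g.1.left.b, t.mulC g.1.left)) fun g h => by
    rw [← ofAdd_add, Prod.mk_add_mk, ← b_mul_gamma, ← mulC_mul_gamma,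
      ← t.isGamma_gamma.mem_subgroup.1 g.2]
    rfl

theorem mem_zpowers_of_planeHom_eq_one {g : t.isGamma_gamma.subgroup} (hg : t.planeHom g = 1) :
    g.1 ∈ Subgroup.zpowers (hol (rho p) 1) := by
  obtain ⟨hb, hc⟩ := Prod.ext_iff.1 (ofAdd_eq_one.1 hg)
  have hright : g.1.right = 1 := (t.isGamma_gamma.mem_subgroup.1 g.2).trans (gamma_eq_one hb hc)
  have hc' : g.1.left.c = 0 := by cases t <;> simp_all [mulC]
  refine ⟨g.1.left.a.val, ?_⟩
  change (SemidirectProduct.inl (rho p) : Hol (Heis p)) ^ (g.1.left.a.val : ℤ) = g.1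
  rw [zpow_natCast, ← map_pow, rho_pow, ZMod.natCast_zmod_val]
  exact SemidirectProduct.ext (Heis.ext rfl hb.symm hc'.symm) hright.symm

theorem subgroup_le_of_generators {H : Subgroup (Hol (Heis p))}
    (hρ : hol (rho p) 1 ∈ H) {n m : Heis p} (hn : hol n (t.gamma n) ∈ H)
    (hm : hol m (t.gamma m) ∈ H) (hnm : n.b * t.mulC m - m.b * t.mulC n ≠ 0) :
    t.isGamma_gamma.subgroup ≤ H := by
  intro g hg
  obtain ⟨i, j, hb, hc⟩ := exists_nsmul_add_nsmul_eq hnm g.left.b (t.mulC g.left)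
  let x : t.isGamma_gamma.subgroup := ⟨hol n (t.gamma n), rfl⟩
  let y : t.isGamma_gamma.subgroup := ⟨hol m (t.gamma m), rfl⟩
  have hplane : t.planeHom (x ^ i * y ^ j) = t.planeHom ⟨g, hg⟩ := by
    rw [map_mul, map_pow, map_pow]
    refine congrArg Multiplicative.ofAdd (Prod.ext ?_ ?_)
    · exact (congrArg₂ (· + ·) (nsmul_eq_mul i _) (nsmul_eq_mul j _)).trans hb
    · exact (congrArg₂ (· + ·) (nsmul_eq_mul i _) (nsmul_eq_mul j _)).trans hc
  have hker : g * ((x ^ i * y ^ j : t.isGamma_gamma.subgroup) : Hol (Heis p))⁻¹ ∈ H := by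
    refine Subgroup.zpowers_le.2 hρ (t.mem_zpowers_of_planeHom_eq_one
      (g := ⟨g, hg⟩ * (x ^ i * y ^ j)⁻¹) ?_)
    rw [map_mul, map_inv, hplane, mul_inv_cancel]
  exact (mul_mem_cancel_right (inv_mem (mul_mem (pow_mem hn i) (pow_mem hm j)))).1 hker

end Generators

theorem alpha1_eq_unip : alpha1 p = unip 1 0 0 := by
  ext n <;> simp [alpha1, unip]

theorem alpha2_eq_unip : alpha2 p = unip (-1 / 2) 0 1 := by
  have h2 := two_ne_zero' (p := p)
  refine MulEquiv.ext fun n => Heis.ext ?_ rfl (by simp [alpha2, unip])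
  simp only [alpha2, unip, MulEquiv.coe_mk, Equiv.coe_fn_mk]
  field_simp
  ring

theorem alpha3_eq_unip : alpha3 p = unip 0 1 0 := by
  ext n <;> simp [alpha3, unip]

theorem alpha3_pow_val (a : ZMod p) : alpha3 p ^ a.val = unip 0 a 0 := by
  rw [alpha3_pow, ZMod.natCast_zmod_val]
  ext n <;> simp [inner, unip]

theorem Valid.exists_generators {t : Param p} (ht : t.Valid) :
    ∃ n m, n.b * t.mulC m - m.b * t.mulC n ≠ 0 ∧
      t.subgroup = Subgroup.closure {hol (rho p) 1, hol n (t.gamma n), hol m (t.gamma m)} := by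
  have h2 := two_ne_zero' (p := p)
  cases t with
  | A u₂ u₃ =>
    have ht : u₃ ≠ 0 := ht
    refine ⟨sigma p, sigma p ^ u₂.val * tau p ^ u₃.val, ?_, ?_⟩
    · simpa [mulC, sigma_pow, tau_pow] using ht
    · simp [subgroup, gamma, alpha1_eq_unip, alpha3_eq_unip, sigma_pow, tau_pow, ht]
  | B v₂ =>
    have ht : v₂ ≠ 0 := ht
    refine ⟨(tau p ^ v₂.val)⁻¹, sigma p ^ v₂.val, ?_, ?_⟩
    · simpa [mulC, sigma_pow, tau_pow] using ht
    · simp [subgroup, gamma, alpha1_eq_unip, alpha3_eq_unip, sigma_pow, tau_pow, ht]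
  | C x₃ a =>
    have ht : x₃ ≠ 0 := ht
    refine ⟨tau p ^ x₃.val, sigma p, ?_, ?_⟩
    · simpa [mulC, tau_pow] using ht
    · have hσ : alpha2 p * alpha3 p ^ a.val = gamma (.C x₃ a) (sigma p) := by
        rw [alpha2_eq_unip, alpha3_pow_val, unip_mul, gamma]
        simp only [sigma_b, sigma_c]
        congr 1 <;> field_simp <;> ring
      simp [subgroup, hσ, gamma, alpha1_eq_unip, tau_pow, ht]

theorem Valid.subgroup_eq {t : Param p} (ht : t.Valid) :
    t.subgroup = t.isGamma_gamma.subgroup := by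
  obtain ⟨n, m, hnm, hcl⟩ := ht.exists_generators
  rw [hcl]
  refine le_antisymm ?_ (t.subgroup_le_of_generators (n := n) (m := m)
    (Subgroup.subset_closure (by simp)) (Subgroup.subset_closure (by simp))
    (Subgroup.subset_closure (by simp)) hnm)
  rw [Subgroup.closure_le]
  rintro _ (rfl | rfl | rfl)
  · exact (gamma_eq_one rfl (by cases t <;> simp [mulC, hol])).symm
  · rfl
  · rfl

theorem Valid.isRegular {t : Param p} (ht : t.Valid) : Hol.IsRegular t.subgroup :=
  ht.subgroup_eq ▸ t.isGamma_gamma.isRegular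

theorem Valid.gamma_eq {t : Param p} (ht : t.Valid) (h : Hol.IsRegular t.subgroup) :
    Hol.Brace.gamma t.subgroup h = t.gamma :=
  funext fun _ => Hol.Brace.gamma_eq_of_mem _ _ (ht.subgroup_eq ▸ rfl)

theorem Valid.thetaCard_eq {t : Param p} (ht : t.Valid) (h : Hol.IsRegular t.subgroup) :
    SkewBrace.thetaCard (Hol.Brace t.subgroup h) = p ^ 2 := by
  rw [Hol.Brace.thetaCard_eq_card_range, ht.gamma_eq, ht.card_range_gamma]

theorem IsHeis.isBraceOf {t : Param p} (ht : t.IsHeis) (h : Hol.IsRegular t.subgroup) :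
    SkewBrace.IsBraceOf (Heis p) (Heis p) (p ^ 2) (Hol.Brace t.subgroup h) :=
  ⟨ht.nonempty_mulEquiv h (ht.valid.gamma_eq h), ⟨Hol.Brace.addEquiv h⟩, ht.valid.thetaCard_eq h⟩

theorem IsElem.isBraceOf {t : Param p} (ht : t.IsElem) (h : Hol.IsRegular t.subgroup) :
    SkewBrace.IsBraceOf (ElemAb3 p) (Heis p) (p ^ 2) (Hol.Brace t.subgroup h) :=
  ⟨ht.nonempty_mulEquiv h (ht.valid.gamma_eq h), ⟨Hol.Brace.addEquiv h⟩, ht.valid.thetaCard_eq h⟩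

end Param

end Heis

/-! ### Isomorphisms within the list -/

namespace Heis.Param

open Hol

variable {p : ℕ} [Fact p.Prime]

theorem apply_zero_zero_ne_zero {β : GL (Fin 2) (ZMod p)} (h01 : β.1 0 1 = 0) :
    β.1 0 0 ≠ 0 := by
  have hdet := det_ne_zero β
  rw [h01, zero_mul, sub_zero] at hdet
  exact left_ne_zero_of_mul hdet

variable [Fact (3 < p)]

section A

variable {u₂ u₃ u₂' u₃' r₁ r₃ : ZMod p} {β : GL (Fin 2) (ZMod p)} (h' : u₃' ≠ 0)

include h'

theorem mat_eq_of_intertwines_A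
    (hi : Intertwines (A u₂ u₃).gamma (A u₂' u₃').gamma (aut r₁ r₃ β)) :
    β.1 1 0 = -β.1 0 1 * u₃' ∧ β.1 1 1 = β.1 0 0 + β.1 0 1 * u₂' := by
  obtain ⟨-, -, -, h₁, h₂⟩ := (aut_mul_unip_iff ..).1 (hi ⟨0, 1, 0⟩)
  rw [aut_b, aut_c] at h₁ h₂
  simp only [mul_zero, mul_one, add_zero] at h₁ h₂
  obtain ⟨hb, hc⟩ := eq_sub_of_cramer h₁ h₂ (det_ne_zero β)
  rw [zero_div] at hb hc
  field_simp at hb hc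
  have h10 : β.1 1 0 = -β.1 0 1 * u₃' := by linear_combination hc
  refine ⟨h10, ?_⟩
  rw [h10] at hb
  field_simp at hb
  linear_combination -hb

theorem mat_mul_eq_of_intertwines_A (h : u₃ ≠ 0)
    (hi : Intertwines (A u₂ u₃).gamma (A u₂' u₃').gamma (aut r₁ r₃ β)) :
    β.1 0 0 * u₂ + β.1 0 1 * u₃ = u₂' * β.1 0 0 - β.1 1 0 ∧
      β.1 1 0 * u₂ + β.1 1 1 * u₃ = β.1 0 0 * u₃' := by
  obtain ⟨-, -, -, h₁, h₂⟩ := (aut_mul_unip_iff ..).1 (hi ⟨0, u₂, u₃⟩)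
  rw [aut_b, aut_c] at h₁ h₂
  simp only [mul_zero, add_zero] at h₁ h₂
  obtain ⟨hb, hc⟩ := eq_sub_of_cramer h₁ h₂ (det_ne_zero β)
  rw [div_self h, div_mul_cancel₀ _ h, sub_self] at hb hc
  have hc' : β.1 1 0 * u₂ + β.1 1 1 * u₃ = β.1 0 0 * u₃' := by
    field_simp at hc
    linear_combination hc
  refine ⟨?_, hc'⟩
  rw [hc'] at hb
  field_simp at hb
  linear_combination hb

theorem eq_of_intertwines_A (h : u₃ ≠ 0)
    (hi : Intertwines (A u₂ u₃).gamma (A u₂' u₃').gamma (aut r₁ r₃ β)) :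
    u₂ = u₂' ∧ u₃ = u₃' := by
  obtain ⟨h10, h11⟩ := mat_eq_of_intertwines_A h' hi
  obtain ⟨hb, hc⟩ := mat_mul_eq_of_intertwines_A h' h hi
  have hdet := det_ne_zero β
  have hb' : (u₂ - u₂') * β.1 0 0 + (u₃ - u₃') * β.1 0 1 = 0 := by
    linear_combination hb - h10
  have hc' : (u₂ - u₂') * β.1 1 0 + (u₃ - u₃') * β.1 1 1 = 0 := by
    linear_combination hc - u₂' * h10 - u₃' * h11
  constructor <;> refine sub_eq_zero.1 ((mul_eq_zero.1 ?_).resolve_left hdet)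
  · linear_combination β.1 1 1 * hb' - β.1 0 1 * hc'
  · linear_combination β.1 0 0 * hc' - β.1 1 0 * hb'

theorem intertwines_A_iff (h : u₃ ≠ 0) :
    Intertwines (A u₂ u₃).gamma (A u₂' u₃').gamma (aut r₁ r₃ β) ↔
      (u₂ = u₂' ∧ u₃ = u₃') ∧ β.1 1 0 = -β.1 0 1 * u₃ ∧ β.1 1 1 = β.1 0 0 + β.1 0 1 * u₂ := by
  constructor
  · intro hi
    obtain ⟨rfl, rfl⟩ := eq_of_intertwines_A h' h hi
    exact ⟨⟨rfl, rfl⟩, mat_eq_of_intertwines_A h hi⟩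
  · rintro ⟨⟨rfl, rfl⟩, h10, h11⟩ n
    refine (aut_mul_unip_iff ..).2 ⟨by ring, by ring, by ring, ?_, ?_⟩
    all_goals
      rw [aut_b, aut_c, h10, h11]
      field_simp
      ring

end A

section B

variable {v v' : ZMod p} (h : v ≠ 0)

include h

theorem eq_of_intertwines_B (h' : v' ≠ 0) {α : MulAut (Heis p)}
    (hi : Intertwines (B v).gamma (B v').gamma α) : v = v' := by
  obtain ⟨r₁, r₃, β, rfl⟩ := exists_eq_aut α
  obtain ⟨-, -, -, -, h₂⟩ := (aut_mul_unip_iff ..).1 (hi ⟨0, 1, 0⟩)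
  rw [aut_b, aut_c] at h₂
  simp only [mul_zero, mul_one, add_zero] at h₂
  field_simp at h₂
  apply mul_left_cancel₀ (det_ne_zero β)
  linear_combination -h₂

theorem intertwines_B (α : MulAut (Heis p)) : Intertwines (B v).gamma (B v).gamma α := by
  obtain ⟨r₁, r₃, β, rfl⟩ := exists_eq_aut α
  intro n
  refine (aut_mul_unip_iff ..).2 ⟨by ring, by ring, by ring, ?_, ?_⟩
  all_goals
    rw [aut_b, aut_c]
    field_simp
    ring

theorem not_intertwines_A_B {u₂ u₃ : ZMod p} (α : MulAut (Heis p)) :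
    ¬ Intertwines (A u₂ u₃).gamma (B v).gamma α := by
  intro hi
  obtain ⟨r₁, r₃, β, rfl⟩ := exists_eq_aut α
  obtain ⟨-, -, -, h₁, -⟩ := (aut_mul_unip_iff ..).1 (hi ⟨0, 1, 0⟩)
  rw [aut_b, aut_c] at h₁
  simp only [mul_zero, mul_one, add_zero, sub_zero] at h₁
  field_simp at h₁
  apply det_ne_zero β
  apply mul_right_cancel₀ h
  linear_combination h₁

end B

section C

variable {x₃ a x₃' a' r₁ r₃ : ZMod p} {β : GL (Fin 2) (ZMod p)}

theorem mat_eq_of_intertwines_C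
    (hi : Intertwines (C x₃ a).gamma (C x₃' a').gamma (aut r₁ r₃ β)) :
    β.1 0 1 = 0 ∧ β.1 1 1 = β.1 0 0 ^ 2 := by
  obtain ⟨h01, h11, -⟩ := (aut_mul_unip_iff ..).1 (hi ⟨0, 1, 0⟩)
  rw [aut_b] at h11
  simp only [mul_zero, mul_one, add_zero] at h01 h11
  exact ⟨h01, h11.trans (sq _).symm⟩

theorem eq_of_intertwines_C
    (hi : Intertwines (C x₃ a).gamma (C x₃' a').gamma (aut r₁ r₃ β)) : x₃ = x₃' ∧ a = a' := by
  obtain ⟨h01, h11⟩ := mat_eq_of_intertwines_C hi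
  obtain ⟨-, -, -, -, ha⟩ := (aut_mul_unip_iff ..).1 (hi ⟨0, 1, 0⟩)
  obtain ⟨-, -, -, hx, -⟩ := (aut_mul_unip_iff ..).1 (hi ⟨0, 0, 1⟩)
  rw [aut_b, h01, h11] at ha hx
  rw [aut_c, h11] at hx
  simp only [mul_zero, mul_one, zero_mul, add_zero, zero_add, sub_zero, ne_eq,
    OfNat.ofNat_ne_zero, not_false_eq_true, zero_pow] at ha hx
  have hcube : β.1 0 0 * β.1 0 0 ^ 2 ≠ 0 :=
    mul_ne_zero (apply_zero_zero_ne_zero h01) (pow_ne_zero 2 (apply_zero_zero_ne_zero h01))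
  refine ⟨inv_injective (mul_left_cancel₀ hcube ?_), mul_left_cancel₀ hcube ?_⟩
  · linear_combination hx
  · linear_combination ha

theorem intertwines_C_iff :
    Intertwines (C x₃ a).gamma (C x₃' a').gamma (aut r₁ r₃ β) ↔
      (x₃ = x₃' ∧ a = a') ∧ β.1 0 1 = 0 ∧ β.1 1 1 = β.1 0 0 ^ 2 ∧
      r₃ = (a + x₃⁻¹) * (β.1 0 0)⁻¹ * β.1 1 0 + (β.1 0 0 - 1) * (1 + a - x₃⁻¹) / 2 := by
  have h2 := two_ne_zero' (p := p)
  constructor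
  · intro hi
    obtain ⟨rfl, rfl⟩ := eq_of_intertwines_C hi
    obtain ⟨h01, h11⟩ := mat_eq_of_intertwines_C hi
    have h00 := apply_zero_zero_ne_zero h01
    obtain ⟨-, -, -, h₁, -⟩ := (aut_mul_unip_iff ..).1 (hi ⟨0, 1, 0⟩)
    rw [aut_b, aut_c, h01, h11] at h₁
    simp only [mul_zero, mul_one, zero_mul, add_zero, sub_zero, one_pow] at h₁
    refine ⟨⟨rfl, rfl⟩, h01, h11, ?_⟩
    generalize x₃⁻¹ = e at *
    field_simp at h₁ ⊢
    linear_combination h₁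
  · rintro ⟨⟨rfl, rfl⟩, h01, h11, hr⟩ n
    have h00 := apply_zero_zero_ne_zero h01
    refine (aut_mul_unip_iff ..).2 ⟨?_, ?_, ?_, ?_, ?_⟩
    · rw [h01, zero_mul]
    · rw [aut_b, h01, h11]
      ring
    · rw [h01, mul_zero]
    · rw [aut_b, aut_c, h01, h11, hr]
      generalize x₃⁻¹ = e
      generalize β.1 0 0 = x at *
      field_simp
      ring
    · rw [aut_b, h01, h11]
      ring

theorem not_intertwines_C {t : Param p} (ht : ∀ n, ∃ l₁ l₂, t.gamma n = unip l₁ l₂ 0)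
    (α : MulAut (Heis p)) : ¬ Intertwines (C x₃ a).gamma t.gamma α := by
  intro hi
  obtain ⟨r₁, r₃, β, rfl⟩ := exists_eq_aut α
  have h := hi ⟨0, 1, 0⟩
  obtain ⟨l₁, l₂, hl⟩ := ht (aut r₁ r₃ β ⟨0, 1, 0⟩)
  rw [hl] at h
  obtain ⟨h01, h11, -⟩ := (aut_mul_unip_iff ..).1 h
  simp only [mul_one, zero_mul] at h01 h11
  apply det_ne_zero β
  rw [h01, h11]
  ring

end C

theorem eq_of_intertwines {t t' : Param p} (ht : t.Valid) (ht' : t'.Valid) {α : MulAut (Heis p)}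
    (h : Intertwines t.gamma t'.gamma α) : t = t' := by
  cases t with
  | A u₂ u₃ =>
    cases t' with
    | A u₂' u₃' =>
      obtain ⟨r₁, r₃, β, rfl⟩ := exists_eq_aut α
      obtain ⟨rfl, rfl⟩ := eq_of_intertwines_A ht' ht h
      rfl
    | B v => exact absurd h (not_intertwines_A_B ht' _)
    | C x₃ a => exact absurd h.symm (not_intertwines_C (fun n => ⟨_, _, rfl⟩) _)
  | B v =>
    cases t' with
    | A u₂' u₃' => exact absurd h.symm (not_intertwines_A_B ht _)
    | B v' => rw [eq_of_intertwines_B ht ht' h]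
    | C x₃ a => exact absurd h.symm (not_intertwines_C (fun n => ⟨_, _, rfl⟩) _)
  | C x₃ a =>
    cases t' with
    | A u₂' u₃' => exact absurd h (not_intertwines_C (fun n => ⟨_, _, rfl⟩) _)
    | B v' => exact absurd h (not_intertwines_C (fun n => ⟨_, _, rfl⟩) _)
    | C x₃' a' =>
      obtain ⟨r₁, r₃, β, rfl⟩ := exists_eq_aut α
      obtain ⟨rfl, rfl⟩ := eq_of_intertwines_C h
      rfl

end Heis.Param

/-! ### Completeness of the list -/

namespace Heis

variable {p : ℕ}

theorem mul_rho (n : Heis p) : n * rho p = rho p * n := by ext <;> simp [add_comm]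

variable [Fact p.Prime]

theorem rho_mem_of_ofX_mem {S : Subgroup (Heis p)} {x : ZMod p} (hx : x ≠ 0)
    (h : ofX x 0 0 ∈ S) : rho p ∈ S := by
  have hpow (y : ZMod p) : rho p ^ y.val = ofX y 0 0 := by
    rw [rho_pow, ZMod.natCast_zmod_val]
    exact Heis.ext (by simp [ofX]) rfl rfl
  have hrho : rho p = ofX x 0 0 ^ (x⁻¹).val := by
    rw [← hpow, ← pow_mul, rho_pow]
    ext <;> simp [hx]
  rw [hrho]
  exact pow_mem h _

variable [Fact (3 < p)]

theorem rho_mem_of_conj_mem {S : Subgroup (Heis p)} {d : Heis p} (hd : d ≠ 1)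
    (h : ∀ a, a * d * a⁻¹ ∈ S) : rho p ∈ S := by
  have hdS : d ∈ S := by simpa using h 1
  have hcomm (a : Heis p) : ofX (a.c * d.b - a.b * d.c) 0 0 ∈ S := by
    rw [← commutator_eq_ofX]
    exact mul_mem (h a) (inv_mem hdS)
  by_cases hb : d.b = 0
  · by_cases hc : d.c = 0
    · have hdX : d = ofX (X d) 0 0 := ext_X (X_ofX _ _ _).symm hb hc
      refine rho_mem_of_ofX_mem (x := X d) (fun hX => hd ?_) (hdX ▸ hdS)
      rw [hdX, hX, ofX_zero]
    · exact rho_mem_of_ofX_mem (neg_ne_zero.2 hc) (by simpa [hb] using hcomm (sigma p))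
  · exact rho_mem_of_ofX_mem hb (by simpa using hcomm (tau p))

/-- The automorphism induced on the quotient by the centre, as a matrix. -/
def linPart : MulAut (Heis p) →* Matrix (Fin 2) (Fin 2) (ZMod p) where
  toFun α := !![(α (sigma p)).b, (α (tau p)).b; (α (sigma p)).c, (α (tau p)).c]
  map_one' := by simp [Matrix.one_fin_two]
  map_mul' α β := by
    obtain ⟨r₁, r₃, β₁, rfl⟩ := exists_eq_aut α
    simp [aut_b, aut_c]

theorem linPart_apply (α : MulAut (Heis p)) :
    linPart α = !![(α (sigma p)).b, (α (tau p)).b; (α (sigma p)).c, (α (tau p)).c] := rfl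

theorem linPart_aut (r₁ r₃ : ZMod p) (β : GL (Fin 2) (ZMod p)) : linPart (aut r₁ r₃ β) = β.1 := by
  rw [linPart_apply, Matrix.eta_fin_two β.1]
  simp only [aut_b, aut_c, sigma_b, sigma_c, tau_b, tau_c, mul_one, mul_zero, add_zero, zero_add]

theorem apply_b (α : MulAut (Heis p)) (n : Heis p) :
    (α n).b = linPart α 0 0 * n.b + linPart α 0 1 * n.c := by
  obtain ⟨r₁, r₃, β, rfl⟩ := exists_eq_aut α
  rw [linPart_aut, aut_b]

theorem apply_c (α : MulAut (Heis p)) (n : Heis p) :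
    (α n).c = linPart α 1 0 * n.b + linPart α 1 1 * n.c := by
  obtain ⟨r₁, r₃, β, rfl⟩ := exists_eq_aut α
  rw [linPart_aut, aut_c]

theorem apply_rho (α : MulAut (Heis p)) :
    α (rho p) = ofX (linPart α 0 0 * linPart α 1 1 - linPart α 0 1 * linPart α 1 0) 0 0 :=
  map_rho α

theorem linPart_of_pow_eq_one {α : MulAut (Heis p)} {k : ℕ} (h : α ^ p ^ k = 1) :
    linPart α 0 0 + linPart α 1 1 = 2 ∧
      (linPart α 0 0 - 1) * (linPart α 1 1 - 1) = linPart α 0 1 * linPart α 1 0 :=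
  trace_and_det_sub_one_of_pow_eq_one (p := p) (k := k) (by rw [← map_pow, h, map_one])

theorem eq_unip_of_linPart {α : MulAut (Heis p)} (h00 : linPart α 0 0 = 1)
    (h01 : linPart α 0 1 = 0) (h11 : linPart α 1 1 = 1) :
    α = unip (X (α (sigma p))) (X (α (tau p))) (linPart α 1 0) := by
  refine mulAut_ext_sigma_tau (ext_X (by simp) ?_ ?_) (ext_X (by simp) ?_ ?_) <;>
    simp [apply_b α, apply_c α, h00, h01, h11]

theorem eq_unip_of_pow_eq_one {α : MulAut (Heis p)} {k : ℕ} (h : α ^ p ^ k = 1)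
    (h01 : linPart α 0 1 = 0) : ∃ l₁ l₂ m, α = unip l₁ l₂ m := by
  obtain ⟨htr, hdet⟩ := linPart_of_pow_eq_one h
  have h00 : linPart α 0 0 = 1 := eq_one_of_add_eq_two htr (by rw [hdet, h01, zero_mul])
  exact ⟨_, _, _, eq_unip_of_linPart h00 h01 (by linear_combination htr - h00)⟩

section Theta

variable {γ : Heis p → MulAut (Heis p)} (h : Hol.IsGamma γ)
  (hcard : Nat.card (Set.range γ) = p ^ 2)

include h hcard

theorem gamma_apply_rho (n : Heis p) : γ n (rho p) = rho p := by
  obtain ⟨htr, hdet⟩ := linPart_of_pow_eq_one (h.pow_eq_one_of_card_eq hcard n)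
  rw [apply_rho, ← ofX_one]
  congr 1
  linear_combination hdet + htr

theorem rho_mem_ker : rho p ∈ h.ker := by
  set g := γ (rho p)
  have hga (a : Heis p) : γ (g a) = γ a := by
    have hmul := h (g a) (rho p)
    rw [gamma_apply_rho h hcard, mul_rho, h (rho p) a,
      (h.commute_of_card_eq_sq hcard (rho p) a).eq] at hmul
    exact mul_right_cancel hmul.symm
  have hker (a : Heis p) : g a * a⁻¹ ∈ h.ker := h.map_mul_inv_eq_one (hga a)
  by_cases hg1 : g = 1
  · exact hg1
  obtain ⟨b, hb⟩ : ∃ b, g b * b⁻¹ ≠ 1 := by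
    by_contra! hall
    exact hg1 (MulEquiv.ext fun b => mul_inv_eq_one.1 (hall b))
  refine rho_mem_of_conj_mem hb fun a => ?_
  have hconj : a * (g b * b⁻¹) * a⁻¹ = (g a * a⁻¹)⁻¹ * (g (a * b) * (a * b)⁻¹) := by
    rw [map_mul]
    group
  rw [hconj]
  exact mul_mem (inv_mem (hker a)) (hker _)

theorem gamma_eq_gamma_ofX (n : Heis p) : γ n = γ (ofX 0 n.b n.c) := by
  have hn : n = rho p ^ (X n).val * ofX 0 n.b n.c := by
    rw [rho_pow]
    refine ext_X ?_ (by simp) (by simp)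
    rw [X_mul]
    simp [X, ofX]
  conv_lhs => rw [hn]
  exact h.map_mul_of_mem_ker (pow_mem (rho_mem_ker h hcard) _) _

theorem injective_gamma_ofX :
    Function.Injective fun v : ZMod p × ZMod p => γ (ofX 0 v.1 v.2) := by
  have hrange : Set.range γ = Set.range fun v : ZMod p × ZMod p => γ (ofX 0 v.1 v.2) := by
    ext α
    constructor
    · rintro ⟨n, rfl⟩
      exact ⟨(n.b, n.c), (gamma_eq_gamma_ofX h hcard n).symm⟩
    · rintro ⟨v, rfl⟩
      exact ⟨_, rfl⟩
  rw [hrange] at hcard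
  refine Set.rangeFactorization_injective.1 ((Nat.bijective_iff_surjective_and_card _).2
    ⟨Set.rangeFactorization_surjective, ?_⟩).1
  rw [hcard, Nat.card_prod, Nat.card_zmod, sq]

theorem exists_conj_eq_unip :
    ∃ α : MulAut (Heis p), ∀ n, ∃ l₁ l₂ k, α * γ n * α⁻¹ = unip l₁ l₂ k := by
  by_cases hM : ∀ n, linPart (γ n) = 1
  · refine ⟨1, fun n => ?_⟩
    rw [one_mul, inv_one, mul_one]
    exact eq_unip_of_pow_eq_one (h.pow_eq_one_of_card_eq hcard n) (by simp [hM])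
  push Not at hM
  obtain ⟨n₀, hn₀⟩ := hM
  obtain ⟨htr, hdet⟩ := linPart_of_pow_eq_one (h.pow_eq_one_of_card_eq hcard n₀)
  obtain ⟨P, hP⟩ := exists_mul_eq_mul_lowerUnipotent htr hdet hn₀
  let δ : MulAut (Heis p) := aut 0 0 P
  have hlin : linPart (δ⁻¹ * γ n₀ * δ⁻¹⁻¹) = !![1, 0; 1, 1] := by
    rw [inv_inv, map_mul, map_mul, linPart_aut, mul_assoc, hP, ← mul_assoc, ← linPart_aut 0 0 P,
      ← map_mul, inv_mul_cancel, map_one, one_mul]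
  refine ⟨δ⁻¹, fun n => eq_unip_of_pow_eq_one (k := 2) ?_ ?_⟩
  · rw [conj_pow, h.pow_eq_one_of_card_eq hcard, mul_one, mul_inv_cancel]
  · apply apply_zero_one_eq_zero_of_commute
    rw [← hlin]
    exact ((h.commute_of_card_eq_sq hcard n n₀).conj δ⁻¹).map linPart

end Theta

section Linear

variable {γ : Heis p → MulAut (Heis p)} {p₁₁ p₁₂ p₂₁ p₂₂ : ZMod p}
  (hγ : ∀ n, γ n = unip (p₁₁ * n.b + p₁₂ * n.c) (p₂₁ * n.b + p₂₂ * n.c) 0)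
  (hdet : p₁₁ * p₂₂ - p₁₂ * p₂₁ ≠ 0)

include hγ hdet

theorem exists_intertwines_A {x y : ZMod p}
    (hxy : p₂₂ * x ^ 2 - (p₁₂ + p₂₁) * x * y + p₁₁ * y ^ 2 ≠ 0) :
    ∃ t : Param p, t.Valid ∧ ∃ α, Hol.Intertwines γ t.gamma α := by
  set d := p₁₁ * p₂₂ - p₁₂ * p₂₁ with hd
  have hP : d * x * (p₂₂ * x - p₁₂ * y) - d * y * (p₂₁ * x - p₁₁ * y) ≠ 0 := by
    rw [show d * x * (p₂₂ * x - p₁₂ * y) - d * y * (p₂₁ * x - p₁₁ * y) =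
      d * (p₂₂ * x ^ 2 - (p₁₂ + p₂₁) * x * y + p₁₁ * y ^ 2) by ring]
    exact mul_ne_zero hdet hxy
  have hdiv : (p₂₁ - p₁₂) / d / d⁻¹ = p₂₁ - p₁₂ := by field_simp
  refine ⟨.A ((p₂₁ - p₁₂) / d) d⁻¹, inv_ne_zero hdet, aut 0 0 (mat _ _ _ _ hP), fun n => ?_⟩
  rw [hγ]
  refine (aut_mul_unip_iff ..).2 ⟨by ring, by ring, by ring, ?_, ?_⟩ <;>
  · simp only [aut_b, aut_c, coe_mat, Matrix.of_apply, Matrix.cons_val', Matrix.cons_val_zero,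
      Matrix.cons_val_one, Matrix.cons_val_fin_one]
    rw [hdiv, div_inv_eq_mul, hd]
    ring

theorem exists_intertwines_B
    (hq : ∀ x y, p₂₂ * x ^ 2 - (p₁₂ + p₂₁) * x * y + p₁₁ * y ^ 2 = 0) :
    ∃ t : Param p, t.Valid ∧ ∃ α, Hol.Intertwines γ t.gamma α := by
  have h₂₂ : p₂₂ = 0 := by simpa using hq 1 0
  have h₁₁ : p₁₁ = 0 := by simpa using hq 0 1
  have h₁₂ : p₁₂ = -p₂₁ := by linear_combination h₂₂ + h₁₁ - hq 1 1
  have h₂₁ : p₂₁ ≠ 0 := by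
    rintro rfl
    exact hdet (by rw [h₂₂]; ring)
  refine ⟨.B p₂₁⁻¹, inv_ne_zero h₂₁, 1, fun n => ?_⟩
  rw [hγ, one_mul, mul_one, h₁₁, h₂₂, h₁₂, MulAut.one_apply, Param.gamma, div_inv_eq_mul,
    div_inv_eq_mul]
  congr 1 <;> ring

theorem exists_intertwines_of_linear :
    ∃ t : Param p, t.Valid ∧ ∃ α, Hol.Intertwines γ t.gamma α := by
  by_cases hq : ∀ x y, p₂₂ * x ^ 2 - (p₁₂ + p₂₁) * x * y + p₁₁ * y ^ 2 = 0
  · exact exists_intertwines_B hγ hdet hq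
  · push Not at hq
    obtain ⟨x, y, hxy⟩ := hq
    exact exists_intertwines_A hγ hdet hxy

end Linear

theorem exists_intertwines_of_quadratic {γ : Heis p → MulAut (Heis p)} {κ a d e : ZMod p}
    (hγ : ∀ n, γ n = unip ((a - e) * κ / 2 * n.b ^ 2 + d * n.b + e * n.c) (a * n.b) (κ * n.b))
    (hκ : κ ≠ 0) (he : e ≠ 0) :
    ∃ t : Param p, t.Valid ∧ ∃ α, Hol.Intertwines γ t.gamma α := by
  have h2 := two_ne_zero' (p := p)
  refine ⟨.C e⁻¹ a, inv_ne_zero he, aut 0 ((e - a - 1) / 2 - d / κ)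
    (mat 1 0 0 κ⁻¹ (by simpa using hκ)), fun n => ?_⟩
  rw [hγ]
  refine (aut_mul_unip_iff ..).2 ?_
  simp only [aut_b, aut_c, coe_mat, Matrix.of_apply, Matrix.cons_val', Matrix.cons_val_zero,
    Matrix.cons_val_one, Matrix.cons_val_fin_one, inv_inv]
  refine ⟨by ring, by field_simp; ring, by ring, ?_, ?_⟩ <;>
  · field_simp
    ring

section Coordinates

variable {γ : Heis p → MulAut (Heis p)} {l₁ l₂ k : ZMod p → ZMod p → ZMod p}
  (h : Hol.IsGamma γ) (hγ : ∀ n, γ n = unip (l₁ n.b n.c) (l₂ n.b n.c) (k n.b n.c))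

include h hγ

theorem coord_add (b c b' c' : ZMod p) :
    l₁ (b + b') (c + (c' + k b c * b')) = l₁ b c + l₁ b' c' + l₂ b c * k b' c' ∧
      l₂ (b + b') (c + (c' + k b c * b')) = l₂ b c + l₂ b' c' ∧
      k (b + b') (c + (c' + k b c * b')) = k b c + k b' c' := by
  have hmul := h (ofX 0 b c) (ofX 0 b' c')
  rw [hγ (_ * _), hγ (ofX 0 b c), hγ (ofX 0 b' c'), unip_mul] at hmul
  simpa using unip_inj.1 hmul

variable (hcard : Nat.card (Set.range γ) = p ^ 2)

include hcard

theorem coord_comm (b c b' c' : ZMod p) : l₂ b c * k b' c' = l₂ b' c' * k b c := by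
  have hcomm := (h.commute_of_card_eq_sq hcard (ofX 0 b c) (ofX 0 b' c')).eq
  rw [hγ (ofX 0 b c), hγ (ofX 0 b' c'), unip_mul, unip_mul] at hcomm
  have hfst := (unip_inj.1 hcomm).1
  simp only [ofX_b, ofX_c] at hfst
  linear_combination hfst

theorem coord_inj {b c b' c' : ZMod p} (h₁ : l₁ b c = l₁ b' c') (h₂ : l₂ b c = l₂ b' c')
    (hk : k b c = k b' c') : b = b' ∧ c = c' :=
  Prod.mk.inj (injective_gamma_ofX h hcard (a₁ := (b, c)) (a₂ := (b', c')) (by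
    simp only [hγ, ofX_b, ofX_c, h₁, h₂, hk]))

theorem exists_intertwines_of_linPart_eq_zero (hk : ∀ b c, k b c = 0) :
    ∃ t : Param p, t.Valid ∧ ∃ α, Hol.Intertwines γ t.gamma α := by
  have hl₁ := zmod_map₂_eq (f := l₁) fun b c b' c' => by
    simpa [hk] using (coord_add h hγ b c b' c').1
  have hl₂ := zmod_map₂_eq (f := l₂) fun b c b' c' => by
    simpa [hk] using (coord_add h hγ b c b' c').2.1
  refine exists_intertwines_of_linear (p₁₁ := l₁ 1 0) (p₁₂ := l₁ 0 1) (p₂₁ := l₂ 1 0)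
    (p₂₂ := l₂ 0 1) (fun n => ?_) (det_ne_zero_of_forall fun b c h₁ h₂ => ?_)
  · rw [hγ, hk, hl₁, hl₂]
    congr 1 <;> ring
  · apply coord_inj h hγ hcard
    · rw [hl₁, h₁, hl₁ 0 0, zero_mul, zero_mul, add_zero]
    · rw [hl₂, h₂, hl₂ 0 0, zero_mul, zero_mul, add_zero]
    · rw [hk, hk]

theorem exists_intertwines_of_linPart_ne_zero (hk : ¬ ∀ b c, k b c = 0) :
    ∃ t : Param p, t.Valid ∧ ∃ α, Hol.Intertwines γ t.gamma α := by
  have hkb := eq_apply_one_zero_mul fun b c b' c' => (coord_add h hγ b c b' c').2.2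
  have hκ : k 1 0 ≠ 0 := fun h0 => hk fun b c => by rw [hkb, h0, zero_mul]
  have hl₂ (b c) : l₂ b c = l₂ 1 0 * b := by
    have hcomm := coord_comm h hγ hcard b c 1 0
    rw [hkb b c] at hcomm
    exact mul_right_cancel₀ hκ (by linear_combination hcomm)
  have hl₁ := eq_quadratic_of_map_add two_ne_zero' (l := l₁) (a := l₂ 1 0) (κ := k 1 0)
    fun b c b' c' => by rw [← hkb b c, ← hl₂ b c, ← hkb b' c', (coord_add h hγ b c b' c').1]
  refine exists_intertwines_of_quadratic (κ := k 1 0) (a := l₂ 1 0) (e := l₁ 0 1)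
    (d := l₁ 1 0 - (l₂ 1 0 - l₁ 0 1) * k 1 0 / 2) (fun n => ?_) hκ fun he => ?_
  · rw [hγ, hkb, hl₂, hl₁]
  · refine zero_ne_one (coord_inj h hγ hcard (b := 0) (c := 0) (b' := 0) (c' := 1) ?_ ?_ ?_).2
    · rw [hl₁ 0 0, he]
      ring
    · rw [hl₂, hl₂ 0 1]
    · rw [hkb, hkb 0 1]

end Coordinates

theorem exists_intertwines {γ : Heis p → MulAut (Heis p)} (h : Hol.IsGamma γ)
    (hcard : Nat.card (Set.range γ) = p ^ 2) :
    ∃ t : Param p, t.Valid ∧ ∃ α, Hol.Intertwines γ t.gamma α := by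
  obtain ⟨α, hα⟩ := exists_conj_eq_unip h hcard
  set δ := fun n => α * γ (α⁻¹ n) * α⁻¹
  have hi : Hol.Intertwines γ δ α := fun n => by simp [δ]
  have hδ : Hol.IsGamma δ := h.conj α
  have hrange : Set.range δ = MulAut.conj α '' Set.range γ := by
    rw [← Set.range_comp, ← (α⁻¹).surjective.range_comp (_ ∘ γ)]
    rfl
  have hδcard : Nat.card (Set.range δ) = p ^ 2 := by
    rw [hrange, Nat.card_image_of_injective (MulAut.conj α).injective, hcard]
  choose l₁ l₂ k hl using fun b c : ZMod p => hα (α⁻¹ (ofX 0 b c))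
  have hcoord (n : Heis p) : δ n = unip (l₁ n.b n.c) (l₂ n.b n.c) (k n.b n.c) := by
    rw [gamma_eq_gamma_ofX hδ hδcard n]
    exact hl _ _
  suffices ∃ t : Param p, t.Valid ∧ ∃ β, Hol.Intertwines δ t.gamma β by
    obtain ⟨t, ht, β, hβ⟩ := this
    exact ⟨t, ht, _, hi.trans hβ⟩
  by_cases hk : ∀ b c, k b c = 0
  · exact exists_intertwines_of_linPart_eq_zero hδ hcoord hδcard hk
  · exact exists_intertwines_of_linPart_ne_zero hδ hcoord hδcard hk

end Heis

namespace Heis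

theorem not_nonempty_mulEquiv_elemAb3 {p : ℕ} [Fact p.Prime] :
    ¬Nonempty (Heis p ≃* ElemAb3 p) := by
  rintro ⟨e⟩
  have h : tau p * sigma p = sigma p * tau p := e.injective (by rw [map_mul, map_mul, mul_comm])
  have ha := congrArg Heis.a h
  simp [tau, sigma] at ha

namespace Param

open SkewBrace

variable {p : ℕ} [Fact p.Prime] [Fact (3 < p)]

theorem eq_of_iso {t t' : Param p} (ht : t.Valid) (ht' : t'.Valid)
    (h : Hol.IsRegular t.subgroup) (h' : Hol.IsRegular t'.subgroup)
    (hi : Nonempty (Hol.Brace t.subgroup h ≃+* Hol.Brace t'.subgroup h')) : t = t' := by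
  obtain ⟨α, hα⟩ := (Hol.Brace.nonempty_iso_iff h h').1 hi
  rw [ht.gamma_eq, ht'.gamma_eq] at hα
  exact eq_of_intertwines ht ht' hα

theorem exists_iso_brace {B : Type*} [SkewBrace B] (hB : Nonempty (B ≃+ Additive (Heis p)))
    (hcard : thetaCard B = p ^ 2) :
    ∃ t : Param p, ∃ ht : t.Valid, Nonempty (B ≃+* Hol.Brace t.subgroup ht.isRegular) := by
  obtain ⟨f⟩ := hB
  obtain ⟨γ, h, ⟨e⟩⟩ := Hol.exists_isGamma_of_addEquiv f
  rw [thetaCard_congr e, Hol.Brace.thetaCard_eq_card_range, h.gamma_eq] at hcard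
  obtain ⟨t, ht, α, hα⟩ := exists_intertwines h hcard
  obtain ⟨e'⟩ := (Hol.Brace.nonempty_iso_iff h.isRegular ht.isRegular).2
    ⟨α, by rwa [h.gamma_eq, ht.gamma_eq]⟩
  exact ⟨t, ht, ⟨e.trans e'⟩⟩

/-- The subgroup with parameters `t` defines a skew brace with `|Θ| = p²` whose multiplicative group
is isomorphic to `G`. -/
def HasMulType (t : Param p) (G : Type*) [Group G] : Prop :=
  ∃ ht : t.Valid, Nonempty (Hol.Brace t.subgroup ht.isRegular ≃* G)

section HasMulType

variable {t : Param p} {G : Type*} [Group G]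

theorem hasMulType_congr {G' : Type*} [Group G'] (e : G ≃* G') :
    t.HasMulType G ↔ t.HasMulType G' :=
  exists_congr fun _ => ⟨Nonempty.map fun f => f.trans e, Nonempty.map fun f => f.trans e.symm⟩

theorem hasMulType_heis_iff : t.HasMulType (Heis p) ↔ t.IsHeis := by
  constructor
  · rintro ⟨ht, ⟨f⟩⟩
    refine ht.isHeis_or_isElem.resolve_right fun hE =>
      not_nonempty_mulEquiv_elemAb3 (p := p) ?_
    exact (hE.isBraceOf ht.isRegular).1.map f.symm.trans
  · exact fun ht => ⟨ht.valid, (ht.isBraceOf ht.valid.isRegular).1⟩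

theorem hasMulType_elemAb3_iff : t.HasMulType (ElemAb3 p) ↔ t.IsElem := by
  constructor
  · rintro ⟨ht, ⟨f⟩⟩
    refine ht.isHeis_or_isElem.resolve_left fun hH =>
      not_nonempty_mulEquiv_elemAb3 (p := p) ?_
    exact (hH.isBraceOf ht.isRegular).1.map fun g => g.symm.trans f
  · exact fun ht => ⟨ht.valid, (ht.isBraceOf ht.valid.isRegular).1⟩

theorem HasMulType.isBraceOf (ht : t.HasMulType G) :
    IsBraceOf G (Heis p) (p ^ 2) (Hol.Brace t.subgroup ht.1.isRegular) :=
  ⟨ht.2, ⟨Hol.Brace.addEquiv _⟩, ht.1.thetaCard_eq _⟩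

theorem HasMulType.exists_isRegular (ht : t.HasMulType G) :
    ∃ h : Hol.IsRegular t.subgroup, Nat.card (t.subgroup.map (Hol.Theta (Heis p))) = p ^ 2 ∧
      Nonempty (t.subgroup ≃* G) ∧ IsBraceOf G (Heis p) (p ^ 2) (Hol.Brace t.subgroup h) := by
  refine ⟨ht.1.isRegular, ?_, ht.2.map (Hol.Brace.mulEquiv _).trans, ht.isBraceOf⟩
  rw [Hol.Brace.card_map_Theta ht.1.isRegular, ht.1.gamma_eq, ht.1.card_range_gamma]

theorem existsUnique_hasMulType {B : Type*} [SkewBrace B] (hB : IsBraceOf G (Heis p) (p ^ 2) B) :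
    ∃! t : Param p, t.HasMulType G ∧
      ∃ h : Hol.IsRegular t.subgroup, Nonempty (B ≃+* Hol.Brace t.subgroup h) := by
  obtain ⟨t, ht, ⟨e⟩⟩ := exists_iso_brace hB.2.1 hB.2.2
  refine ⟨t, ⟨⟨ht, hB.1.map (e : B ≃* _).symm.trans⟩, _, ⟨e⟩⟩, ?_⟩
  rintro t' ⟨ht', h', ⟨e'⟩⟩
  exact eq_of_iso ht'.1 ht _ _ ⟨e'.symm.trans e⟩

end HasMulType

theorem numClasses_eq (G : Type*) [Group G] :
    numClasses.{u} G (Heis p) (p ^ 2) = Nat.card {t : Param p // t.HasMulType G} := by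
  let F : {t : Param p // t.HasMulType G} → Bundled.{u} := fun t =>
    ⟨ULift.{u} (Hol.Brace t.1.subgroup t.2.1.isRegular)⟩
  have hF (t) : IsBraceOf G (Heis p) (p ^ 2) (F t).carrier :=
    t.2.isBraceOf.congr (uliftEquiv _).symm
  symm
  refine Nat.card_eq_of_bijective (fun t => ⟨Quotient.mk isoSetoid (F t), F t, rfl, hF t⟩)
    ⟨fun t t' h => ?_, ?_⟩
  · obtain ⟨e⟩ := Quotient.exact (congrArg Subtype.val h)
    exact Subtype.ext (eq_of_iso t.2.1 t'.2.1 _ _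
      ⟨(uliftEquiv _).symm.trans (e.trans (uliftEquiv _))⟩)
  · rintro ⟨_, B, rfl, hB⟩
    obtain ⟨t, ⟨ht, h, ⟨e⟩⟩, -⟩ := existsUnique_hasMulType hB
    exact ⟨⟨t, ht⟩, Subtype.ext (Quotient.sound ⟨(uliftEquiv _).trans e.symm⟩)⟩

end Param

end Heis

/-! ### Counting -/

namespace Heis.Param

variable {p : ℕ}

/-- The parameters as a sum type, for the finiteness of `Param p` and for sums over it. -/
def equivSum : Param p ≃ (ZMod p × ZMod p) ⊕ ZMod p ⊕ (ZMod p × ZMod p) where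
  toFun
    | .A u₂ u₃ => .inl (u₂, u₃)
    | .B v₂ => .inr (.inl v₂)
    | .C x₃ a => .inr (.inr (x₃, a))
  invFun
    | .inl t => .A t.1 t.2
    | .inr (.inl v) => .B v
    | .inr (.inr t) => .C t.1 t.2
  left_inv t := by cases t <;> rfl
  right_inv t := by rcases t with _ | _ | _ <;> rfl

variable [Fact p.Prime]

noncomputable instance : Fintype (Param p) := Fintype.ofEquiv _ equivSum.symm

theorem sum_eq {M : Type*} [AddCommMonoid M] (f : Param p → M) :
    ∑ t, f t = ∑ u₃, ∑ u₂, f (.A u₂ u₃) + (∑ v, f (.B v) + ∑ x₃, ∑ a, f (.C x₃ a)) := by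
  rw [← equivSum.symm.sum_comp, Fintype.sum_sum_type, Fintype.sum_sum_type, Fintype.sum_prod_type,
    Fintype.sum_prod_type, Finset.sum_comm]
  rfl

open Classical in
theorem sum_valid {M : Type*} [AddCommMonoid M] (f : Param p → M) :
    ∑ t with t.Valid, f t = ∑ u₃ with u₃ ≠ 0, ∑ u₂, f (.A u₂ u₃) +
      (∑ v with v ≠ 0, f (.B v) + ∑ x₃ with x₃ ≠ 0, ∑ a, f (.C x₃ a)) := by
  have hA (u₂ u₃ : ZMod p) : (A u₂ u₃).Valid ↔ u₃ ≠ 0 := ⟨id, id⟩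
  have hB (v₂ : ZMod p) : (B v₂).Valid ↔ v₂ ≠ 0 := ⟨id, id⟩
  have hC (x₃ a : ZMod p) : (C x₃ a).Valid ↔ x₃ ≠ 0 := ⟨id, id⟩
  simp only [Finset.sum_filter, sum_eq (fun _ => ite _ _ _), hA, hB, hC, Finset.sum_ite_irrel,
    Finset.sum_const_zero]

open Classical in
theorem sum_isElem {M : Type*} [AddCommMonoid M] (f : Param p → M) :
    ∑ t with t.IsElem, f t = ∑ u with u ≠ 0, f (.A u u) +
      (f (.B 2) + ∑ x₃ with x₃ ≠ 0, f (.C x₃ ((1 + x₃) / x₃))) := by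
  have hA (u₂ u₃ : ZMod p) : (A u₂ u₃).IsElem ↔ u₃ ≠ 0 ∧ u₂ = u₃ := ⟨id, id⟩
  have hB (v₂ : ZMod p) : (B v₂).IsElem ↔ v₂ = 2 := ⟨id, id⟩
  have hC (x₃ a : ZMod p) : (C x₃ a).IsElem ↔ x₃ ≠ 0 ∧ a = (1 + x₃) / x₃ :=
    and_congr_right fun hx => (eq_div_iff hx).symm
  simp only [Finset.sum_filter, sum_eq (fun _ => ite _ _ _), hA, hB, hC, ite_and,
    Finset.sum_ite_irrel, Finset.sum_const_zero, Finset.sum_ite_eq', Finset.mem_univ, if_true]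

open Classical in
theorem natCard_eq_sum (P : Param p → Prop) :
    (Nat.card {t // P t} : ℤ) = ∑ t with P t, 1 := by
  rw [Nat.card_eq_fintype_card, Fintype.card_subtype, Finset.card_eq_sum_ones, Nat.cast_sum,
    Nat.cast_one]

variable (p) in
theorem card_isElem : (Nat.card {t : Param p // t.IsElem} : ℤ) = 2 * p - 1 := by
  classical
  rw [natCard_eq_sum, sum_isElem]
  simp only [Finset.sum_const, nsmul_eq_mul, intCast_card_filter_ne, ZMod.card]
  ring

section Weight

/-- The index of the automorphism group of the skew brace in `Aut(M₁)`. -/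
noncomputable def weight : Param p → ℤ
  | .A u₂ u₃ => p ^ 2 + p * quadraticChar (ZMod p) (u₂ ^ 2 - 4 * u₃) -
      if u₂ ^ 2 - 4 * u₃ = 0 then 1 else 0
  | .B _ => 1
  | .C _ _ => (p ^ 2 - 1) * p

variable [Fact (3 < p)]

theorem ringChar_zmod_ne_two : ringChar (ZMod p) ≠ 2 := by
  have hp : 3 < p := Fact.out
  rw [ZMod.ringChar_zmod_n]
  omega

theorem four_ne_zero' : (4 : ZMod p) ≠ 0 := by
  rw [show (4 : ZMod p) = 2 * 2 by norm_num]
  exact mul_ne_zero two_ne_zero' two_ne_zero'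

variable (p) in
theorem sum_weight_A : ∑ u₃ with u₃ ≠ 0, ∑ u₂, weight (.A u₂ u₃ : Param p) =
    (p - 1) * (p ^ 3 - p - 1) := by
  have h4 : (4 : ZMod p) ≠ 0 := four_ne_zero'
  have hdisc (u₂ u₃ : ZMod p) : u₂ ^ 2 - 4 * u₃ = 0 ↔ u₃ = u₂ ^ 2 / 4 := by
    rw [sub_eq_zero, eq_div_iff h4, mul_comm u₃, eq_comm]
  have hall : ∑ u₃, ∑ u₂, weight (.A u₂ u₃ : Param p) = p ^ 4 - p := by
    rw [Finset.sum_comm]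
    simp only [weight, hdisc, Finset.sum_sub_distrib, Finset.sum_add_distrib, ← Finset.mul_sum,
      sum_quadraticChar_sub_mul ringChar_zmod_ne_two h4, Finset.sum_const, Finset.card_univ,
      ZMod.card, nsmul_eq_mul, Finset.sum_ite_eq', Finset.mem_univ, if_true]
    ring
  have hzero : ∑ u₂, weight (.A u₂ 0 : Param p) = p ^ 3 + p * (p - 1) - 1 := by
    simp only [weight, mul_zero, sub_zero, Finset.sum_sub_distrib, Finset.sum_add_distrib,
      ← Finset.mul_sum, sum_quadraticChar_sq, Finset.sum_const, Finset.card_univ,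
      ZMod.card, nsmul_eq_mul, sq_eq_zero_iff, Finset.sum_ite_eq', Finset.mem_univ, if_true]
    ring
  rw [← Finset.add_sum_erase _ _ (Finset.mem_univ 0), hzero] at hall
  rw [Finset.filter_ne']
  linear_combination hall

variable (p) in
theorem sum_quadraticChar_diag :
    ∑ u with u ≠ 0, quadraticChar (ZMod p) (u ^ 2 - 4 * u) = -1 := by
  have hall := sum_quadraticChar_sub_mul (ringChar_zmod_ne_two (p := p)) four_ne_zero' 1
  rw [← Finset.add_sum_erase _ _ (Finset.mem_univ 0), mul_zero, sub_zero, map_one] at hall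
  rw [← eq_neg_of_add_eq_zero_right hall, ← Finset.filter_ne']
  refine Finset.sum_nbij' (·⁻¹) (·⁻¹) (by simp) (by simp) (by simp) (by simp) fun u hu => ?_
  have hu : u ≠ 0 := (Finset.mem_filter.1 hu).2
  have hsq : u ^ 2 - 4 * u = u ^ 2 * (1 - 4 * u⁻¹) := by field_simp
  rw [hsq, map_mul, quadraticChar_sq_one' hu, one_mul]

variable (p) in
theorem sum_weight_A_diag : ∑ u with u ≠ 0, weight (.A u u : Param p) = p ^ 3 - p ^ 2 - p - 1 := by
  have h4 : (4 : ZMod p) ≠ 0 := four_ne_zero'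
  have hdisc {u : ZMod p} (hu : u ≠ 0) : u ^ 2 - 4 * u = 0 ↔ u = 4 := by
    rw [sq, ← sub_mul, mul_eq_zero, or_iff_left hu, sub_eq_zero]
  have hone : ∑ u : ZMod p with u ≠ 0, (if u ^ 2 - 4 * u = 0 then 1 else 0 : ℤ) = 1 := by
    rw [Finset.sum_congr rfl fun u hu => if_congr (hdisc (Finset.mem_filter.1 hu).2) rfl rfl,
      Finset.sum_ite_eq']
    exact if_pos (by rwa [Finset.mem_filter_univ])
  simp only [weight, Finset.sum_sub_distrib, Finset.sum_add_distrib, ← Finset.mul_sum,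
    sum_quadraticChar_diag, hone, Finset.sum_const, nsmul_eq_mul, intCast_card_filter_ne, ZMod.card]
  ring

open Classical in
theorem sum_isHeis_add_sum_isElem {M : Type*} [AddCommMonoid M] (f : Param p → M) :
    ∑ t with t.IsHeis, f t + ∑ t with t.IsElem, f t = ∑ t with t.Valid, f t := by
  have hdisj : ∀ t : Param p, t.IsHeis → ¬ t.IsElem
    | .A _ _, h, h' => h.2 h'.2
    | .B _, h, h' => h.2 h'
    | .C _ _, h, h' => h.2 h'.2
  rw [← Finset.sum_union]
  · congr 1
    ext t
    simp only [Finset.mem_union, Finset.mem_filter_univ]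
    exact ⟨Or.rec IsHeis.valid IsElem.valid, Valid.isHeis_or_isElem⟩
  · exact Finset.disjoint_filter.2 fun t _ => hdisj t

variable (p) in
open Classical in
theorem sum_weight_isElem : ∑ t : Param p with t.IsElem, t.weight = (p ^ 2 - 2) * p ^ 2 := by
  rw [sum_isElem, sum_weight_A_diag]
  simp only [weight, Finset.sum_const, nsmul_eq_mul, intCast_card_filter_ne, ZMod.card]
  ring

variable (p) in
open Classical in
theorem sum_weight_isHeis : ∑ t : Param p with t.IsHeis, t.weight =
    (p ^ 4 - p ^ 3 - 2 * p ^ 2 + 2 * p + 1) * p := by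
  rw [eq_sub_of_add_eq (sum_isHeis_add_sum_isElem weight), sum_weight_isElem, sum_valid,
    sum_weight_A]
  simp only [weight, Finset.sum_const, nsmul_eq_mul, intCast_card_filter_ne, Finset.card_univ,
    ZMod.card]
  ring

variable (p) in
theorem card_isHeis : (Nat.card {t : Param p // t.IsHeis} : ℤ) = (2 * p - 3) * p := by
  classical
  have h := sum_isHeis_add_sum_isElem fun _ : Param p => (1 : ℤ)
  rw [← natCard_eq_sum, ← natCard_eq_sum, card_isElem, sum_valid] at h
  simp only [Finset.sum_const, nsmul_eq_mul, intCast_card_filter_ne, Finset.card_univ,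
    ZMod.card] at h
  linear_combination h

end Weight

variable [Fact (3 < p)]

section RingAut

variable {t : Param p} {u₂ u₃ v₂ x₃ a : ZMod p}

/-- The automorphisms of the skew brace with parameters `t`, as automorphisms of `Heis p`. -/
noncomputable def ringAutEquiv (ht : t.Valid) (h : Hol.IsRegular t.subgroup) :
    RingAut (Hol.Brace t.subgroup h) ≃
      {α : MulAut (Heis p) // Hol.Intertwines t.gamma t.gamma α} :=
  (Hol.Brace.isoEquiv h h).trans (Equiv.subtypeEquivRight fun α => by rw [ht.gamma_eq])

theorem isBraceAut_iff (ht : t.Valid) (h : Hol.IsRegular t.subgroup) (α : MulAut (Heis p)) :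
    IsBraceAut h α ↔ Hol.Intertwines t.gamma t.gamma α := by
  constructor
  · rintro ⟨φ, hφ⟩
    have hα : α = (ringAutEquiv ht h φ).1 := MulEquiv.ext fun n => (hφ n).symm
    exact hα ▸ (ringAutEquiv ht h φ).2
  · intro hα
    exact ⟨(ringAutEquiv ht h).symm ⟨α, hα⟩, fun x => rfl⟩

theorem exists_eq_alpha_pow_mul (α : MulAut (Heis p)) :
    ∃ (r₁ r₃ : ℕ) (β : GL (Fin 2) (ZMod p)), α = alpha1 p ^ r₁ * alpha3 p ^ r₃ * autGL β := by
  obtain ⟨r₁, r₃, β, rfl⟩ := exists_eq_aut α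
  obtain ⟨r₁, rfl⟩ := ZMod.natCast_zmod_surjective r₁
  obtain ⟨r₃, rfl⟩ := ZMod.natCast_zmod_surjective r₃
  exact ⟨r₁, r₃, β, aut_natCast r₁ r₃ β⟩

theorem isBraceAut_A_iff (hu : u₃ ≠ 0) (h : Hol.IsRegular (A u₂ u₃).subgroup)
    (α : MulAut (Heis p)) : IsBraceAut h α ↔
      ∃ (r₁ r₃ : ℕ) (b₁ b₂ : ZMod p) (β : GL (Fin 2) (ZMod p)),
        (β : Matrix (Fin 2) (Fin 2) (ZMod p)) = !![b₁, b₂; -b₂ * u₃, b₁ + b₂ * u₂] ∧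
        α = alpha1 p ^ r₁ * alpha3 p ^ r₃ * autGL β := by
  rw [isBraceAut_iff (t := .A u₂ u₃) hu]
  constructor
  · obtain ⟨r₁, r₃, β, rfl⟩ := exists_eq_alpha_pow_mul α
    rw [← aut_natCast, intertwines_A_iff hu hu]
    rintro ⟨-, h10, h11⟩
    exact ⟨r₁, r₃, _, _, β, congrArg Units.val (eq_mat rfl rfl h10 h11), aut_natCast r₁ r₃ β⟩
  · rintro ⟨r₁, r₃, b₁, b₂, β, hβ, rfl⟩
    rw [← aut_natCast, intertwines_A_iff hu hu, hβ]
    exact ⟨⟨rfl, rfl⟩, rfl, rfl⟩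

theorem isBraceAut_B (hv : v₂ ≠ 0) (h : Hol.IsRegular (B v₂).subgroup) (α : MulAut (Heis p)) :
    IsBraceAut h α ∧ ∃ (r₁ r₃ : ℕ) (β : GL (Fin 2) (ZMod p)),
      α = alpha1 p ^ r₁ * alpha3 p ^ r₃ * autGL β :=
  ⟨(isBraceAut_iff (t := .B v₂) hv h α).2 (intertwines_B hv α), exists_eq_alpha_pow_mul α⟩

theorem isBraceAut_C_iff (hx : x₃ ≠ 0) (h : Hol.IsRegular (C x₃ a).subgroup)
    (α : MulAut (Heis p)) : IsBraceAut h α ↔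
      ∃ (r₁ r₃ : ℕ) (b₁ b₃ : ZMod p) (β : GL (Fin 2) (ZMod p)),
        (β : Matrix (Fin 2) (Fin 2) (ZMod p)) = !![b₁, 0; b₃, b₁ ^ 2] ∧
        (r₃ : ZMod p) = (a + x₃⁻¹) * b₁⁻¹ * b₃ + (b₁ - 1) * (1 + a - x₃⁻¹) / 2 ∧
        α = alpha1 p ^ r₁ * alpha3 p ^ r₃ * autGL β := by
  rw [isBraceAut_iff (t := .C x₃ a) hx]
  constructor
  · obtain ⟨r₁, r₃, β, rfl⟩ := exists_eq_alpha_pow_mul α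
    rw [← aut_natCast, intertwines_C_iff]
    rintro ⟨-, h01, h11, hr⟩
    exact ⟨r₁, r₃, _, _, β, congrArg Units.val (eq_mat rfl h01 rfl h11), hr, aut_natCast r₁ r₃ β⟩
  · rintro ⟨r₁, r₃, b₁, b₃, β, hβ, hr, rfl⟩
    rw [← aut_natCast, intertwines_C_iff, hβ]
    exact ⟨⟨rfl, rfl⟩, rfl, rfl, hr⟩

/-- Coordinates on the automorphisms of the skew brace with parameters `A u₂ u₃`: the two exponents
`r₁`, `r₃` and the first row of the matrix, whose determinant is the quadratic form below. -/
noncomputable def intertwinersEquivA (hu : u₃ ≠ 0) :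
    {α : MulAut (Heis p) // Hol.Intertwines (A u₂ u₃).gamma (A u₂ u₃).gamma α} ≃
      ZMod p × ZMod p ×
        {b : ZMod p × ZMod p // b.1 ^ 2 + u₂ * (b.1 * b.2) + u₃ * b.2 ^ 2 ≠ 0} :=
  (autEquiv.subtypeEquiv (p := fun t => t.2.2.1 1 0 = -t.2.2.1 0 1 * u₃ ∧
      t.2.2.1 1 1 = t.2.2.1 0 0 + t.2.2.1 0 1 * u₂) fun _ =>
    ((intertwines_A_iff hu hu).trans (and_iff_right ⟨rfl, rfl⟩)).symm).symm.trans
  { toFun t := (t.1.1, t.1.2.1, ⟨(t.1.2.2.1 0 0, t.1.2.2.1 0 1), by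
      have hdet := det_ne_zero t.1.2.2
      rw [t.2.1, t.2.2] at hdet
      convert hdet using 1
      ring⟩)
    invFun s := ⟨(s.1, s.2.1, mat s.2.2.1.1 s.2.2.1.2 (-s.2.2.1.2 * u₃)
        (s.2.2.1.1 + s.2.2.1.2 * u₂) (by convert s.2.2.2 using 1; ring)), rfl, rfl⟩
    left_inv := by
      rintro ⟨⟨r₁, r₃, β⟩, h10, h11⟩
      exact Subtype.ext (Prod.ext rfl (Prod.ext rfl (eq_mat rfl rfl h10 h11).symm))
    right_inv _ := rfl }

/-- Coordinates on the automorphisms of the skew brace with parameters `C x₃ a`: the exponent `r₁`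
and the first column of the matrix. -/
noncomputable def intertwinersEquivC :
    {α : MulAut (Heis p) // Hol.Intertwines (C x₃ a).gamma (C x₃ a).gamma α} ≃
      ZMod p × (ZMod p)ˣ × ZMod p :=
  (autEquiv.subtypeEquiv (p := fun t => t.2.2.1 0 1 = 0 ∧ t.2.2.1 1 1 = t.2.2.1 0 0 ^ 2 ∧
      t.2.1 = (a + x₃⁻¹) * (t.2.2.1 0 0)⁻¹ * t.2.2.1 1 0 +
        (t.2.2.1 0 0 - 1) * (1 + a - x₃⁻¹) / 2) fun _ =>
    (intertwines_C_iff.trans (and_iff_right ⟨rfl, rfl⟩)).symm).symm.trans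
  { toFun t := (t.1.1, Units.mk0 (t.1.2.2.1 0 0) (apply_zero_zero_ne_zero t.2.1), t.1.2.2.1 1 0)
    invFun s := ⟨(s.1, (a + x₃⁻¹) * (s.2.1 : ZMod p)⁻¹ * s.2.2 + (s.2.1 - 1) * (1 + a - x₃⁻¹) / 2,
      mat s.2.1 0 s.2.2 (s.2.1 ^ 2) (by simp)), rfl, rfl, rfl⟩
    left_inv := by
      rintro ⟨⟨r₁, r₃, β⟩, h01, h11, hr⟩
      exact Subtype.ext (Prod.ext rfl (Prod.ext hr.symm (eq_mat rfl h01 rfl h11).symm))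
    right_inv _ := Prod.ext rfl (Prod.ext (Units.ext rfl) rfl) }

variable (p) in
theorem card_mulAut_int : (Nat.card (MulAut (Heis p)) : ℤ) = (p ^ 2 - 1) * (p ^ 2 - p) * p ^ 2 := by
  have h1 : 1 ≤ p := NeZero.one_le
  rw [card_mulAut, Nat.cast_mul, Nat.cast_mul, Nat.cast_sub (Nat.one_le_pow _ _ h1),
    Nat.cast_sub (Nat.le_self_pow two_ne_zero p), Nat.cast_pow, Nat.cast_one]
  ring

theorem card_ringAut_A (hu : u₃ ≠ 0) (h : Hol.IsRegular (A u₂ u₃).subgroup) :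
    (Nat.card (RingAut (Hol.Brace (A u₂ u₃).subgroup h)) : ℤ) =
      p ^ 2 * ((p - 1) * (p - quadraticChar (ZMod p) (u₂ ^ 2 - 4 * u₃))) := by
  rw [Nat.card_congr ((ringAutEquiv (t := .A u₂ u₃) hu h).trans (intertwinersEquivA hu)),
    Nat.card_prod, Nat.card_prod, Nat.card_zmod, Nat.card_eq_fintype_card, Fintype.card_subtype,
    Nat.cast_mul, Nat.cast_mul, card_filter_quadraticForm_ne_zero ringChar_zmod_ne_two, ZMod.card]
  ring

theorem card_ringAut_A_of_disc_eq_zero (hu : u₃ ≠ 0) (h : Hol.IsRegular (A u₂ u₃).subgroup)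
    (hD : u₂ ^ 2 - 4 * u₃ = 0) :
    (Nat.card (RingAut (Hol.Brace (A u₂ u₃).subgroup h)) : ℤ) = (p - 1) * p ^ 3 := by
  rw [card_ringAut_A hu, hD, MulChar.map_zero]
  ring

theorem card_ringAut_A_of_disc_isSquare (hu : u₃ ≠ 0) (h : Hol.IsRegular (A u₂ u₃).subgroup)
    (hD : u₂ ^ 2 - 4 * u₃ ≠ 0) (hs : IsSquare (u₂ ^ 2 - 4 * u₃)) :
    (Nat.card (RingAut (Hol.Brace (A u₂ u₃).subgroup h)) : ℤ) = (p - 1) ^ 2 * p ^ 2 := by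
  rw [card_ringAut_A hu, (quadraticChar_one_iff_isSquare hD).2 hs]
  ring

theorem card_ringAut_A_of_disc_not_isSquare (hu : u₃ ≠ 0) (h : Hol.IsRegular (A u₂ u₃).subgroup)
    (hs : ¬ IsSquare (u₂ ^ 2 - 4 * u₃)) :
    (Nat.card (RingAut (Hol.Brace (A u₂ u₃).subgroup h)) : ℤ) = (p ^ 2 - 1) * p ^ 2 := by
  rw [card_ringAut_A hu, quadraticChar_neg_one_iff_not_isSquare.2 hs]
  ring

theorem card_ringAut_B (hv : v₂ ≠ 0) (h : Hol.IsRegular (B v₂).subgroup) :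
    (Nat.card (RingAut (Hol.Brace (B v₂).subgroup h)) : ℤ) = (p ^ 2 - 1) * (p ^ 2 - p) * p ^ 2 := by
  rw [Nat.card_congr (ringAutEquiv (t := .B v₂) hv h), ← card_mulAut_int]
  exact congrArg _ (Nat.card_congr (Equiv.subtypeUnivEquiv (intertwines_B hv)))

theorem card_ringAut_C (hx : x₃ ≠ 0) (h : Hol.IsRegular (C x₃ a).subgroup) :
    (Nat.card (RingAut (Hol.Brace (C x₃ a).subgroup h)) : ℤ) = (p - 1) * p ^ 2 := by
  rw [Nat.card_congr ((ringAutEquiv (t := .C x₃ a) hx h).trans intertwinersEquivC),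
    Nat.card_prod, Nat.card_prod, Nat.card_zmod, Nat.card_units, Nat.card_zmod, Nat.cast_mul,
    Nat.cast_mul, Nat.cast_sub NeZero.one_le, Nat.cast_one]
  ring

theorem weight_mul_card_ringAut (ht : t.Valid) (h : Hol.IsRegular t.subgroup) :
    t.weight * Nat.card (RingAut (Hol.Brace t.subgroup h)) = Nat.card (MulAut (Heis p)) := by
  rw [card_mulAut_int]
  cases t with
  | A u₂ u₃ =>
    rw [card_ringAut_A ht h, weight]
    by_cases hD : u₂ ^ 2 - 4 * u₃ = 0
    · rw [if_pos hD, hD, MulChar.map_zero]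
      ring
    · rw [if_neg hD]
      rcases quadraticChar_dichotomy hD with hχ | hχ <;> rw [hχ] <;> ring
  | B v₂ => rw [card_ringAut_B ht h, weight, one_mul]
  | C x₃ a =>
    rw [card_ringAut_C ht h, weight]
    ring

end RingAut

open SkewBrace

section RegularSubgroups

variable {Γ : Type v} [Group Γ]

theorem card_isoBrace_mul {t : Param p} (ht : t.HasMulType Γ) :
    (Nat.card {M : Subgroup (Equiv.Perm Γ) // ∃ hM : IsRegularNormalised M,
      Nonempty (Hol.Brace t.subgroup ht.1.isRegular ≃+* hM.Brace)} : ℤ) *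
      Nat.card (MulAut (Heis p)) = Nat.card (MulAut Γ) * t.weight := by
  obtain ⟨φ⟩ := ht.2
  rw [← weight_mul_card_ringAut ht.1 ht.1.isRegular, ← card_mul_card_ringAut φ, Nat.cast_mul]
  ring

/-- The regular subgroups with a skew brace in question, sorted by its isomorphism class. -/
noncomputable def sigmaIsoBraceEquiv : (Σ t : {t : Param p // t.HasMulType Γ},
      {M : Subgroup (Equiv.Perm Γ) // ∃ hM : IsRegularNormalised M,
        Nonempty (Hol.Brace t.1.subgroup t.2.1.isRegular ≃+* hM.Brace)}) ≃
    {M : Subgroup (Equiv.Perm Γ) // ∃ hM : IsRegularNormalised M,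
      Nonempty (M ≃* Heis p) ∧ thetaCard hM.Brace = p ^ 2} := by
  refine Equiv.ofBijective (fun x => ⟨x.2.1, ?_⟩) ⟨?_, ?_⟩
  · obtain ⟨t, M, hM, ⟨f⟩⟩ := x
    exact ⟨hM, (hM.isBraceOf_iff _ (.refl Γ)).1 (t.2.isBraceOf.congr f)⟩
  · rintro ⟨t, M, hM, ⟨f⟩⟩ ⟨t', M', hM', ⟨f'⟩⟩ h
    obtain rfl : M = M' := congrArg Subtype.val h
    obtain rfl : t = t' := Subtype.ext (eq_of_iso t.2.1 t'.2.1 _ _ ⟨f.trans f'.symm⟩)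
    rfl
  · rintro ⟨M, hM, h⟩
    obtain ⟨t, ⟨ht, _, ⟨f⟩⟩, -⟩ :=
      existsUnique_hasMulType ((hM.isBraceOf_iff _ (.refl Γ)).2 h)
    exact ⟨⟨⟨t, ht⟩, M, hM, ⟨f.symm⟩⟩, rfl⟩

open Classical in
theorem card_isRegularNormalised_mul [Finite Γ] :
    (Nat.card {M : Subgroup (Equiv.Perm Γ) // ∃ hM : IsRegularNormalised M,
      Nonempty (M ≃* Heis p) ∧ thetaCard hM.Brace = p ^ 2} : ℤ) * Nat.card (MulAut (Heis p)) =
      Nat.card (MulAut Γ) * ∑ t : Param p with t.HasMulType Γ, t.weight := by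
  rw [← Nat.card_congr sigmaIsoBraceEquiv, Nat.card_sigma, Nat.cast_sum, Finset.sum_mul,
    Finset.sum_subtype _ (fun t => Finset.mem_filter_univ t) weight, Finset.mul_sum]
  exact Finset.sum_congr rfl fun t _ => card_isoBrace_mul t.2

end RegularSubgroups

variable (p) in
theorem card_mulAut_elemAb3 : (Nat.card (MulAut (ElemAb3 p)) : ℤ) =
    (p ^ 3 - 1) * Nat.card (MulAut (Heis p)) := by
  have h1 : 1 ≤ p := NeZero.one_le
  let e₁ : AddAut (Fin 3 → ZMod p) ≃ MulAut (ElemAb3 p) :=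
    AddEquiv.toMultiplicative.trans
      (MulAut.congr (MulEquiv.piMultiplicative (fun _ : Fin 3 => ZMod p))).toEquiv
  let e₂ : ((Fin 3 → ZMod p) ≃ₗ[ZMod p] (Fin 3 → ZMod p)) ≃ AddAut (Fin 3 → ZMod p) :=
    { toFun := fun f => f.toAddEquiv
      invFun := fun f => f.toLinearEquiv (fun c x => ZMod.map_smul f c x)
      left_inv := fun _ => rfl
      right_inv := fun _ => rfl }
  have hc := Nat.card_congr ((Matrix.GeneralLinearGroup.toLin.toEquiv.trans
    (LinearMap.GeneralLinearGroup.generalLinearEquiv _ _).toEquiv).trans (e₂.trans e₁))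
  rw [← hc, Matrix.card_GL_field, Fin.prod_univ_three, card_mulAut_int]
  simp only [ZMod.card, Fin.val_zero, Fin.val_one, Fin.val_two, pow_zero, pow_one]
  rw [Nat.cast_mul, Nat.cast_mul, Nat.cast_sub (Nat.one_le_pow _ _ h1),
    Nat.cast_sub (Nat.le_self_pow three_ne_zero p),
    Nat.cast_sub (Nat.pow_le_pow_right h1 (by norm_num))]
  push_cast
  ring

section Counting

variable (p)

theorem card_mulAut_ne_zero : (Nat.card (MulAut (Heis p)) : ℤ) ≠ 0 := by
  have : Finite (MulAut (Heis p)) := .of_equiv _ autEquiv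
  exact Nat.cast_ne_zero.2 Nat.card_pos.ne'

theorem numClasses_heis :
    (numClasses.{u} (Heis p) (Heis p) (p ^ 2) : ℤ) = (2 * p - 3) * p := by
  simp only [numClasses_eq, hasMulType_heis_iff, card_isHeis]

theorem numClasses_elemAb3 :
    (numClasses.{u} (ElemAb3 p) (Heis p) (p ^ 2) : ℤ) = 2 * p - 1 := by
  simp only [numClasses_eq, hasMulType_elemAb3_iff, card_isElem]

variable {p} {K : Type v} {L : Type w} [Field K] [Field L] [Algebra K L] [FiniteDimensional K L]
  [IsGalois K L]

theorem number_of_mulEquiv_heis (e : (L ≃ₐ[K] L) ≃* Heis p) :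
    (HopfGaloisStructure.number K L (Heis p) (p ^ 2) : ℤ) =
      (p ^ 4 - p ^ 3 - 2 * p ^ 2 + 2 * p + 1) * p := by
  classical
  refine mul_right_cancel₀ (card_mulAut_ne_zero p) ?_
  rw [HopfGaloisStructure.number_eq, card_isRegularNormalised_mul,
    Nat.card_congr (MulAut.congr e).toEquiv, mul_comm]
  simp only [hasMulType_congr e, hasMulType_heis_iff, sum_weight_isHeis]

theorem number_of_mulEquiv_elemAb3 (e : (L ≃ₐ[K] L) ≃* ElemAb3 p) :
    (HopfGaloisStructure.number K L (Heis p) (p ^ 2) : ℤ) =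
      (p ^ 3 - 1) * (p ^ 2 - 2) * p ^ 2 := by
  classical
  refine mul_right_cancel₀ (card_mulAut_ne_zero p) ?_
  rw [HopfGaloisStructure.number_eq, card_isRegularNormalised_mul,
    Nat.card_congr (MulAut.congr e).toEquiv, card_mulAut_elemAb3]
  simp only [hasMulType_congr e, hasMulType_elemAb3_iff, sum_weight_isElem]
  ring

end Counting

end Heis.Param

theorem lemma17 (p : ℕ) [Fact p.Prime] [Fact (3 < p)] :
    -- the number of isomorphism classes of skew braces
    ((SkewBrace.numClasses.{u} (Heis p) (Heis p) (p ^ 2) : ℤ) = (2 * p - 3) * p) ∧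
    ((SkewBrace.numClasses.{u} (ElemAb3 p) (Heis p) (p ^ 2) : ℤ) = 2 * p - 1) ∧
    -- the listed subgroups are regular with image of order `p ^ 2` and have the stated structure
    (∀ t : Heis.Param p, t.IsHeis → ∃ h : Hol.IsRegular t.subgroup,
      Nat.card (t.subgroup.map (Hol.Theta (Heis p))) = p ^ 2 ∧
      Nonempty (t.subgroup ≃* Heis p) ∧
      SkewBrace.IsBraceOf (Heis p) (Heis p) (p ^ 2) (Hol.Brace t.subgroup h)) ∧
    (∀ t : Heis.Param p, t.IsElem → ∃ h : Hol.IsRegular t.subgroup,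
      Nat.card (t.subgroup.map (Hol.Theta (Heis p))) = p ^ 2 ∧
      Nonempty (t.subgroup ≃* ElemAb3 p) ∧
      SkewBrace.IsBraceOf (ElemAb3 p) (Heis p) (p ^ 2) (Hol.Brace t.subgroup h)) ∧
    -- every skew brace in question is isomorphic to exactly one in the list
    (∀ (B : Type v) [SkewBrace B], SkewBrace.IsBraceOf (Heis p) (Heis p) (p ^ 2) B →
      ∃! t : Heis.Param p, t.IsHeis ∧
        ∃ h : Hol.IsRegular t.subgroup, Nonempty (B ≃+* Hol.Brace t.subgroup h)) ∧
    (∀ (B : Type v) [SkewBrace B], SkewBrace.IsBraceOf (ElemAb3 p) (Heis p) (p ^ 2) B →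
      ∃! t : Heis.Param p, t.IsElem ∧
        ∃ h : Hol.IsRegular t.subgroup, Nonempty (B ≃+* Hol.Brace t.subgroup h)) ∧
    -- the automorphism groups, family by family
    (∀ u₂ u₃ : ZMod p, u₃ ≠ 0 → ∃ h : Hol.IsRegular (Heis.Param.A u₂ u₃).subgroup,
      (∀ α : MulAut (Heis p), Heis.IsBraceAut h α ↔
        ∃ (r₁ r₃ : ℕ) (b₁ b₂ : ZMod p) (β : GL (Fin 2) (ZMod p)),
          (β : Matrix (Fin 2) (Fin 2) (ZMod p)) = !![b₁, b₂; -b₂ * u₃, b₁ + b₂ * u₂] ∧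
          α = Heis.alpha1 p ^ r₁ * Heis.alpha3 p ^ r₃ * Heis.autGL β) ∧
      (u₂ ^ 2 - 4 * u₃ = 0 →
        (Nat.card (RingAut (Hol.Brace _ h)) : ℤ) = (p - 1) * p ^ 3) ∧
      (u₂ ^ 2 - 4 * u₃ ≠ 0 → IsSquare (u₂ ^ 2 - 4 * u₃) →
        (Nat.card (RingAut (Hol.Brace _ h)) : ℤ) = (p - 1) ^ 2 * p ^ 2) ∧
      (¬ IsSquare (u₂ ^ 2 - 4 * u₃) →
        (Nat.card (RingAut (Hol.Brace _ h)) : ℤ) = (p ^ 2 - 1) * p ^ 2)) ∧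
    (∀ v₂ : ZMod p, v₂ ≠ 0 → ∃ h : Hol.IsRegular (Heis.Param.B v₂).subgroup,
      (∀ α : MulAut (Heis p), Heis.IsBraceAut h α ∧
        ∃ (r₁ r₃ : ℕ) (β : GL (Fin 2) (ZMod p)),
          α = Heis.alpha1 p ^ r₁ * Heis.alpha3 p ^ r₃ * Heis.autGL β) ∧
      (Nat.card (RingAut (Hol.Brace _ h)) : ℤ) = (p ^ 2 - 1) * (p ^ 2 - p) * p ^ 2) ∧
    (∀ x₃ a : ZMod p, x₃ ≠ 0 → ∃ h : Hol.IsRegular (Heis.Param.C x₃ a).subgroup,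
      (∀ α : MulAut (Heis p), Heis.IsBraceAut h α ↔
        ∃ (r₁ r₃ : ℕ) (b₁ b₃ : ZMod p) (β : GL (Fin 2) (ZMod p)),
          (β : Matrix (Fin 2) (Fin 2) (ZMod p)) = !![b₁, 0; b₃, b₁ ^ 2] ∧
          (r₃ : ZMod p) = (a + x₃⁻¹) * b₁⁻¹ * b₃ + (b₁ - 1) * (1 + a - x₃⁻¹) / 2 ∧
          α = Heis.alpha1 p ^ r₁ * Heis.alpha3 p ^ r₃ * Heis.autGL β) ∧
      (Nat.card (RingAut (Hol.Brace _ h)) : ℤ) = (p - 1) * p ^ 2) ∧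
    -- the number of Hopf-Galois structures
    (∀ (K : Type v) (L : Type w) [Field K] [Field L] [Algebra K L] [FiniteDimensional K L]
      [IsGalois K L], Nonempty ((L ≃ₐ[K] L) ≃* Heis p) →
      (HopfGaloisStructure.number K L (Heis p) (p ^ 2) : ℤ) =
        (p ^ 4 - p ^ 3 - 2 * p ^ 2 + 2 * p + 1) * p) ∧
    (∀ (K : Type v) (L : Type w) [Field K] [Field L] [Algebra K L] [FiniteDimensional K L]
      [IsGalois K L], Nonempty ((L ≃ₐ[K] L) ≃* ElemAb3 p) →
      (HopfGaloisStructure.number K L (Heis p) (p ^ 2) : ℤ) =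
        (p ^ 3 - 1) * (p ^ 2 - 2) * p ^ 2) := by
  refine ⟨Heis.Param.numClasses_heis p, Heis.Param.numClasses_elemAb3 p,
    fun t ht => (Heis.Param.hasMulType_heis_iff.2 ht).exists_isRegular,
    fun t ht => (Heis.Param.hasMulType_elemAb3_iff.2 ht).exists_isRegular,
    fun B _ hB => ?_, fun B _ hB => ?_, fun u₂ u₃ hu => ?_, fun v₂ hv => ?_, fun x₃ a hx => ?_,
    fun K L _ _ _ _ _ ⟨e⟩ => Heis.Param.number_of_mulEquiv_heis e,
    fun K L _ _ _ _ _ ⟨e⟩ => Heis.Param.number_of_mulEquiv_elemAb3 e⟩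
  · simpa only [Heis.Param.hasMulType_heis_iff] using Heis.Param.existsUnique_hasMulType hB
  · simpa only [Heis.Param.hasMulType_elemAb3_iff] using Heis.Param.existsUnique_hasMulType hB
  · exact ⟨Heis.Param.Valid.isRegular (t := .A u₂ u₃) hu, Heis.Param.isBraceAut_A_iff hu _,
      Heis.Param.card_ringAut_A_of_disc_eq_zero hu _,
      Heis.Param.card_ringAut_A_of_disc_isSquare hu _,
      Heis.Param.card_ringAut_A_of_disc_not_isSquare hu _⟩
  · exact ⟨Heis.Param.Valid.isRegular (t := .B v₂) hv, Heis.Param.isBraceAut_B hv _,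
      Heis.Param.card_ringAut_B hv _⟩
  · exact ⟨Heis.Param.Valid.isRegular (t := .C x₃ a) hx, Heis.Param.isBraceAut_C_iff hx _,
      Heis.Param.card_ringAut_C hx _⟩
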